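/- **Setting.** Let $\mathbb D$ be the open unit disk with boundary circle $\mathbb S^1$. A map $A:\mathbb S^1\to\mathbb S^1$ is given with cyclically (counter-clockwise) ordered break-points $x_1,\dots,x_k$, arcs $I_j=[x_j,x_{j+1}]$ (indices mod $k$) and pieces $g_j\in\mathrm{Aut}(\mathbb D)$ with $A|_{I_j}=g_j|_{I_j}$; $\Gamma=\langle g_1,\dots,g_k\rangle$ is the group generated by the pieces, and $\mathrm{GO}_A(x)=\{x': A^{\circ m}(x)=A^{\circ n}(x')\text{ for some }m,n\ge 0\}$. The map $A$ is *mateable* if * $\Gamma$ is Fuchsian (discrete), $A$ is an expansive covering of $\mathbb S^1$ of degree at least $2$, and the arcs $I_j$ form a Markov partition for $A$; * $\Gamma\cdot x=\mathrm{GO}_A(x)$ for every $x$ in the limit set of $\Gamma$; * no periodic break-point is asymmetrically hyperbolic, i.e. has both one-sided multipliers $>1$ and different from each other. It is *minimal* if there are no $j$ and $h\in\Gamma$ with $A=h$ on both $I_{j-1}$ and $I_j$. Let $R_j\subset\overline{\mathbb D}$ be the closed region bounded by $I_j$ and the hyperbolic geodesic joining its endpoints, $\Omega=\bigcup_j R_j$,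 $\widehat A:\Omega\to\overline{\mathbb D}$ the canonical extension ($\widehat A=g_j$ on $R_j$), and $R=\mathbb D\setminus\Omega$. The vertices of $R$ are the $x_j$; the edges of $R$ are the bi-infinite geodesics contained in $\partial R$; a diagonal of $R$ is the geodesic joining two distinct vertices that are not joined by an edge. $\widehat A$ *has a folding* if $\widehat A(\alpha)=\widehat A(\beta)$ for two adjacent edges $\alpha,\beta$ of $R$. The *inner domain* $D$ is the interior of the hyperbolic convex hull of the vertices fixed by $A$, and $\overline D$ is its closure in $\mathbb D$. Geodesics are identified with their pairs of ideal endpoints. For an edge $\alpha$, iterate $\widehat A$ on $\alpha$ as long as the image geodesic lies in $\Omega$ (the first image not contained in $\Omega$ is kept, and iteration stops there); $\widehat{\mathrm{GO}}_A(\alpha)$ is the set of geodesics some iterate of which (possibly the zeroth) under $\widehat A$ equals one of these forward images. For a pair $\{p,q\}$ of distinct points of $\mathbb S^1$, let $\mathbf dA\{p,q\}=\{A(p),A(q)\}$; an $A$-pre-image of $\{p,q\}$ is a pair $\{h(p),h(q)\}$ with $h\in\Gamma$ a branch of $A^{-1}$ on an arc containing $p$ and $q$. $\mathrm{GO}_A\{p,q\}$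 is the union of the forward $\mathbf dA$-orbit of $\{p,q\}$ (stopped if the two points collide, the degenerate pair being included) and of all iterated $A$-pre-images of its non-degenerate elements. $\widehat A$ is *edge-orbit equivalent* to $\Gamma$ if $\widehat{\mathrm{GO}}_A(\alpha)=\mathrm{GO}_A(\alpha)=\Gamma\cdot\alpha$ for every edge $\alpha$ of $R$, and if the endpoints of every diagonal of $R$ that is periodic under $\mathbf dA$ are fixed by $A$. **Proposition.** Let $A$ be a minimal mateable map without folding such that $\Gamma$ is torsion-free and $\widehat A$ is edge-orbit equivalent to $\Gamma$. Then either $\widehat A(\partial R)=\partial R$, or for every edge $\alpha$ of $R$ there is $n\in\mathbb N$ such that $\widehat A^{\circ n}(\alpha)$ is a diagonal of $R$ contained in $\overline D$. Further, 1. $\overline D\subset R$; 2. for every edge $\alpha$ of $R$, $\widehat A(\alpha)$ is either an edge of $R$ or a diagonal of $R$ contained in $\overline D$. In either case, $\mathbb D/\Gamma$ is homeomorphic to a sphere with a finite non-empty set of points removed. -/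

import Mathlib

open Filter Topology

noncomputable section

namespace Mating

/-- The closed unit disk in `ℂ`. -/
abbrev ClosedDisk : Type := Metric.closedBall (0 : ℂ) 1

/-- The unit circle as the boundary of the closed unit disk. -/
def toDisk (x : Circle) : ClosedDisk := ⟨(x : ℂ), by
  rw [mem_closedBall_zero_iff, Circle.norm_coe]⟩

/-- The open unit disk `𝔻`, as a subset of the closed disk. -/
def openDisk : Set ClosedDisk := {z | ‖(z : ℂ)‖ < 1}

/-! ### Automorphisms of the disk and Fuchsian groups -/

/-- A homeomorphism of the closed disk is Möbius if it has the form
`z ↦ (a z + b) / (conj b z + conj a)` with `|b| < |a|`. -/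
def IsMobius (f : ClosedDisk ≃ₜ ClosedDisk) : Prop :=
  ∃ a b : ℂ, ‖b‖ < ‖a‖ ∧ ∀ z : ClosedDisk,
    ((f z : ClosedDisk) : ℂ) =
      (a * (z : ℂ) + b) / ((starRingEnd ℂ) b * (z : ℂ) + (starRingEnd ℂ) a)

theorem denom_ne_zero {a b : ℂ} (h : ‖b‖ < ‖a‖) (z : ClosedDisk) :
    (starRingEnd ℂ) b * (z : ℂ) + (starRingEnd ℂ) a ≠ 0 := by
  intro h0
  have hz : ‖(z : ℂ)‖ ≤ 1 := mem_closedBall_zero_iff.mp z.2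
  have h1 : (starRingEnd ℂ) a = -((starRingEnd ℂ) b * (z : ℂ)) := by
    linear_combination h0
  have h2 : ‖a‖ = ‖b‖ * ‖(z : ℂ)‖ := by
    have := congrArg norm h1
    simpa using this
  nlinarith [norm_nonneg b, norm_nonneg (z : ℂ)]

theorem norm_sub_sq {a b : ℂ} (h : ‖b‖ < ‖a‖) :
    0 < Complex.normSq a - Complex.normSq b := by
  rw [Complex.normSq_eq_norm_sq, Complex.normSq_eq_norm_sq]
  nlinarith [norm_nonneg b]

theorem norm_lt_of_normSq {a b : ℂ} (h : Complex.normSq b < Complex.normSq a) :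
    ‖b‖ < ‖a‖ := by
  rw [Complex.normSq_eq_norm_sq, Complex.normSq_eq_norm_sq] at h
  exact lt_of_pow_lt_pow_left₀ 2 (norm_nonneg a) h

/-- The group `Aut(𝔻)` of conformal automorphisms of the unit disk, each one extended to the
closed disk. -/
def diskAut : Subgroup (ClosedDisk ≃ₜ ClosedDisk) where
  carrier := {f | IsMobius f}
  one_mem' := ⟨1, 0, by simp, fun z => by simp⟩
  mul_mem' := by
    rintro f g ⟨a, b, hab, hf⟩ ⟨c, d, hcd, hg⟩
    refine ⟨a * c + b * (starRingEnd ℂ) d, a * d + b * (starRingEnd ℂ) c, ?_, fun z => ?_⟩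
    · apply norm_lt_of_normSq
      have h1 := norm_sub_sq hab
      have h2 := norm_sub_sq hcd
      have h3 := mul_pos h1 h2
      simp only [Complex.normSq_apply, Complex.add_re, Complex.add_im, Complex.mul_re,
        Complex.mul_im, Complex.conj_re, Complex.conj_im] at h3 ⊢
      nlinarith [h3]
    · have e1 := denom_ne_zero hcd z
      have e2 := denom_ne_zero hab (g z)
      have hg' := hg z
      have hf' := hf (g z)
      rw [eq_div_iff e1] at hg'
      rw [eq_div_iff e2] at hf'
      have e3 : ((f * g) z : ClosedDisk) = f (g z) := rfl
      rw [e3]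
      simp only [map_add, map_mul, Complex.conj_conj]
      generalize ((g z : ClosedDisk) : ℂ) = v at *
      generalize ((f (g z) : ClosedDisk) : ℂ) = w at *
      have e4 : ((starRingEnd ℂ) a * (starRingEnd ℂ) d + (starRingEnd ℂ) b * c) * (z : ℂ)
          + ((starRingEnd ℂ) a * (starRingEnd ℂ) c + (starRingEnd ℂ) b * d)
          = ((starRingEnd ℂ) d * (z : ℂ) + (starRingEnd ℂ) c)
            * ((starRingEnd ℂ) b * v + (starRingEnd ℂ) a) := by
        linear_combination -(starRingEnd ℂ) b * hg'
      rw [e4, eq_div_iff (mul_ne_zero e1 e2)]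
      linear_combination ((starRingEnd ℂ) d * (z : ℂ) + (starRingEnd ℂ) c) * hf' + a * hg'
  inv_mem' := by
    rintro f ⟨a, b, hab, hf⟩
    refine ⟨(starRingEnd ℂ) a, -b, by simpa using hab, fun z => ?_⟩
    have e3 : (f⁻¹ z : ClosedDisk) = f.symm z := rfl
    rw [e3]
    have h1 := hf (f.symm z)
    rw [f.apply_symm_apply] at h1
    have e1 := denom_ne_zero hab (f.symm z)
    have e2 := denom_ne_zero (a := (starRingEnd ℂ) a) (b := -b) (by simpa using hab) z
    rw [eq_div_iff e1] at h1
    rw [eq_div_iff e2]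
    simp only [map_neg, Complex.conj_conj]
    linear_combination -h1

theorem norm_apply_toDisk (h : diskAut) (x : Circle) :
    ‖((h.1 (toDisk x) : ClosedDisk) : ℂ)‖ = 1 := by
  obtain ⟨f, a, b, hab, hf⟩ := h
  change ‖((f (toDisk x) : ClosedDisk) : ℂ)‖ = 1
  rw [hf, norm_div]
  have e1 := denom_ne_zero hab (toDisk x)
  rw [div_eq_one_iff_eq (norm_ne_zero_iff.mpr e1)]
  have hx : (starRingEnd ℂ) (x : ℂ) * (x : ℂ) = 1 := by
    rw [mul_comm, Complex.mul_conj]; simp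
  have e2 : (starRingEnd ℂ) (a * (x : ℂ) + b) * (x : ℂ)
      = (starRingEnd ℂ) b * (x : ℂ) + (starRingEnd ℂ) a := by
    simp only [map_add, map_mul]
    linear_combination (starRingEnd ℂ) a * hx
  change ‖a * (x : ℂ) + b‖ = ‖(starRingEnd ℂ) b * (x : ℂ) + (starRingEnd ℂ) a‖
  rw [← e2, norm_mul, RCLike.norm_conj, Circle.norm_coe, mul_one]

/-- The action of `Aut(𝔻)` on the unit circle. -/
def onCircle (h : diskAut) (x : Circle) : Circle :=
  ⟨((h.1 (toDisk x) : ClosedDisk) : ℂ), mem_sphere_zero_iff_norm.mpr (norm_apply_toDisk h x)⟩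

/-- A Fuchsian group: a discrete subgroup of `Aut(𝔻)` (the identity is isolated for uniform
convergence on the closed disk). -/
def IsFuchsian (Γ : Subgroup diskAut) : Prop :=
  ∃ ε : ℝ, 0 < ε ∧ ∀ h ∈ Γ, (∀ z : ClosedDisk, dist (h.1 z) z < ε) → h = 1

def IsTorsionFree (Γ : Subgroup diskAut) : Prop :=
  ∀ h ∈ Γ, ∀ n : ℕ, 0 < n → h ^ n = 1 → h = 1

/-- The limit set of a Fuchsian group: the points of the circle at which the orbit of the
centre of the disk accumulates. -/
def limitSet (Γ : Subgroup diskAut) : Set Circle :=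
  {x | toDisk x ∈ closure {z : ClosedDisk | ∃ h ∈ Γ, z = h.1 ⟨0, Metric.mem_closedBall_self zero_le_one⟩}}

/-- Two points of the open disk are identified if they lie in the same `Γ`-orbit. -/
def orbitSetoid (Γ : Subgroup diskAut) : Setoid openDisk where
  r z w := ∃ h ∈ Γ, h.1 (z : ClosedDisk) = (w : ClosedDisk)
  iseqv :=
    { refl := fun z => ⟨1, Γ.one_mem, rfl⟩
      symm := by
        rintro z w ⟨h, hh, e⟩
        exact ⟨h⁻¹, Γ.inv_mem hh, by rw [← e]; exact h.1.symm_apply_apply _⟩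
      trans := by
        rintro z w v ⟨h, hh, e⟩ ⟨h', hh', e'⟩
        exact ⟨h' * h, Γ.mul_mem hh' hh, by rw [← e', ← e]; rfl⟩ }

/-- The quotient surface `𝔻/Γ`, with the quotient topology. -/
abbrev QuotientSurface (Γ : Subgroup diskAut) : Type := Quotient (orbitSetoid Γ)

/-- The `2`-sphere. -/
abbrev Sphere2 : Type := Metric.sphere (0 : EuclideanSpace ℝ (Fin 3)) 1

/-- A topological space is a punctured sphere if it is homeomorphic to the `2`-sphere with a
finite nonempty set of points removed. -/
def IsPuncturedSphere (X : Type) [TopologicalSpace X] : Prop :=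
  ∃ F : Set Sphere2, F.Finite ∧ F.Nonempty ∧ Nonempty (X ≃ₜ (Fᶜ : Set Sphere2))

/-! ### Hyperbolic geodesics, half-planes and convex hulls -/

/-- For distinct `p, q` on the unit circle, the equation `side p q z = 0` is that of the
Euclidean circle (or line) through `p` and `q` orthogonal to the unit circle; `side p q z` is
positive on the side of it containing the open counter-clockwise arc from `p` to `q`. -/
def side (p q : Circle) (z : ClosedDisk) : ℝ :=
  2 * ((z : ℂ) * (starRingEnd ℂ) ((p : ℂ) - (q : ℂ))).im
    + ((p : ℂ) * (starRingEnd ℂ) (q : ℂ)).im * (1 + ‖(z : ℂ)‖ ^ 2)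

theorem side_swap (p q : Circle) (z : ClosedDisk) : side q p z = -side p q z := by
  simp only [side, map_sub, Complex.mul_im, Complex.sub_re, Complex.sub_im, Complex.conj_re,
    Complex.conj_im]
  ring

/-- The closed region of the closed disk bounded by the geodesic joining `p` and `q` and the
closed counter-clockwise arc from `p` to `q`. -/
def halfPlane (p q : Circle) : Set ClosedDisk := {z | 0 ≤ side p q z}

/-- The bi-infinite geodesic in `𝔻` with the given pair of distinct ideal endpoints
(meaningful for `¬ e.IsDiag` only). -/
def geodesic (e : Sym2 Circle) : Set ClosedDisk :=
  Sym2.lift ⟨fun p q => {z : ClosedDisk | z ∈ openDisk ∧ side p q z = 0}, by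
    intro p q
    ext z
    simp [side_swap p q z]⟩ e

/-- The hyperbolic convex hull in `𝔻` of a set of ideal points: the intersection of all closed
half-planes whose ideal boundary contains the set. -/
def idealHull (W : Set Circle) : Set ClosedDisk :=
  {z | z ∈ openDisk ∧ ∀ p q : Circle, p ≠ q → (∀ w ∈ W, toDisk w ∈ halfPlane p q) →
    z ∈ halfPlane p q}

/-! ### Piecewise Möbius maps -/

/-- A piecewise Möbius self-map `A` of the circle, together with its decomposition into pieces.
There are `k` pieces. The break-points `x j = exp (i θ j)` are indexed cyclically: `j` ranges
over `ℤ` and everything is `k`-periodic in `j`. On the closed arc `I j` from `x j` to `x (j+1)`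
the map `A` is equal to `g j ∈ Aut(𝔻)`. -/
structure PiecewiseMobius where
  A : Circle → Circle
  k : ℕ
  k_pos : 0 < k
  θ : ℤ → ℝ
  θ_strictMono : StrictMono θ
  θ_periodic : ∀ j, θ (j + k) = θ j + 2 * Real.pi
  g : ℤ → diskAut
  g_periodic : ∀ j, g (j + k) = g j
  eq_piece : ∀ j, ∀ t ∈ Set.Icc (θ j) (θ (j + 1)),
    A (Circle.exp t) = onCircle (g j) (Circle.exp t)

namespace PiecewiseMobius

variable (P : PiecewiseMobius)

/-- The break-points. -/
def x (j : ℤ) : Circle := Circle.exp (P.θ j)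

/-- The closed arcs `I j`. -/
def arc (j : ℤ) : Set Circle := Circle.exp '' Set.Icc (P.θ j) (P.θ (j + 1))

/-- The interiors of the arcs `I j`. -/
def arcInt (j : ℤ) : Set Circle := Circle.exp '' Set.Ioo (P.θ j) (P.θ (j + 1))

/-- The group `Γ_A` generated by the pieces. -/
def group : Subgroup diskAut := Subgroup.closure (Set.range P.g)

/-- The set `S` of vertices. -/
def vertices : Set Circle := Set.range P.x

def IsExpansive (f : Circle → Circle) : Prop :=
  ∃ δ : ℝ, 0 < δ ∧ ∀ a b : Circle, a ≠ b → ∃ n : ℕ, δ < dist (f^[n] a) (f^[n] b)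

/-- `f` is a covering of the circle of degree at least two. -/
def IsHigherDegreeCovering (f : Circle → Circle) : Prop :=
  IsCoveringMap f ∧ ∃ d : ℕ, 2 ≤ d ∧ ∀ y, (f ⁻¹' {y}).ncard = d

/-- The intervals of definition form a Markov partition. -/
def IsMarkov : Prop :=
  ∀ i j, (P.A '' P.arcInt i ∩ P.arcInt j).Nonempty → P.arcInt j ⊆ P.A '' P.arcInt i

/-- Piecewise Fuchsian Markov maps. -/
def IsPiecewiseFuchsianMarkov : Prop :=
  IsFuchsian P.group ∧ IsExpansive P.A ∧ IsHigherDegreeCovering P.A ∧ P.IsMarkov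

/-- There are no superfluous break-points. -/
def IsMinimal : Prop :=
  ¬ ∃ j : ℤ, ∃ h ∈ P.group, (∀ z ∈ P.arc j, P.A z = onCircle h z) ∧
    (∀ z ∈ P.arc (j - 1), P.A z = onCircle h z)

/-! ### Mateable maps -/

/-- The grand orbit of a point of the circle. -/
def pointGrandOrbit (y : Circle) : Set Circle :=
  {y' | ∃ m n : ℕ, P.A^[m] y = P.A^[n] y'}

/-- `A` is orbit equivalent to `Γ` on the limit set. -/
def IsOrbitEquivalent (Γ : Subgroup diskAut) : Prop :=
  ∀ y ∈ limitSet Γ, {y' | ∃ h ∈ Γ, y' = onCircle h y} = P.pointGrandOrbit y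

/-- `m` is the one-sided derivative of `f` at its fixed point `y`; the side is that of the
points `y * exp (i t)`, with `t` tending to zero along the filter `l`. -/
def HasMultiplier (f : Circle → Circle) (y : Circle) (l : Filter ℝ) (m : ℝ) : Prop :=
  Tendsto (fun t : ℝ => ((f (y * Circle.exp t) : ℂ) - (y : ℂ)) /
    (((y * Circle.exp t : Circle) : ℂ) - (y : ℂ))) l (𝓝 (m : ℂ))

/-- The periodic point `y` of `A` is hyperbolic on both sides, with different multipliers. -/
def IsAsymmetricallyHyperbolic (y : Circle) : Prop :=
  ∃ m₁ m₂ : ℝ, HasMultiplier (P.A^[Function.minimalPeriod P.A y]) y (𝓝[>] 0) m₁ ∧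
    HasMultiplier (P.A^[Function.minimalPeriod P.A y]) y (𝓝[<] 0) m₂ ∧
    1 < m₁ ∧ 1 < m₂ ∧ m₁ ≠ m₂

/-- Mateable maps. -/
def IsMateable : Prop :=
  P.IsPiecewiseFuchsianMarkov ∧ P.IsOrbitEquivalent P.group ∧
    ∀ y ∈ P.vertices, y ∈ Function.periodicPts P.A → ¬ P.IsAsymmetricallyHyperbolic y

/-! ### The canonical extension and the fundamental domain -/

/-- The closed region `R j` cut off by the geodesic joining the ends of `I j`. -/
def region (j : ℤ) : Set ClosedDisk := halfPlane (P.x j) (P.x (j + 1))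

/-- The canonical domain of definition of the canonical extension `Â`. -/
def Ω : Set ClosedDisk := ⋃ j, P.region j

/-- The image `Â(E ∩ Ω)` of a set under the canonical extension `Â`, which equals `g j` on
`R j`. -/
def extImage (E : Set ClosedDisk) : Set ClosedDisk :=
  ⋃ j, (P.g j).1 '' (E ∩ P.region j)

/-- The fundamental domain `R = 𝔻 ∖ Ω`. -/
def R : Set ClosedDisk := openDisk \ P.Ω

/-- The edges of `R`: the bi-infinite geodesics contained in `∂R`, given by their pairs of
ideal endpoints. -/
def IsEdge (e : Sym2 Circle) : Prop := ¬ e.IsDiag ∧ geodesic e ⊆ frontier P.R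

/-- The diagonals of `R`: the pairs of non-adjacent vertices. -/
def IsDiagonal (e : Sym2 Circle) : Prop :=
  ¬ e.IsDiag ∧ (∀ p ∈ e, p ∈ P.vertices) ∧ ¬ P.IsEdge e

/-- Two different edges with a common ideal vertex have the same image under `Â`. -/
def HasFolding : Prop :=
  ∃ p q r : Circle, p ≠ r ∧ P.IsEdge s(p, q) ∧ P.IsEdge s(q, r) ∧
    P.extImage (geodesic s(p, q)) = P.extImage (geodesic s(q, r))

/-- The inner domain `D`: the interior of the convex hull of the vertices fixed by `A`. -/
def innerDomain : Set ClosedDisk :=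
  interior (idealHull {w | w ∈ P.vertices ∧ P.A w = w})

/-- The closure of the inner domain in `𝔻`. -/
def innerDomainClosure : Set ClosedDisk := closure P.innerDomain ∩ openDisk

/-! ### Grand orbits of geodesics and edge-orbit equivalence -/

/-- The geodesic `e` is contained in `Ω`, and `Â` maps it onto the geodesic `f`. -/
def ExtStep (e f : Sym2 Circle) : Prop :=
  ¬ e.IsDiag ∧ ¬ f.IsDiag ∧ geodesic e ⊆ P.Ω ∧ P.extImage (geodesic e) = geodesic f

/-- Some iterate of `Â` (possibly the identity) is defined on the geodesic `e` and maps it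
onto the geodesic `f`; forward iteration stops when `Ω` is left. -/
def ExtReaches (e f : Sym2 Circle) : Prop := Relation.ReflTransGen P.ExtStep e f

/-- The grand orbit of a geodesic under `Â`: all iterated preimages of all its forward
iterates. -/
def extGrandOrbit (e : Sym2 Circle) : Set (Sym2 Circle) :=
  {b | ∃ f, P.ExtReaches e f ∧ P.ExtReaches b f}

/-- The forward orbit of a pair of points under the map induced by `A`; it stops when the two
points collide. -/
def pairForwardOrbit (e : Sym2 Circle) : Set (Sym2 Circle) :=
  {f | Relation.ReflTransGen (fun a b : Sym2 Circle => ¬ a.IsDiag ∧ b = a.map P.A) e f}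

/-- `b` is an `A`-preimage of `e = {p, q}`: there is a branch `h ∈ Γ_A` of `A⁻¹`, defined on an
arc `σ` containing `p` and `q`, with `b = {h p, h q}`. -/
def IsPairPreimage (e b : Sym2 Circle) : Prop :=
  ∃ h ∈ P.group, ∃ σ : Set Circle, IsConnected σ ∧ (∀ z ∈ σ, P.A (onCircle h z) = z) ∧
    (∀ p ∈ e, p ∈ σ) ∧ b = e.map (onCircle h)

/-- All iterated `A`-preimages of a pair, including the pair itself. -/
def pairBackwardOrbit (e : Sym2 Circle) : Set (Sym2 Circle) :=
  {b | Relation.ReflTransGen P.IsPairPreimage e b}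

/-- The grand orbit of a pair of points under `A`: its forward orbit together with the backward
orbits of the elements of the forward orbit (that of a degenerate pair being empty). -/
def pairGrandOrbit (e : Sym2 Circle) : Set (Sym2 Circle) :=
  P.pairForwardOrbit e ∪
    {b | ∃ f ∈ P.pairForwardOrbit e, ¬ f.IsDiag ∧ b ∈ P.pairBackwardOrbit f}

/-- The `Γ`-orbit of a pair of points of the circle. -/
def pairGroupOrbit (Γ : Subgroup diskAut) (e : Sym2 Circle) : Set (Sym2 Circle) :=
  {b | ∃ h ∈ Γ, b = e.map (onCircle h)}

/-- `Â` is edge-orbit equivalent to `Γ`. -/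
def IsEdgeOrbitEquivalent (Γ : Subgroup diskAut) : Prop :=
  (∀ e, P.IsEdge e → P.extGrandOrbit e = P.pairGrandOrbit e ∧
    P.pairGrandOrbit e = pairGroupOrbit Γ e) ∧
  (∀ e, P.IsDiagonal e → e ∈ Function.periodicPts (Sym2.map P.A) → ∀ p ∈ e, P.A p = p)

end PiecewiseMobius

end Mating

end

/-!
In the Klein model geodesics become chords (`side_eq_chord`), so that convexity and the relative
position of geodesics reduce to the cyclic order `ccw` of points of the circle. Automorphisms of the
disk preserve this order and map geodesics to geodesics (`ccw_onCircle`).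

*Translates of edges.* By edge-orbit equivalence, every translate of an edge under `Γ` either has
both endpoints on one arc `I j`, or is a diagonal of `R` the endpoints of which are fixed by `A`
(`arc_or_diagonal`), and equivalent diagonals are equal (`eq_of_isDiagonal`). Since arcs and
diagonals leave little room, translates of edges do not cross each other (`not_cross`), and their
stabilizers in the torsion-free group `Γ` are trivial (`eq_one_of_map_eq`). In particular, two
adjacent vertices are never both fixed (`not_both_fixed`). As the inner domain is spanned by fixed
vertices, this already shows that its closure lies in `R` (`innerDomainClosure_subset_R`).

*The dichotomy.* Suppose that some edge never reaches a diagonal. If others do, there is a vertex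
with edges of both kinds, and pushing it forward leads to such a vertex which is fixed. At a fixed
vertex without folding, an edge which stays an edge must be exchanged with its neighbour, and
continuing along `∂R` one finds that `A` acts on the vertices as a reflection. Hence all edges are
mapped to edges (`hits_or_isEdge`), so that `Â(∂R) = ∂R` (`extImage_frontier`). Otherwise all edges
reach diagonals with fixed endpoints, and these lie in the closure of the inner domain
(`geodesic_subset_of_isDiagonal`).

*A fundamental polygon.* If edges are mapped to edges, the sides of `R` are paired by a mirror
symmetry (`exists_reflection`). Otherwise there is a chain of edges between two consecutive fixed
vertices all edges of which are mapped to diagonals (`exists_direct_chain`). Minimality makes the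
images of two adjacent edges extremal among the diagonals at their common vertex
(`not_cyc_of_not_fixed`), and between the endpoints of an image there is no further fixed vertex
(`no_fixed_between`). So the images of the vertices of the chain run once through all fixed vertices
in the reversed order (`exists_fan`), and the polygon with these edges and diagonals as sides has
again a mirror-symmetric side pairing. Both polygons are instances of `FoldedPolygon`: their
translates are disjoint because a translate of a side which enters `R` is a diagonal joining fixed
vertices and hence avoids the polygon (`isDiagonal_of_mem_R`, `IdealPolygon.eq_one_of_mem_inner`),
and they cover the disk because of expansivity: a point never brought to the closure of `R` would
produce infinitely many points of the circle with the same itinerary (`exists_mem_closure_R`,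
`finite_of_expansive`).

*The quotient surface.* The chords joining the paired points on the boundary of a folded polygon
are pairwise disjoint (`FoldedPolygon.strip_ne`) and sweep out the polygon
(`FoldedPolygon.exists_strip_eq`). Gluing the two ends of each chord gives a circle, and these
circles correspond to the circles of latitude of the sphere; the ideal vertices become the punctures
(`FoldedPolygon.isPuncturedSphere`).
-/

noncomputable section

namespace Mating

open Complex

/-! ### The action of `Aut(𝔻)` on the circle -/

theorem toDisk_onCircle (h : diskAut) (p : Circle) : toDisk (onCircle h p) = h.1 (toDisk p) :=
  Subtype.ext rfl

theorem toDisk_injective : Function.Injective toDisk := fun _ _ h =>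
  Circle.ext (congrArg (Subtype.val : ClosedDisk → ℂ) h)

theorem onCircle_mul (h g : diskAut) (p : Circle) :
    onCircle (h * g) p = onCircle h (onCircle g p) := by
  apply toDisk_injective
  rw [toDisk_onCircle, toDisk_onCircle, toDisk_onCircle]; rfl

@[simp] theorem onCircle_one (p : Circle) : onCircle 1 p = p := by
  apply toDisk_injective
  rw [toDisk_onCircle]; rfl

@[simp] theorem onCircle_inv_apply (h : diskAut) (p : Circle) :
    onCircle h⁻¹ (onCircle h p) = p := by
  rw [← onCircle_mul]; simp

@[simp] theorem onCircle_apply_inv (h : diskAut) (p : Circle) :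
    onCircle h (onCircle h⁻¹ p) = p := by
  rw [← onCircle_mul]; simp

theorem onCircle_injective (h : diskAut) : Function.Injective (onCircle h) := fun p q e => by
  rw [← onCircle_inv_apply h p, e, onCircle_inv_apply]

theorem inv_apply_apply (h : diskAut) (z : ClosedDisk) : (h⁻¹).1 (h.1 z) = z :=
  h.1.symm_apply_apply z

theorem apply_inv_apply (h : diskAut) (z : ClosedDisk) : h.1 ((h⁻¹).1 z) = z :=
  h.1.apply_symm_apply z

theorem continuous_toDisk : Continuous toDisk :=
  Continuous.subtype_mk continuous_subtype_val _

theorem continuous_onCircle (h : diskAut) : Continuous (onCircle h) :=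
  Continuous.subtype_mk
    (continuous_subtype_val.comp (h.1.continuous.comp continuous_toDisk)) _

theorem exists_toDisk_of_norm_eq {z : ClosedDisk} (h : ‖(z : ℂ)‖ = 1) : ∃ p, toDisk p = z :=
  ⟨⟨z, mem_sphere_zero_iff_norm.mpr h⟩, rfl⟩

theorem toDisk_not_mem_openDisk (p : Circle) : toDisk p ∉ openDisk := by
  intro h
  have h1 : ‖((toDisk p : ClosedDisk) : ℂ)‖ < 1 := h
  have h2 : ‖((toDisk p : ClosedDisk) : ℂ)‖ = 1 := Circle.norm_coe p
  linarith

theorem not_mem_openDisk_iff {z : ClosedDisk} : z ∉ openDisk ↔ ∃ p, toDisk p = z := by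
  constructor
  · intro h
    apply exists_toDisk_of_norm_eq
    have h1 : ¬ ‖(z : ℂ)‖ < 1 := h
    have h2 : ‖(z : ℂ)‖ ≤ 1 := mem_closedBall_zero_iff.mp z.2
    linarith
  · rintro ⟨p, rfl⟩
    exact toDisk_not_mem_openDisk p

theorem isOpen_openDisk : IsOpen openDisk :=
  isOpen_lt (by fun_prop) continuous_const

theorem apply_mem_openDisk (h : diskAut) {z : ClosedDisk} : h.1 z ∈ openDisk ↔ z ∈ openDisk := by
  rw [← not_iff_not, not_mem_openDisk_iff, not_mem_openDisk_iff]
  constructor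
  · rintro ⟨p, hp⟩
    exact ⟨onCircle h⁻¹ p, by rw [toDisk_onCircle, hp, inv_apply_apply]⟩
  · rintro ⟨p, rfl⟩
    exact ⟨onCircle h p, toDisk_onCircle h p⟩

theorem conj_coe_mul (p : Circle) : (starRingEnd ℂ) (p : ℂ) * p = 1 := by
  rw [mul_comm, Complex.mul_conj]; simp

/-- A disk automorphism with three fixed points on the circle is the identity: the fixed points
are the roots of a quadratic polynomial. -/
theorem eq_one_of_three_fixed (h : diskAut) {p q r : Circle} (hpq : p ≠ q) (hpr : p ≠ r)
    (hqr : q ≠ r) (hp : onCircle h p = p) (hq : onCircle h q = q) (hr : onCircle h r = r) :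
    h = 1 := by
  obtain ⟨f, a, b, hab, hf⟩ := h
  have key : ∀ s : Circle, onCircle ⟨f, a, b, hab, hf⟩ s = s →
      (starRingEnd ℂ) b * (s : ℂ) ^ 2 + ((starRingEnd ℂ) a - a) * s - b = 0 := by
    intro s hs
    have h1 := hf (toDisk s)
    have h2 : ((f (toDisk s) : ClosedDisk) : ℂ) = s := congrArg Subtype.val hs
    rw [h2, eq_div_iff (denom_ne_zero hab (toDisk s))] at h1
    change (s : ℂ) * ((starRingEnd ℂ) b * (s : ℂ) + (starRingEnd ℂ) a) = a * s + b at h1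
    linear_combination h1
  have kp := key p hp
  have kq := key q hq
  have kr := key r hr
  have npq : (p : ℂ) - q ≠ 0 := sub_ne_zero.mpr fun e => hpq (Circle.ext e)
  have npr : (p : ℂ) - r ≠ 0 := sub_ne_zero.mpr fun e => hpr (Circle.ext e)
  have nqr : (q : ℂ) - r ≠ 0 := sub_ne_zero.mpr fun e => hqr (Circle.ext e)
  have e1 : (starRingEnd ℂ) b * (p + q) + ((starRingEnd ℂ) a - a) = 0 := by
    apply mul_left_cancel₀ npq
    linear_combination kp - kq
  have e2 : (starRingEnd ℂ) b * (p + r) + ((starRingEnd ℂ) a - a) = 0 := by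
    apply mul_left_cancel₀ npr
    linear_combination kp - kr
  have e3 : (starRingEnd ℂ) b = 0 := by
    apply mul_left_cancel₀ nqr
    linear_combination e1 - e2
  have hb : b = 0 := by simpa using e3
  have ha : (starRingEnd ℂ) a = a := by
    rw [e3] at e1
    linear_combination e1
  have ha0 : a ≠ 0 := by
    intro h0
    rw [h0, hb] at hab
    simp at hab
  apply Subtype.ext
  apply Homeomorph.ext
  intro z
  apply Subtype.ext
  change ((f z : ClosedDisk) : ℂ) = z
  rw [hf z, hb, ha]
  simp only [map_zero, zero_mul, zero_add, add_zero]
  exact mul_div_cancel_left₀ _ ha0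

/-! ### Invariance of half-planes -/

/-- The determinant of the vectors `(z, conj z, (1 + |z|²) / 2)` of three points of the closed
disk, the first two of them on the circle. Up to the factor `I` it is `side`, and in this form it
is visibly multiplied by a positive number when an automorphism of the disk is applied to the
three points. -/
theorem I_mul_side (p q : Circle) (z : ClosedDisk) :
    (side p q z : ℂ) * I = Matrix.det
      !![(p : ℂ), (q : ℂ), (z : ℂ);
         (starRingEnd ℂ) (p : ℂ), (starRingEnd ℂ) (q : ℂ), (starRingEnd ℂ) (z : ℂ);
         1, 1, (1 + (starRingEnd ℂ) (z : ℂ) * z) / 2] := by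
  have hn : ((‖(z : ℂ)‖ ^ 2 : ℝ) : ℂ) = (starRingEnd ℂ) (z : ℂ) * z := by
    rw [mul_comm, Complex.mul_conj, Complex.normSq_eq_norm_sq]
  have him : ∀ w : ℂ, ((w.im : ℝ) : ℂ) * I = (w - (starRingEnd ℂ) w) / 2 := by
    intro w
    rw [Complex.sub_conj]
    push_cast
    ring
  have e : (side p q z : ℂ) * I
      = 2 * ((((z : ℂ) * (starRingEnd ℂ) ((p : ℂ) - (q : ℂ))).im : ℂ) * I)
        + ((((p : ℂ) * (starRingEnd ℂ) (q : ℂ)).im : ℂ) * I)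
          * (1 + ((‖(z : ℂ)‖ ^ 2 : ℝ) : ℂ)) := by
    simp only [side]
    push_cast
    ring
  rw [e, him, him, hn, Matrix.det_fin_three]
  simp only [map_mul, map_sub, Complex.conj_conj]
  simp
  ring

theorem exists_side_onCircle (h : diskAut) (p q : Circle) (z : ClosedDisk) :
    ∃ c : ℝ, 0 < c ∧ side (onCircle h p) (onCircle h q) (h.1 z) = c * side p q z := by
  obtain ⟨f, a, b, hab, hf⟩ := h
  set h : diskAut := ⟨f, a, b, hab, hf⟩ with hh
  let N : ClosedDisk → ℂ := fun z => (starRingEnd ℂ) b * (z : ℂ) + (starRingEnd ℂ) a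
  have hN : ∀ z, N z ≠ 0 := fun z => denom_ne_zero hab z
  have hval : ∀ z : ClosedDisk, ((h.1 z : ClosedDisk) : ℂ) * N z = a * z + b := by
    intro z
    change ((f z : ClosedDisk) : ℂ) * N z = a * z + b
    rw [hf z, div_mul_cancel₀ _ (hN z)]
  have hD := norm_sub_sq hab
  set Δ : ℝ := Complex.normSq a - Complex.normSq b with hΔ
  have hΔc : (Δ : ℂ) = a * (starRingEnd ℂ) a - b * (starRingEnd ℂ) b := by
    rw [hΔ, Complex.mul_conj, Complex.mul_conj]; push_cast; rfl
  let L : Matrix (Fin 3) (Fin 3) ℂ :=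
    !![a ^ 2, b ^ 2, 2 * a * b;
       (starRingEnd ℂ) b ^ 2, (starRingEnd ℂ) a ^ 2, 2 * (starRingEnd ℂ) a * (starRingEnd ℂ) b;
       a * (starRingEnd ℂ) b, (starRingEnd ℂ) a * b,
        a * (starRingEnd ℂ) a + b * (starRingEnd ℂ) b]
  have hL : L.det = (Δ : ℂ) ^ 3 := by
    rw [Matrix.det_fin_three, hΔc]
    simp [L]
    ring
  have hmul : ∀ w : ClosedDisk, Complex.normSq (N w) ≠ 0 := fun w => by
    simpa [Complex.normSq_eq_zero] using hN w
  refine ⟨Δ ^ 3 / (normSq (N (toDisk p)) * normSq (N (toDisk q)) * normSq (N z)), ?_, ?_⟩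
  · have : ∀ w, 0 < normSq (N w) := fun w => Complex.normSq_pos.mpr (hN w)
    have h1 := this (toDisk p)
    have h2 := this (toDisk q)
    have h3 := this z
    positivity
  have key := I_mul_side (onCircle h p) (onCircle h q) (h.1 z)
  have key0 := I_mul_side p q z
  have vp := hval (toDisk p)
  have vq := hval (toDisk q)
  have vz := hval z
  have hp' : ((h.1 (toDisk p) : ClosedDisk) : ℂ) = (onCircle h p : ℂ) := rfl
  have hq' : ((h.1 (toDisk q) : ClosedDisk) : ℂ) = (onCircle h q : ℂ) := rfl
  rw [hp'] at vp
  rw [hq'] at vq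
  have cp := conj_coe_mul p
  have cq := conj_coe_mul q
  have cp' := conj_coe_mul (onCircle h p)
  have cq' := conj_coe_mul (onCircle h q)
  have vpc := congrArg (starRingEnd ℂ) vp
  have vqc := congrArg (starRingEnd ℂ) vq
  have vzc := congrArg (starRingEnd ℂ) vz
  have nN : ∀ w, ((normSq (N w) : ℝ) : ℂ) = N w * (starRingEnd ℂ) (N w) := fun w => by
    rw [Complex.mul_conj]
  simp only [map_mul, map_add] at vpc vqc vzc
  have dp : (toDisk p : ℂ) = (p : ℂ) := rfl
  have dq : (toDisk q : ℂ) = (q : ℂ) := rfl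
  have eNp : N (toDisk p) = (starRingEnd ℂ) b * (p : ℂ) + (starRingEnd ℂ) a := rfl
  have eNq : N (toDisk q) = (starRingEnd ℂ) b * (q : ℂ) + (starRingEnd ℂ) a := rfl
  have eNz : N z = (starRingEnd ℂ) b * (z : ℂ) + (starRingEnd ℂ) a := rfl
  rw [dp] at vp vpc
  rw [dq] at vq vqc
  have eNpc := congrArg (starRingEnd ℂ) eNp
  have eNqc := congrArg (starRingEnd ℂ) eNq
  have eNzc := congrArg (starRingEnd ℂ) eNz
  simp only [map_mul, map_add, Complex.conj_conj] at eNpc eNqc eNzc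
  set P := N (toDisk p)
  set Q := N (toDisk q)
  set Z := N z
  have hM : L * !![(p : ℂ), (q : ℂ), (z : ℂ);
         (starRingEnd ℂ) (p : ℂ), (starRingEnd ℂ) (q : ℂ), (starRingEnd ℂ) (z : ℂ);
         1, 1, (1 + (starRingEnd ℂ) (z : ℂ) * z) / 2]
      = !![(onCircle h p : ℂ), (onCircle h q : ℂ), ((h.1 z : ClosedDisk) : ℂ);
         (starRingEnd ℂ) (onCircle h p : ℂ), (starRingEnd ℂ) (onCircle h q : ℂ),
          (starRingEnd ℂ) ((h.1 z : ClosedDisk) : ℂ);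
         1, 1, (1 + (starRingEnd ℂ) ((h.1 z : ClosedDisk) : ℂ) * (h.1 z : ClosedDisk)) / 2]
        * Matrix.diagonal ![P * (starRingEnd ℂ) P, Q * (starRingEnd ℂ) Q,
            Z * (starRingEnd ℂ) Z] := by
    ext i j
    fin_cases i <;> fin_cases j <;>
      simp [L, Matrix.mul_apply, Fin.sum_univ_three, Matrix.diagonal]
    · linear_combination (-(starRingEnd ℂ) P) * vp - (a * p + b) * eNpc - a * b * cp
    · linear_combination (-(starRingEnd ℂ) Q) * vq - (a * q + b) * eNqc - a * b * cq
    · linear_combination (-(starRingEnd ℂ) Z) * vz - (a * z + b) * eNzc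
    · linear_combination (-P) * vpc
        - ((starRingEnd ℂ) a * (starRingEnd ℂ) p + (starRingEnd ℂ) b) * eNp
        - (starRingEnd ℂ) a * (starRingEnd ℂ) b * cp
    · linear_combination (-Q) * vqc
        - ((starRingEnd ℂ) a * (starRingEnd ℂ) q + (starRingEnd ℂ) b) * eNq
        - (starRingEnd ℂ) a * (starRingEnd ℂ) b * cq
    · linear_combination (-Z) * vzc
        - ((starRingEnd ℂ) a * (starRingEnd ℂ) z + (starRingEnd ℂ) b) * eNz
    · rw [eNp, map_add, map_mul, Complex.conj_conj, Complex.conj_conj]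
      linear_combination (-b * (starRingEnd ℂ) b) * cp
    · rw [eNq, map_add, map_mul, Complex.conj_conj, Complex.conj_conj]
      linear_combination (-b * (starRingEnd ℂ) b) * cq
    · have e : Z * (starRingEnd ℂ) Z
            * (1 + (starRingEnd ℂ) ((h.1 z : ClosedDisk) : ℂ) * (h.1 z : ClosedDisk))
          = Z * (starRingEnd ℂ) Z
            + ((starRingEnd ℂ) a * (starRingEnd ℂ) z + (starRingEnd ℂ) b) * (a * z + b) := by
        rw [← vz, ← vzc]; ring
      have e' : (1 + (starRingEnd ℂ) ((h.1 z : ClosedDisk) : ℂ) * (h.1 z : ClosedDisk)) / 2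
            * (Z * (starRingEnd ℂ) Z)
          = (Z * (starRingEnd ℂ) Z
            + ((starRingEnd ℂ) a * (starRingEnd ℂ) z + (starRingEnd ℂ) b) * (a * z + b)) / 2 := by
        rw [← e]; ring
      refine Eq.trans ?_ e'.symm
      rw [eNz, map_add, map_mul, Complex.conj_conj, Complex.conj_conj]
      ring
  have hdet := congrArg Matrix.det hM
  rw [Matrix.det_mul, Matrix.det_mul, ← key0, ← key, hL, Matrix.det_diagonal,
    Fin.prod_univ_three] at hdet
  simp only [Matrix.cons_val_zero, Matrix.cons_val_one, Matrix.cons_val] at hdet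
  have n1 := hmul (toDisk p)
  have n2 := hmul (toDisk q)
  have n3 := hmul z
  have hfin : ((side (onCircle h p) (onCircle h q) (h.1 z) *
      (normSq P * normSq Q * normSq Z) : ℝ) : ℂ) = ((Δ ^ 3 * side p q z : ℝ) : ℂ) := by
    push_cast
    have i1 : ((normSq P : ℝ) : ℂ) = P * (starRingEnd ℂ) P := by rw [Complex.mul_conj]
    have i2 : ((normSq Q : ℝ) : ℂ) = Q * (starRingEnd ℂ) Q := by rw [Complex.mul_conj]
    have i3 : ((normSq Z : ℝ) : ℂ) = Z * (starRingEnd ℂ) Z := by rw [Complex.mul_conj]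
    rw [i1, i2, i3]
    apply mul_right_cancel₀ Complex.I_ne_zero
    linear_combination -hdet
  have hfin' := Complex.ofReal_injective hfin
  rw [div_mul_eq_mul_div, eq_div_iff (mul_ne_zero (mul_ne_zero n1 n2) n3)]
  exact hfin'

theorem side_onCircle_pos (h : diskAut) {p q : Circle} {z : ClosedDisk} :
    0 < side (onCircle h p) (onCircle h q) (h.1 z) ↔ 0 < side p q z := by
  obtain ⟨c, hc, e⟩ := exists_side_onCircle h p q z
  rw [e]
  exact ⟨fun h => by
    by_contra h'
    push Not at h'
    nlinarith, fun h => mul_pos hc h⟩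

theorem side_onCircle_neg (h : diskAut) {p q : Circle} {z : ClosedDisk} :
    side (onCircle h p) (onCircle h q) (h.1 z) < 0 ↔ side p q z < 0 := by
  have e := side_onCircle_pos h (p := q) (q := p) (z := z)
  rwa [side_swap (onCircle h p), side_swap p q, neg_pos, neg_pos] at e

theorem side_onCircle_nonneg (h : diskAut) {p q : Circle} {z : ClosedDisk} :
    0 ≤ side (onCircle h p) (onCircle h q) (h.1 z) ↔ 0 ≤ side p q z := by
  rw [← not_lt, side_onCircle_neg, not_lt]

theorem side_onCircle_nonpos (h : diskAut) {p q : Circle} {z : ClosedDisk} :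
    side (onCircle h p) (onCircle h q) (h.1 z) ≤ 0 ↔ side p q z ≤ 0 := by
  rw [← not_lt, side_onCircle_pos, not_lt]

theorem side_onCircle_eq_zero (h : diskAut) {p q : Circle} {z : ClosedDisk} :
    side (onCircle h p) (onCircle h q) (h.1 z) = 0 ↔ side p q z = 0 := by
  rw [le_antisymm_iff, le_antisymm_iff, side_onCircle_nonneg, side_onCircle_nonpos]

end Mating

namespace Mating

open Complex

/-! ### Chords and the cyclic order of the circle -/

/-- The affine function on the plane vanishing on the chord from `p` to `q`. In the Klein model
of the hyperbolic plane it plays the role of `side p q`. -/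
def chord (p q : Circle) (w : ℂ) : ℝ :=
  (w * (starRingEnd ℂ) ((p : ℂ) - (q : ℂ))).im + ((p : ℂ) * (starRingEnd ℂ) (q : ℂ)).im

theorem chord_swap (p q : Circle) (w : ℂ) : chord q p w = -chord p q w := by
  simp only [chord, map_sub, Complex.mul_im, Complex.sub_re, Complex.sub_im, Complex.conj_re,
    Complex.conj_im]
  ring

theorem chord_combo (p q : Circle) (w w' : ℂ) (a b : ℝ) (hab : a + b = 1) :
    chord p q (a * w + b * w') = a * chord p q w + b * chord p q w' := by
  have hb : b = 1 - a := by linarith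
  subst hb
  simp only [chord, Complex.mul_im, Complex.add_re, Complex.add_im, Complex.mul_re,
    Complex.ofReal_re, Complex.ofReal_im]
  ring

theorem chord_eq_add (p q r : Circle) :
    chord p q r = ((r : ℂ) * (starRingEnd ℂ) (p : ℂ)).im + ((q : ℂ) * (starRingEnd ℂ) (r : ℂ)).im
      + ((p : ℂ) * (starRingEnd ℂ) (q : ℂ)).im := by
  simp only [chord, map_sub, Complex.mul_im, Complex.sub_re, Complex.sub_im, Complex.conj_re,
    Complex.conj_im]
  ring

theorem chord_rotate (p q r : Circle) : chord p q r = chord q r p := by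
  rw [chord_eq_add, chord_eq_add]; ring

@[simp] theorem chord_left (p q : Circle) : chord p q p = 0 := by
  rw [chord_eq_add]
  simp only [Complex.mul_im, Complex.conj_re, Complex.conj_im]
  ring

@[simp] theorem chord_right (p q : Circle) : chord p q q = 0 := by
  rw [chord_eq_add]
  simp only [Complex.mul_im, Complex.conj_re, Complex.conj_im]
  ring

theorem continuous_chord (p q : Circle) : Continuous (chord p q) := by
  unfold chord
  fun_prop

theorem circle_exp_re (t : ℝ) : ((Circle.exp t : Circle) : ℂ).re = Real.cos t := by
  rw [Circle.coe_exp, Complex.exp_ofReal_mul_I_re]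

theorem circle_exp_im (t : ℝ) : ((Circle.exp t : Circle) : ℂ).im = Real.sin t := by
  rw [Circle.coe_exp, Complex.exp_ofReal_mul_I_im]

theorem chord_exp (α β γ : ℝ) : chord (Circle.exp α) (Circle.exp β) (Circle.exp γ)
    = 4 * Real.sin ((γ - α) / 2) * Real.sin ((β - γ) / 2) * Real.sin ((β - α) / 2) := by
  have e : chord (Circle.exp α) (Circle.exp β) (Circle.exp γ)
      = Real.sin (γ - α) + Real.sin (β - γ) - Real.sin (β - α) := by
    rw [chord_eq_add]
    simp only [Complex.mul_im, Complex.conj_re, Complex.conj_im, circle_exp_re, circle_exp_im,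
      Real.sin_sub]
    ring
  rw [e]
  obtain ⟨A, hA⟩ : ∃ A, A = (γ - α) / 2 := ⟨_, rfl⟩
  obtain ⟨B, hB⟩ : ∃ B, B = (β - γ) / 2 := ⟨_, rfl⟩
  rw [show γ - α = 2 * A by rw [hA]; ring, show β - γ = 2 * B by rw [hB]; ring,
    show β - α = 2 * (A + B) by rw [hA, hB]; ring, show 2 * A / 2 = A by ring,
    show 2 * B / 2 = B by ring, show 2 * (A + B) / 2 = A + B by ring]
  rw [Real.sin_two_mul, Real.sin_two_mul, Real.sin_two_mul, Real.sin_add, Real.cos_add]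
  have hA2 := Real.sin_sq_add_cos_sq A
  have hB2 := Real.sin_sq_add_cos_sq B
  linear_combination (-2 * Real.sin B * Real.cos B) * hA2 + (-2 * Real.sin A * Real.cos A) * hB2

theorem exists_angle (α : ℝ) (p : Circle) :
    ∃ γ, α ≤ γ ∧ γ < α + 2 * Real.pi ∧ Circle.exp γ = p := by
  obtain ⟨t, rfl⟩ := Circle.exp_surjective p
  have h2 : 0 < 2 * Real.pi := Real.two_pi_pos
  refine ⟨toIcoMod h2 α t, left_le_toIcoMod h2 α t, toIcoMod_lt_right h2 α t, ?_⟩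
  rw [Circle.exp_eq_exp]
  refine ⟨-toIcoDiv h2 α t, ?_⟩
  rw [toIcoMod, zsmul_eq_mul]
  push_cast
  ring

theorem exists_angle_of_ne {α : ℝ} {p : Circle} (h : p ≠ Circle.exp α) :
    ∃ γ, α < γ ∧ γ < α + 2 * Real.pi ∧ Circle.exp γ = p := by
  obtain ⟨γ, h1, h2, rfl⟩ := exists_angle α p
  refine ⟨γ, lt_of_le_of_ne h1 ?_, h2, rfl⟩
  rintro rfl
  exact h rfl

theorem exp_ne_exp {α β : ℝ} (h : α < β) (h' : β < α + 2 * Real.pi) :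
    Circle.exp α ≠ Circle.exp β := by
  intro e
  rw [Circle.exp_eq_exp] at e
  obtain ⟨m, hm⟩ := e
  have h2 : 0 < 2 * Real.pi := Real.two_pi_pos
  have h3 : (m : ℝ) < 0 := by
    by_contra hc
    push Not at hc
    nlinarith
  have h4 : (-1 : ℝ) < m := by
    by_contra hc
    push Not at hc
    nlinarith
  have h5 : m < 0 := by exact_mod_cast h3
  have h6 : -1 < m := by exact_mod_cast h4
  omega

/-- The point `q` lies on the open counter-clockwise arc from `p` to `r`. -/
def ccw (p q r : Circle) : Prop := 0 < chord p r q

theorem ccw_rotate {p q r : Circle} (h : ccw p q r) : ccw q r p := by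
  unfold ccw at *
  rw [chord_rotate q p r]
  exact h

theorem ccw_exp {α β γ : ℝ} (h1 : α < β) (h2 : β < γ) (h3 : γ < α + 2 * Real.pi) :
    ccw (Circle.exp α) (Circle.exp β) (Circle.exp γ) := by
  unfold ccw
  rw [chord_exp]
  have s1 : 0 < Real.sin ((β - α) / 2) := Real.sin_pos_of_pos_of_lt_pi (by linarith) (by linarith)
  have s2 : 0 < Real.sin ((γ - β) / 2) := Real.sin_pos_of_pos_of_lt_pi (by linarith) (by linarith)
  have s3 : 0 < Real.sin ((γ - α) / 2) := Real.sin_pos_of_pos_of_lt_pi (by linarith) (by linarith)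
  positivity

theorem ccw_asymm {p q r : Circle} (h : ccw p q r) : ¬ ccw p r q := by
  intro h'
  unfold ccw at *
  rw [chord_swap, chord_rotate q p r] at h'
  linarith

theorem ccw_ne_left {p q r : Circle} (h : ccw p q r) : p ≠ q := by
  rintro rfl
  simp [ccw] at h

theorem ccw_ne_right {p q r : Circle} (h : ccw p q r) : q ≠ r := by
  rintro rfl
  simp [ccw] at h

theorem ccw_ne_outer {p q r : Circle} (h : ccw p q r) : p ≠ r :=
  (ccw_ne_right (ccw_rotate h)).symm

theorem ccw_total {p q r : Circle} (h1 : p ≠ q) (h2 : p ≠ r) (h3 : q ≠ r) :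
    ccw p q r ∨ ccw p r q := by
  obtain ⟨α, rfl⟩ := Circle.exp_surjective p
  obtain ⟨β, b1, b2, rfl⟩ := exists_angle_of_ne h1.symm
  obtain ⟨γ, c1, c2, rfl⟩ := exists_angle_of_ne h2.symm
  rcases lt_trichotomy β γ with h | h | h
  · exact Or.inl (ccw_exp b1 h c2)
  · exact absurd (by rw [h]) h3
  · exact Or.inr (ccw_exp c1 h b2)

theorem ccw_exp_iff {α β γ : ℝ} (b1 : α < β) (b2 : β < α + 2 * Real.pi) (c1 : α < γ)
    (c2 : γ < α + 2 * Real.pi) :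
    ccw (Circle.exp α) (Circle.exp β) (Circle.exp γ) ↔ β < γ := by
  refine ⟨fun h => ?_, fun h => ccw_exp b1 h c2⟩
  rcases lt_trichotomy β γ with h' | h' | h'
  · exact h'
  · exact absurd (by rw [h']) (ccw_ne_right h)
  · exact absurd (ccw_exp c1 h' b2) (ccw_asymm h)

theorem ccw_trans {v p q r : Circle} (h1 : ccw v p q) (h2 : ccw v q r) : ccw v p r := by
  obtain ⟨α, rfl⟩ := Circle.exp_surjective v
  obtain ⟨β, b1, b2, rfl⟩ := exists_angle_of_ne (ccw_ne_left h1).symm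
  obtain ⟨γ, c1, c2, rfl⟩ := exists_angle_of_ne (ccw_ne_left h2).symm
  obtain ⟨δ, d1, d2, rfl⟩ := exists_angle_of_ne (ccw_ne_outer h2).symm
  rw [ccw_exp_iff b1 b2 c1 c2] at h1
  rw [ccw_exp_iff c1 c2 d1 d2] at h2
  exact ccw_exp b1 (h1.trans h2) d2

/-! ### The Klein model -/

theorem norm_le_one (z : ClosedDisk) : ‖(z : ℂ)‖ ≤ 1 := mem_closedBall_zero_iff.mp z.2

theorem norm_two_div_le {t : ℝ} : 2 / (1 + t ^ 2) * t ≤ 1 := by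
  rw [div_mul_eq_mul_div, div_le_one (by positivity)]
  nlinarith [sq_nonneg (t - 1)]

theorem klein_left_inv {t : ℝ} (h0 : 0 ≤ t) (h1 : t ≤ 1) :
    1 / (1 + √(1 - (2 / (1 + t ^ 2) * t) ^ 2)) * (2 / (1 + t ^ 2)) = 1 := by
  have h2 : 1 - (2 / (1 + t ^ 2) * t) ^ 2 = ((1 - t ^ 2) / (1 + t ^ 2)) ^ 2 := by
    field_simp
    ring
  have h3 : 0 ≤ (1 - t ^ 2) / (1 + t ^ 2) := div_nonneg (by nlinarith) (by positivity)
  rw [h2, Real.sqrt_sq h3]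
  field_simp
  norm_num

theorem klein_right_inv {t : ℝ} (h0 : 0 ≤ t) (h1 : t ≤ 1) :
    2 / (1 + (1 / (1 + √(1 - t ^ 2)) * t) ^ 2) * (1 / (1 + √(1 - t ^ 2))) = 1 := by
  have h3 : 0 ≤ √(1 - t ^ 2) := Real.sqrt_nonneg _
  have h4 : √(1 - t ^ 2) ^ 2 = 1 - t ^ 2 := Real.sq_sqrt (by nlinarith)
  set s := √(1 - t ^ 2)
  have h5 : (1 / (1 + s) * t) ^ 2 = (1 - s) / (1 + s) := by
    rw [mul_pow, div_pow, show t ^ 2 = (1 - s) * (1 + s) by linarith]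
    field_simp
  rw [h5]
  field_simp
  ring

/-- The change of coordinates from the Poincaré model to the Klein model of the hyperbolic plane,
in which geodesics are Euclidean chords. -/
def kleinEquiv : ClosedDisk ≃ ClosedDisk where
  toFun z := ⟨((2 / (1 + ‖(z : ℂ)‖ ^ 2) : ℝ) : ℂ) * z, by
    rw [mem_closedBall_zero_iff, norm_mul, Complex.norm_of_nonneg (by positivity)]
    exact norm_two_div_le⟩
  invFun w := ⟨((1 / (1 + √(1 - ‖(w : ℂ)‖ ^ 2)) : ℝ) : ℂ) * w, by
    have h3 : 0 ≤ √(1 - ‖(w : ℂ)‖ ^ 2) := Real.sqrt_nonneg _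
    rw [mem_closedBall_zero_iff, norm_mul, Complex.norm_of_nonneg (by positivity)]
    rw [div_mul_eq_mul_div, one_mul, div_le_one (by positivity)]
    linarith [norm_le_one w]⟩
  left_inv z := by
    apply Subtype.ext
    simp only
    rw [norm_mul, Complex.norm_of_nonneg (by positivity), ← mul_assoc, ← Complex.ofReal_mul,
      klein_left_inv (norm_nonneg _) (norm_le_one z)]
    simp
  right_inv w := by
    have h3 : 0 ≤ √(1 - ‖(w : ℂ)‖ ^ 2) := Real.sqrt_nonneg _
    apply Subtype.ext
    simp only
    rw [norm_mul, Complex.norm_of_nonneg (by positivity), ← mul_assoc, ← Complex.ofReal_mul,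
      klein_right_inv (norm_nonneg _) (norm_le_one w)]
    simp

theorem continuous_kleinEquiv : Continuous kleinEquiv := by
  refine Continuous.subtype_mk (Continuous.mul (Complex.continuous_ofReal.comp ?_)
    continuous_subtype_val) _
  refine Continuous.div continuous_const (by fun_prop) fun z => ?_
  positivity

/-- `kleinEquiv` as a homeomorphism. -/
def klein : ClosedDisk ≃ₜ ClosedDisk := Continuous.homeoOfEquivCompactToT2 continuous_kleinEquiv

theorem coe_klein (z : ClosedDisk) :
    ((klein z : ClosedDisk) : ℂ) = ((2 / (1 + ‖(z : ℂ)‖ ^ 2) : ℝ) : ℂ) * z := rfl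

theorem klein_toDisk (p : Circle) : klein (toDisk p) = toDisk p := by
  apply Subtype.ext
  rw [coe_klein]
  change ((2 / (1 + ‖(p : ℂ)‖ ^ 2) : ℝ) : ℂ) * p = p
  rw [Circle.norm_coe]
  norm_num

theorem side_eq_chord (p q : Circle) (z : ClosedDisk) :
    side p q z = (1 + ‖(z : ℂ)‖ ^ 2) * chord p q (klein z : ClosedDisk) := by
  rw [coe_klein, chord, side, mul_assoc, Complex.im_ofReal_mul]
  field_simp

theorem side_pos_iff {p q : Circle} {z : ClosedDisk} :
    0 < side p q z ↔ 0 < chord p q (klein z : ClosedDisk) := by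
  rw [side_eq_chord]
  exact mul_pos_iff_of_pos_left (by positivity)

theorem side_neg_iff {p q : Circle} {z : ClosedDisk} :
    side p q z < 0 ↔ chord p q (klein z : ClosedDisk) < 0 := by
  rw [side_eq_chord, ← not_le, ← not_le]
  exact not_congr (mul_nonneg_iff_of_pos_left (by positivity))

theorem side_nonneg_iff {p q : Circle} {z : ClosedDisk} :
    0 ≤ side p q z ↔ 0 ≤ chord p q (klein z : ClosedDisk) := by
  rw [← not_lt, side_neg_iff, not_lt]

theorem side_nonpos_iff {p q : Circle} {z : ClosedDisk} :
    side p q z ≤ 0 ↔ chord p q (klein z : ClosedDisk) ≤ 0 := by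
  rw [← not_lt, side_pos_iff, not_lt]

theorem side_eq_zero_iff {p q : Circle} {z : ClosedDisk} :
    side p q z = 0 ↔ chord p q (klein z : ClosedDisk) = 0 := by
  rw [le_antisymm_iff, le_antisymm_iff, side_nonneg_iff, side_nonpos_iff]

theorem continuous_side (p q : Circle) : Continuous (side p q) := by
  have : side p q = fun z : ClosedDisk => (1 + ‖(z : ℂ)‖ ^ 2) * chord p q (klein z : ClosedDisk) :=
    funext (side_eq_chord p q)
  rw [this]
  exact Continuous.mul (by fun_prop)
    ((continuous_chord p q).comp (continuous_subtype_val.comp klein.continuous))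

theorem side_toDisk_pos {p q r : Circle} : 0 < side p q (toDisk r) ↔ ccw p r q := by
  rw [side_pos_iff, klein_toDisk]; rfl

theorem side_toDisk_neg {p q r : Circle} : side p q (toDisk r) < 0 ↔ ccw q r p := by
  rw [side_swap, neg_lt_zero, side_toDisk_pos]

theorem side_left (p q : Circle) : side p q (toDisk p) = 0 := by
  rw [side_eq_zero_iff, klein_toDisk]; exact chord_left p q

theorem side_right (p q : Circle) : side p q (toDisk q) = 0 := by
  rw [side_eq_zero_iff, klein_toDisk]; exact chord_right p q

theorem ccw_onCircle (h : diskAut) {p q r : Circle} :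
    ccw (onCircle h p) (onCircle h q) (onCircle h r) ↔ ccw p q r := by
  rw [← side_toDisk_pos, ← side_toDisk_pos, toDisk_onCircle, side_onCircle_pos]

theorem klein_mem_openDisk {z : ClosedDisk} : klein z ∈ openDisk ↔ z ∈ openDisk := by
  rw [← not_iff_not, not_mem_openDisk_iff, not_mem_openDisk_iff]
  constructor
  · rintro ⟨p, hp⟩
    exact ⟨p, klein.injective (by rw [klein_toDisk, hp])⟩
  · rintro ⟨p, rfl⟩
    exact ⟨p, (klein_toDisk p).symm⟩

theorem norm_klein_lt {z : ClosedDisk} (hz : z ∈ openDisk) : ‖((klein z : ClosedDisk) : ℂ)‖ < 1 :=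
  klein_mem_openDisk.mpr hz

/-- The point of the closed disk with given Klein coordinate (a junk value unless `‖w‖ ≤ 1`). -/
def unklein (w : ℂ) : ClosedDisk :=
  if h : ‖w‖ ≤ 1 then klein.symm ⟨w, mem_closedBall_zero_iff.mpr h⟩ else toDisk 1

theorem klein_unklein {w : ℂ} (h : ‖w‖ ≤ 1) : ((klein (unklein w) : ClosedDisk) : ℂ) = w := by
  rw [unklein, dif_pos h, klein.apply_symm_apply]

theorem unklein_klein (z : ClosedDisk) : unklein (klein z : ClosedDisk) = z := by
  apply klein.injective
  apply Subtype.ext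
  rw [klein_unklein (norm_le_one _)]

theorem unklein_mem_openDisk {w : ℂ} (h : ‖w‖ < 1) : unklein w ∈ openDisk := by
  rw [← klein_mem_openDisk]
  change ‖((klein (unklein w) : ClosedDisk) : ℂ)‖ < 1
  rwa [klein_unklein h.le]

theorem norm_combo_lt {u v : ℂ} (hu : ‖u‖ ≤ 1) (hv : ‖v‖ ≤ 1) (huv : u ≠ v) {a : ℝ} (h0 : 0 < a)
    (h1 : a < 1) : ‖((1 - a : ℝ) : ℂ) * u + (a : ℂ) * v‖ < 1 := by
  have := (strictConvex_closedBall ℝ (0 : ℂ) 1) (by simpa using hu) (by simpa using hv) huv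
    (show 0 < 1 - a by linarith) h0 (by ring)
  rw [interior_closedBall _ one_ne_zero, mem_ball_zero_iff] at this
  simpa [Complex.real_smul] using this

theorem norm_combo_le {u v : ℂ} (hu : ‖u‖ ≤ 1) (hv : ‖v‖ ≤ 1) {a : ℝ} (h0 : 0 ≤ a)
    (h1 : a ≤ 1) : ‖((1 - a : ℝ) : ℂ) * u + (a : ℂ) * v‖ ≤ 1 := by
  have := (convex_closedBall (0 : ℂ) 1) (show u ∈ _ by simpa using hu)
    (show v ∈ _ by simpa using hv) (show 0 ≤ 1 - a by linarith) h0 (by ring)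
  rw [mem_closedBall_zero_iff] at this
  simpa [Complex.real_smul] using this

theorem norm_combo_lt' {u v : ℂ} (hu : ‖u‖ ≤ 1) (hv : ‖v‖ < 1) {a : ℝ} (h0 : 0 < a)
    (h1 : a ≤ 1) : ‖((1 - a : ℝ) : ℂ) * u + (a : ℂ) * v‖ < 1 := by
  calc _ ≤ ‖((1 - a : ℝ) : ℂ) * u‖ + ‖(a : ℂ) * v‖ := norm_add_le _ _
    _ = (1 - a) * ‖u‖ + a * ‖v‖ := by
      rw [norm_mul, norm_mul, Complex.norm_of_nonneg (by linarith), Complex.norm_of_nonneg h0.le]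
    _ < 1 := by nlinarith

/-- The position of a point relative to the chord from `p` to `q`: `0` at `p` and `1` at `q`. -/
def chordCoord (p q : Circle) (w : ℂ) : ℝ :=
  ((w - p) * (starRingEnd ℂ) ((q : ℂ) - p)).re / Complex.normSq ((q : ℂ) - p)

theorem continuous_chordCoord (p q : Circle) : Continuous (chordCoord p q) := by
  unfold chordCoord
  fun_prop

theorem normSq_sub_pos {p q : Circle} (h : p ≠ q) : 0 < Complex.normSq ((q : ℂ) - p) :=
  Complex.normSq_pos.mpr (sub_ne_zero.mpr fun e => h (Circle.ext e).symm)

theorem chordCoord_combo {p q : Circle} (h : p ≠ q) (a : ℝ) :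
    chordCoord p q (((1 - a : ℝ) : ℂ) * p + (a : ℂ) * q) = a := by
  have h1 := normSq_sub_pos h
  unfold chordCoord
  have e : ((((1 - a : ℝ) : ℂ) * p + (a : ℂ) * q) - p) * (starRingEnd ℂ) ((q : ℂ) - p)
      = ((a * Complex.normSq ((q : ℂ) - p) : ℝ) : ℂ) := by
    rw [Complex.ofReal_mul, ← Complex.mul_conj]
    push_cast
    ring
  rw [e, Complex.ofReal_re]
  field_simp

theorem eq_combo_of_chord_eq_zero {p q : Circle} (h : p ≠ q) {w : ℂ} (hw : chord p q w = 0) :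
    w = ((1 - chordCoord p q w : ℝ) : ℂ) * p + (chordCoord p q w : ℂ) * q := by
  have h1 := normSq_sub_pos h
  have hne : (q : ℂ) - p ≠ 0 := Complex.normSq_pos.mp h1
  have him : ((w - p) * (starRingEnd ℂ) ((q : ℂ) - p)).im = 0 := by
    have e : ((w - p) * (starRingEnd ℂ) ((q : ℂ) - p)).im = -chord p q w := by
      simp only [chord, map_sub, Complex.mul_im, Complex.sub_re, Complex.sub_im, Complex.conj_re,
        Complex.conj_im]
      ring
    rw [e, hw, neg_zero]
  have hre : (w - p) * (starRingEnd ℂ) ((q : ℂ) - p)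
      = ((chordCoord p q w * Complex.normSq ((q : ℂ) - p) : ℝ) : ℂ) := by
    apply Complex.ext
    · rw [Complex.ofReal_re, chordCoord]
      field_simp
    · rw [Complex.ofReal_im, him]
  rw [Complex.ofReal_mul, ← Complex.mul_conj, ← mul_assoc] at hre
  have := mul_right_cancel₀ ((map_ne_zero _).mpr hne) hre
  push_cast
  linear_combination this

theorem normSq_combo (p q : Circle) (a : ℝ) :
    Complex.normSq (((1 - a : ℝ) : ℂ) * p + (a : ℂ) * q)
      = 1 - a * (1 - a) * Complex.normSq ((q : ℂ) - p) := by
  have hp := Circle.normSq_coe p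
  have hq := Circle.normSq_coe q
  simp only [Complex.normSq_apply, Complex.add_re, Complex.add_im, Complex.mul_re, Complex.mul_im,
    Complex.sub_re, Complex.sub_im, Complex.ofReal_re, Complex.ofReal_im] at *
  linear_combination ((1 - a) ^ 2 + a * (1 - a)) * hp + (a ^ 2 + a * (1 - a)) * hq

/-- In Klein coordinates, a geodesic is the open segment joining its endpoints. -/
theorem mem_geodesic_iff {p q : Circle} (h : p ≠ q) {z : ClosedDisk} :
    z ∈ geodesic s(p, q) ↔ ∃ a : ℝ, 0 < a ∧ a < 1 ∧
      ((klein z : ClosedDisk) : ℂ) = ((1 - a : ℝ) : ℂ) * p + (a : ℂ) * q := by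
  have hpq : (p : ℂ) ≠ q := fun e => h (Circle.ext e)
  constructor
  · rintro ⟨hz, hs⟩
    have e := eq_combo_of_chord_eq_zero h (side_eq_zero_iff.mp hs)
    set a := chordCoord p q (klein z : ClosedDisk)
    have hn := normSq_combo p q a
    rw [← e, Complex.normSq_eq_norm_sq] at hn
    have h1 := norm_klein_lt hz
    have h2 := normSq_sub_pos h
    have h3 : 0 < a * (1 - a) := by
      by_contra hc
      push Not at hc
      nlinarith [norm_nonneg ((klein z : ClosedDisk) : ℂ)]
    refine ⟨a, ?_, ?_, e⟩ <;> nlinarith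
  · rintro ⟨a, h0, h1, e⟩
    refine ⟨?_, ?_⟩
    · rw [← klein_mem_openDisk]
      change ‖((klein z : ClosedDisk) : ℂ)‖ < 1
      rw [e]
      exact norm_combo_lt (Circle.norm_coe p).le (Circle.norm_coe q).le hpq h0 h1
    · rw [side_eq_zero_iff, e, chord_combo _ _ _ _ _ _ (by ring)]
      simp

theorem mem_geodesic {p q : Circle} {z : ClosedDisk} :
    z ∈ geodesic s(p, q) ↔ z ∈ openDisk ∧ side p q z = 0 := Iff.rfl

theorem apply_mem_geodesic (h : diskAut) {p q : Circle} {z : ClosedDisk} :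
    h.1 z ∈ geodesic s(onCircle h p, onCircle h q) ↔ z ∈ geodesic s(p, q) := by
  rw [mem_geodesic, mem_geodesic, apply_mem_openDisk, side_onCircle_eq_zero]

/-- The point dividing the geodesic segment from `z` to `w` in the ratio `a : 1 - a` in Klein
coordinates. -/
def between (z w : ClosedDisk) (a : ℝ) : ClosedDisk :=
  unklein (((1 - a : ℝ) : ℂ) * (klein z : ClosedDisk) + (a : ℂ) * (klein w : ClosedDisk))

theorem klein_between {z w : ClosedDisk} {a : ℝ} (h0 : 0 ≤ a) (h1 : a ≤ 1) :
    ((klein (between z w a) : ClosedDisk) : ℂ)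
      = ((1 - a : ℝ) : ℂ) * (klein z : ClosedDisk) + (a : ℂ) * (klein w : ClosedDisk) :=
  klein_unklein (norm_combo_le (norm_le_one _) (norm_le_one _) h0 h1)

theorem between_mem_openDisk {z w : ClosedDisk} {a : ℝ} (h0 : 0 < a) (h1 : a ≤ 1)
    (hw : w ∈ openDisk) : between z w a ∈ openDisk :=
  unklein_mem_openDisk (norm_combo_lt' (norm_le_one _) (norm_klein_lt hw) h0 h1)

theorem chord_between (p q : Circle) {z w : ClosedDisk} {a : ℝ} (h0 : 0 ≤ a) (h1 : a ≤ 1) :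
    chord p q (klein (between z w a) : ClosedDisk)
      = (1 - a) * chord p q (klein z : ClosedDisk) + a * chord p q (klein w : ClosedDisk) := by
  rw [klein_between h0 h1, chord_combo _ _ _ _ _ _ (by ring)]

theorem tendsto_between (z w : ClosedDisk) :
    Tendsto (between z w) (𝓝[>] 0) (𝓝 z) := by
  have h1 : ContinuousOn (fun a : ℝ => klein (between z w a)) (Set.Icc 0 1) := by
    rw [continuousOn_iff_continuous_domRestrict]
    refine Continuous.subtype_mk (f := fun a : Set.Icc (0 : ℝ) 1 =>
      ((1 - (a : ℝ) : ℝ) : ℂ) * (klein z : ClosedDisk) + ((a : ℝ) : ℂ) * (klein w : ClosedDisk))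
      (by fun_prop) (fun a => ?_) |>.congr fun a => ?_
    · exact mem_closedBall_zero_iff.mpr
        (norm_combo_le (norm_le_one _) (norm_le_one _) a.2.1 a.2.2)
    · exact Subtype.ext (klein_between a.2.1 a.2.2).symm
  have h2 : ContinuousOn (between z w) (Set.Icc 0 1) := by
    have := klein.symm.continuous.comp_continuousOn h1
    simpa [Function.comp_def] using this
  have h3 := (h2 0 (by simp)).mono_left (nhdsWithin_le_iff.mpr ?_ : 𝓝[>] (0 : ℝ) ≤ _)
  · rwa [show between z w 0 = z by simp [between, unklein_klein]] at h3
  · exact mem_of_superset (Ioo_mem_nhdsGT one_pos) fun a ha => ⟨ha.1.le, ha.2.le⟩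

/-- Two points on different sides of a geodesic are separated by a point of it. -/
theorem exists_between_side_eq_zero {p q : Circle} {z w : ClosedDisk} (hz : 0 < side p q z)
    (hw : side p q w < 0) : ∃ a : ℝ, 0 < a ∧ a < 1 ∧ side p q (between z w a) = 0 := by
  rw [side_pos_iff] at hz
  rw [side_neg_iff] at hw
  set c := chord p q (klein z : ClosedDisk)
  set d := chord p q (klein w : ClosedDisk)
  have h1 : 0 < c - d := by linarith
  have h0 : 0 < c / (c - d) := div_pos hz h1
  have h2 : c / (c - d) < 1 := by rw [div_lt_one h1]; linarith
  refine ⟨c / (c - d), h0, h2, ?_⟩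
  rw [side_eq_zero_iff, chord_between p q h0.le h2.le]
  change (1 - c / (c - d)) * c + c / (c - d) * d = 0
  field_simp
  ring

end Mating

namespace Mating

/-! ### Ideal polygons -/

/-- An ideal polygon with `N ≥ 3` vertices `exp (i φ 0), …, exp (i φ (N - 1))` in
counter-clockwise order; `φ N` is one full turn after `φ 0`, so that the sides join the vertices
number `i` and `i + 1` for `i < N`. The values `φ i` for `i > N` play no role. -/
structure IdealPolygon where
  N : ℕ
  three_le : 3 ≤ N
  φ : ℕ → ℝ
  lt_of_lt : ∀ i j, i < j → j ≤ N → φ i < φ j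
  close : φ N = φ 0 + 2 * Real.pi

namespace IdealPolygon

variable (X : IdealPolygon)

/-- The vertices. -/
def v (i : ℕ) : Circle := Circle.exp (X.φ i)

/-- The open polygon, as a subset of the open disk. -/
def inner : Set ClosedDisk :=
  {z | z ∈ openDisk ∧ ∀ i < X.N, side (X.v i) (X.v (i + 1)) z < 0}

/-- The closed polygon in the closed disk, with its ideal vertices. -/
def outer : Set ClosedDisk := {z | ∀ i < X.N, side (X.v i) (X.v (i + 1)) z ≤ 0}

theorem v_N : X.v X.N = X.v 0 := by
  rw [v, v, X.close, Circle.exp_add_two_pi]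

theorem le_of_le {i j : ℕ} (h : i ≤ j) (hj : j ≤ X.N) : X.φ i ≤ X.φ j := by
  rcases h.eq_or_lt with rfl | h
  · exact le_rfl
  · exact (X.lt_of_lt i j h hj).le

theorem v_ne {i j : ℕ} (h : i < j) (hj : j < X.N) : X.v i ≠ X.v j := by
  have h1 := X.lt_of_lt i j h hj.le
  have h2 := X.lt_of_lt j X.N hj le_rfl
  have h3 := X.le_of_le (Nat.zero_le i) (h.trans hj).le
  have h4 := X.close
  exact exp_ne_exp h1 (by linarith)

theorem v_ne_succ {i : ℕ} (h : i < X.N) : X.v i ≠ X.v (i + 1) := by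
  have h3 := X.three_le
  rcases (Nat.succ_le_of_lt h).eq_or_lt with h' | h'
  · rw [show i + 1 = X.N from h', v_N]
    exact (X.v_ne (by omega) h).symm
  · exact X.v_ne (Nat.lt_succ_self i) h'

theorem ccw_v {i j l : ℕ} (hij : i < j) (hjl : j < l) (hl : l < X.N) :
    ccw (X.v i) (X.v j) (X.v l) := by
  have h1 := X.lt_of_lt i j hij (hjl.trans hl).le
  have h2 := X.lt_of_lt j l hjl hl.le
  have h3 := X.lt_of_lt l X.N hl le_rfl
  have h4 := X.le_of_le (Nat.zero_le i) (by omega)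
  have h5 := X.close
  exact ccw_exp h1 h2 (by linarith)

/-- The vertices which are not endpoints of a side lie strictly on the inner side of it. -/
theorem side_v_neg {i j : ℕ} (hi : i < X.N) (hj : j < X.N) (h1 : X.v j ≠ X.v i)
    (h2 : X.v j ≠ X.v (i + 1)) : side (X.v i) (X.v (i + 1)) (toDisk (X.v j)) < 0 := by
  rw [side_toDisk_neg]
  have h1' : j ≠ i := fun e => h1 (by rw [e])
  have h2' : j ≠ i + 1 := fun e => h2 (by rw [e])
  rcases (Nat.succ_le_of_lt hi).eq_or_lt with h' | h'
  · rw [show i + 1 = X.N from h', v_N] at h2 ⊢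
    have : j ≠ 0 := fun e => h2 (by rw [e])
    exact X.ccw_v (by omega) (by omega) hi
  · rcases lt_or_gt_of_ne h1' with h | h
    · exact ccw_rotate (ccw_rotate (X.ccw_v h (Nat.lt_succ_self i) h'))
    · exact ccw_rotate (X.ccw_v (Nat.lt_succ_self i) (by omega) hj)

theorem side_v_nonpos {i j : ℕ} (hi : i < X.N) (hj : j ≤ X.N) :
    side (X.v i) (X.v (i + 1)) (toDisk (X.v j)) ≤ 0 := by
  have : ∃ j' < X.N, X.v j' = X.v j := by
    rcases hj.eq_or_lt with rfl | h
    · exact ⟨0, by omega, X.v_N.symm⟩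
    · exact ⟨j, h, rfl⟩
  obtain ⟨j', hj', e⟩ := this
  rw [← e]
  by_cases h1 : X.v j' = X.v i
  · rw [h1, side_left]
  by_cases h2 : X.v j' = X.v (i + 1)
  · rw [h2, side_right]
  exact (X.side_v_neg hi hj' h1 h2).le

theorem v_mem_outer {j : ℕ} (hj : j ≤ X.N) : toDisk (X.v j) ∈ X.outer :=
  fun _ hi => X.side_v_nonpos hi hj

theorem pair_ne {i j : ℕ} (hi : i < X.N) (hj : j < X.N) (h : i ≠ j) :
    (X.v j ≠ X.v i ∧ X.v j ≠ X.v (i + 1)) ∨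
      (X.v (j + 1) ≠ X.v i ∧ X.v (j + 1) ≠ X.v (i + 1)) := by
  have h3 := X.three_le
  have key : ∀ a b : ℕ, a < X.N → b < X.N → a ≠ b → X.v a ≠ X.v b := by
    intro a b ha hb hab
    rcases lt_or_gt_of_ne hab with h | h
    · exact X.v_ne h hb
    · exact (X.v_ne h ha).symm
  by_cases h1 : j = i + 1
  · right
    subst h1
    refine ⟨?_, (X.v_ne_succ hj).symm⟩
    rcases (Nat.succ_le_of_lt hj).eq_or_lt with h' | h'
    · rw [show i + 1 + 1 = X.N from h', v_N]
      exact key _ _ (by omega) hi (by omega)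
    · exact key _ _ h' hi (by omega)
  · rcases (Nat.succ_le_of_lt hi).eq_or_lt with h' | h'
    · rw [show i + 1 = X.N from h', v_N]
      by_cases h0 : j = 0
      · subst h0
        right
        exact ⟨key _ _ (by omega) hi (by omega), key _ _ (by omega) (by omega) (by omega)⟩
      · left
        exact ⟨key _ _ hj hi h.symm, key _ _ hj (by omega) h0⟩
    · left
      exact ⟨key _ _ hj hi h.symm, key _ _ hj h' h1⟩

/-- The sides of a polygon are disjoint, and each one is on the inner side of all others. -/
theorem side_neg_of_mem_geodesic {i j : ℕ} (hi : i < X.N) (hj : j < X.N) (h : i ≠ j)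
    {z : ClosedDisk} (hz : z ∈ geodesic s(X.v j, X.v (j + 1))) :
    side (X.v i) (X.v (i + 1)) z < 0 := by
  obtain ⟨a, h0, h1, e⟩ := (mem_geodesic_iff (X.v_ne_succ hj)).mp hz
  rw [side_neg_iff, e, chord_combo _ _ _ _ _ _ (by ring)]
  have c1 := X.side_v_nonpos hi hj.le
  have c2 := X.side_v_nonpos hi (Nat.succ_le_of_lt hj)
  rw [side_nonpos_iff, klein_toDisk] at c1 c2
  change chord _ _ (X.v j) ≤ 0 at c1
  change chord _ _ (X.v (j + 1)) ≤ 0 at c2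
  rcases X.pair_ne hi hj h with ⟨d1, d2⟩ | ⟨d1, d2⟩
  · have c3 := X.side_v_neg hi hj d1 d2
    rw [side_neg_iff, klein_toDisk] at c3
    change chord _ _ (X.v j) < 0 at c3
    nlinarith
  · have : ∃ j' < X.N, X.v j' = X.v (j + 1) := by
      rcases (Nat.succ_le_of_lt hj).eq_or_lt with h' | h'
      · exact ⟨0, by omega, by rw [show j + 1 = X.N from h', v_N]⟩
      · exact ⟨j + 1, h', rfl⟩
    obtain ⟨j', hj', e'⟩ := this
    rw [← e'] at d1 d2 c2 ⊢
    have c3 := X.side_v_neg hi hj' d1 d2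
    rw [side_neg_iff, klein_toDisk] at c3
    change chord _ _ (X.v j') < 0 at c3
    nlinarith

theorem geodesic_subset_outer {j : ℕ} (hj : j < X.N) :
    geodesic s(X.v j, X.v (j + 1)) ⊆ X.outer := by
  intro z hz i hi
  by_cases h : i = j
  · subst h
    exact hz.2.le
  · exact (X.side_neg_of_mem_geodesic hi hj h hz).le

theorem isClosed_outer : IsClosed X.outer := by
  have : X.outer = ⋂ i, ⋂ (_ : i < X.N), {z | side (X.v i) (X.v (i + 1)) z ≤ 0} := by
    ext z; simp [outer]
  rw [this]
  exact isClosed_iInter fun i => isClosed_iInter fun _ =>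
    isClosed_le (continuous_side _ _) continuous_const

theorem isOpen_inner : IsOpen X.inner := by
  have : X.inner = openDisk ∩ ⋂ i ∈ Finset.range X.N, {z | side (X.v i) (X.v (i + 1)) z < 0} := by
    ext z; simp [inner]
  rw [this]
  exact isOpen_openDisk.inter (isOpen_biInter_finset fun i _ =>
    isOpen_lt (continuous_side _ _) continuous_const)

theorem inner_subset_outer : X.inner ⊆ X.outer := fun _ hz i hi => (hz.2 i hi).le

/-- Near a point of a side, the inner side of the geodesic belongs to the polygon. -/
theorem eventually_mem_inner {j : ℕ} (hj : j < X.N) {z : ClosedDisk}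
    (hz : z ∈ geodesic s(X.v j, X.v (j + 1))) :
    ∀ᶠ w in 𝓝 z, side (X.v j) (X.v (j + 1)) w < 0 → w ∈ X.inner := by
  have h1 : ∀ᶠ w in 𝓝 z, w ∈ openDisk := isOpen_openDisk.mem_nhds hz.1
  have h2 : ∀ᶠ w in 𝓝 z, ∀ i ∈ Finset.range X.N, i ≠ j → side (X.v i) (X.v (i + 1)) w < 0 := by
    rw [Filter.eventually_all_finset]
    intro i hi
    rw [Finset.mem_range] at hi
    by_cases h : i = j
    · simp [h]
    · have := X.side_neg_of_mem_geodesic hi hj h hz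
      filter_upwards [(isOpen_lt (continuous_side (X.v i) (X.v (i + 1)))
        continuous_const).mem_nhds this] with w hw _ using hw
  filter_upwards [h1, h2] with w hw1 hw2 hw
  refine ⟨hw1, fun i hi => ?_⟩
  by_cases h : i = j
  · rwa [h]
  · exact hw2 i (Finset.mem_range.mpr hi) h

theorem eventually_mem_outer {j : ℕ} (hj : j < X.N) {z : ClosedDisk}
    (hz : z ∈ geodesic s(X.v j, X.v (j + 1))) :
    ∀ᶠ w in 𝓝 z, side (X.v j) (X.v (j + 1)) w ≤ 0 → w ∈ X.outer := by
  filter_upwards [X.eventually_mem_inner hj hz, isOpen_openDisk.mem_nhds hz.1] with w hw hw' h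
  rcases h.lt_or_eq with h | h
  · exact X.inner_subset_outer (hw h)
  · exact X.geodesic_subset_outer hj ⟨hw', h⟩

theorem between_mem_inner {z w : ClosedDisk} (hz : z ∈ X.outer) (hw : w ∈ X.inner) {a : ℝ}
    (h0 : 0 < a) (h1 : a ≤ 1) : between z w a ∈ X.inner := by
  refine ⟨between_mem_openDisk h0 h1 hw.1, fun i hi => ?_⟩
  rw [side_neg_iff, chord_between _ _ h0.le h1]
  have c1 := side_nonpos_iff.mp (hz i hi)
  have c2 := side_neg_iff.mp (hw.2 i hi)
  nlinarith

end IdealPolygon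

theorem exists_mem_geodesic {p q : Circle} (h : p ≠ q) : ∃ z, z ∈ geodesic s(p, q) := by
  have hn : ‖((1 - (1 / 2 : ℝ) : ℝ) : ℂ) * p + ((1 / 2 : ℝ) : ℂ) * q‖ ≤ 1 :=
    norm_combo_le (Circle.norm_coe p).le (Circle.norm_coe q).le (by norm_num) (by norm_num)
  exact ⟨unklein _, (mem_geodesic_iff h).mpr ⟨1 / 2, by norm_num, by norm_num,
    klein_unklein hn⟩⟩

/-- Every neighbourhood of a point of a geodesic contains points on the left of it. -/
theorem exists_side_neg {p q : Circle} (h : p ≠ q) {z : ClosedDisk} (hz : z ∈ geodesic s(p, q))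
    {S : Set ClosedDisk} (hS : S ∈ 𝓝 z) : ∃ w ∈ S, side p q w < 0 := by
  obtain ⟨r, hr⟩ : ∃ r, ccw q r p := by
    obtain ⟨α, rfl⟩ := Circle.exp_surjective q
    obtain ⟨β, b1, b2, rfl⟩ := exists_angle_of_ne h
    exact ⟨Circle.exp ((α + β) / 2), ccw_exp (by linarith) (by linarith) b2⟩
  have h1 := (tendsto_between z (toDisk r)).eventually hS
  have h2 : ∀ᶠ a : ℝ in 𝓝[>] 0, 0 < a ∧ a < 1 := Ioo_mem_nhdsGT one_pos
  obtain ⟨a, ha, h0, ha1⟩ := (h1.and h2).exists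
  refine ⟨_, ha, ?_⟩
  rw [side_neg_iff, chord_between _ _ h0.le ha1.le, side_eq_zero_iff.mp hz.2]
  have := side_toDisk_neg.mpr hr
  rw [side_neg_iff] at this
  nlinarith

namespace IdealPolygon

variable (X : IdealPolygon)

theorem inner_nonempty : X.inner.Nonempty := by
  have h0 : 0 < X.N := by have := X.three_le; omega
  obtain ⟨z, hz⟩ := exists_mem_geodesic (X.v_ne_succ h0)
  obtain ⟨w, hw, hw'⟩ := exists_side_neg (X.v_ne_succ h0) hz (X.eventually_mem_inner h0 hz)
  exact ⟨w, hw hw'⟩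

theorem closure_inner : closure X.inner = X.outer := by
  apply subset_antisymm
  · exact X.isClosed_outer.closure_subset_iff.mpr X.inner_subset_outer
  · intro z hz
    obtain ⟨w, hw⟩ := X.inner_nonempty
    refine mem_closure_of_tendsto (tendsto_between z w) ?_
    filter_upwards [Ioo_mem_nhdsGT one_pos] with a ha
    exact X.between_mem_inner hz hw ha.1 ha.2.le

/-- The only ideal points of a polygon are its vertices. -/
theorem toDisk_mem_outer_iff {p : Circle} : toDisk p ∈ X.outer ↔ ∃ i < X.N, p = X.v i := by
  constructor
  · intro h
    obtain ⟨γ, g1, g2, rfl⟩ := exists_angle (X.φ 0) p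
    have hex : ∃ i, i ≤ X.N ∧ γ < X.φ i := ⟨X.N, le_rfl, by rw [X.close]; exact g2⟩
    classical
    obtain ⟨h1, h2⟩ := Nat.find_spec hex
    have h0 : Nat.find hex ≠ 0 := by
      intro e
      rw [e] at h2
      linarith
    obtain ⟨i, hi⟩ := Nat.exists_eq_succ_of_ne_zero h0
    rw [hi] at h1 h2
    have h3 : X.φ i ≤ γ := by
      by_contra hc
      push Not at hc
      have := Nat.find_min' hex ⟨by omega, hc⟩
      omega
    refine ⟨i, h1, ?_⟩
    rcases h3.eq_or_lt with e | h3
    · rw [v, e]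
    · exfalso
      have h4 := h i h1
      have h5 := X.le_of_le (Nat.zero_le i) (by omega)
      have h6 := X.le_of_le h1 le_rfl
      have h7 := X.close
      have h8 : ccw (X.v i) (Circle.exp γ) (X.v (i + 1)) := by
        have h9 := X.three_le
        refine ccw_exp h3 h2 ?_
        rcases Nat.eq_zero_or_pos i with rfl | h0
        · have := X.lt_of_lt 1 X.N (by omega) le_rfl
          simpa [h7] using this
        · have := X.lt_of_lt 0 i h0 (by omega)
          linarith
      rw [← side_toDisk_pos] at h8
      linarith
  · rintro ⟨i, hi, rfl⟩
    exact X.v_mem_outer hi.le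

end IdealPolygon

/-! ### Polygons that are tiles -/

theorem onCircle_pow (h : diskAut) (n : ℕ) (p : Circle) :
    onCircle (h ^ n) p = (onCircle h)^[n] p := by
  induction n generalizing p with
  | zero => simp
  | succ n ih => rw [pow_succ, onCircle_mul, ih, Function.iterate_succ_apply]

/-- An injective self-map of a finite set has a power which is the identity on it. -/
theorem exists_iterate_eq_self {α : Type*} {S : Set α} (hS : S.Finite) {f : α → α}
    (hf : Set.MapsTo f S S) (hinj : Set.InjOn f S) : ∃ n, 0 < n ∧ ∀ s ∈ S, f^[n] s = s := by
  have := hS.to_subtype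
  have h1 : Function.Injective (hf.restrict f S S) := hf.restrict_inj.mpr hinj
  let σ : Equiv.Perm S := Equiv.ofBijective _ (Finite.injective_iff_bijective.mp h1)
  obtain ⟨n, hn, e⟩ := (isOfFinOrder_of_finite σ).exists_pow_eq_one
  refine ⟨n, hn, fun s hs => ?_⟩
  have h2 : ∀ m : ℕ, ∀ t : S, (((σ ^ m) t : S) : α) = f^[m] t := by
    intro m
    induction m with
    | zero => intro t; rfl
    | succ m ih =>
      intro t
      rw [pow_succ, Equiv.Perm.mul_apply, ih, Function.iterate_succ_apply]
      rfl
  have := h2 n ⟨s, hs⟩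
  rw [e] at this
  exact this.symm

/-- In a torsion-free group, only the identity preserves a finite set of at least three points of
the circle. -/
theorem eq_one_of_mapsTo_finite {Γ : Subgroup diskAut} (htf : IsTorsionFree Γ) {h : diskAut}
    (hh : h ∈ Γ) {S : Set Circle} (hS : S.Finite) (hm : Set.MapsTo (onCircle h) S S)
    {p q r : Circle} (hp : p ∈ S) (hq : q ∈ S) (hr : r ∈ S) (hpq : p ≠ q) (hpr : p ≠ r)
    (hqr : q ≠ r) : h = 1 := by
  obtain ⟨n, hn, e⟩ := exists_iterate_eq_self hS hm (onCircle_injective h).injOn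
  refine htf h hh n hn ?_
  exact eq_one_of_three_fixed _ hpq hpr hqr (by rw [onCircle_pow, e p hp])
    (by rw [onCircle_pow, e q hq]) (by rw [onCircle_pow, e r hr])

namespace IdealPolygon

variable (X : IdealPolygon)

/-- If no translate of a side of the polygon enters the polygon, then the translates of the polygon
under a torsion-free group are pairwise disjoint. -/
theorem eq_one_of_mem_inner {Γ : Subgroup diskAut} (htf : IsTorsionFree Γ)
    (hd : ∀ h ∈ Γ, ∀ i < X.N, ∀ z ∈ X.inner,
      z ∉ geodesic s(onCircle h (X.v i), onCircle h (X.v (i + 1))))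
    {h : diskAut} (hh : h ∈ Γ) {z : ClosedDisk} (hz : z ∈ X.inner) (hz' : h.1 z ∈ X.inner) :
    h = 1 := by
  have key : ∀ w ∈ X.inner, h.1 w ∈ X.inner := by
    intro w hw
    refine ⟨(apply_mem_openDisk h).mpr hw.1, fun i hi => ?_⟩
    have h1 := hd h⁻¹ (Γ.inv_mem hh) i hi
    have h2 : ∀ y, side (onCircle h⁻¹ (X.v i)) (onCircle h⁻¹ (X.v (i + 1))) y < 0 ↔
        side (X.v i) (X.v (i + 1)) (h.1 y) < 0 := by
      intro y
      rw [← side_onCircle_neg h, onCircle_apply_inv, onCircle_apply_inv]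
    rw [← h2]
    by_contra hc
    push Not at hc
    have h3 := (h2 z).mpr (hz'.2 i hi)
    rcases hc.lt_or_eq with hc | hc
    · obtain ⟨a, a0, a1, ha⟩ := exists_between_side_eq_zero hc h3
      have h4 := X.between_mem_inner (X.inner_subset_outer hw) hz a0 a1.le
      exact h1 _ h4 ⟨h4.1, ha⟩
    · exact h1 w hw ⟨hw.1, hc.symm⟩
  have key2 : ∀ w ∈ X.outer, h.1 w ∈ X.outer := by
    intro w hw
    rw [← closure_inner] at hw ⊢
    exact map_mem_closure h.1.continuous hw key
  have h3 := X.three_le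
  refine eq_one_of_mapsTo_finite htf hh (S := {p | ∃ i < X.N, p = X.v i}) ?_ ?_
    (p := X.v 0) (q := X.v 1) (r := X.v 2) ⟨0, by omega, rfl⟩ ⟨1, by omega, rfl⟩
    ⟨2, by omega, rfl⟩ (X.v_ne (by omega) (by omega)) (X.v_ne (by omega) (by omega))
    (X.v_ne (by omega) (by omega))
  · refine ((Set.finite_lt_nat X.N).image X.v).subset ?_
    rintro p ⟨i, hi, rfl⟩
    exact ⟨i, hi, rfl⟩
  · intro p hp
    change ∃ i < X.N, onCircle h p = X.v i
    rw [← toDisk_mem_outer_iff, toDisk_onCircle]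
    exact key2 _ (X.toDisk_mem_outer_iff.mpr hp)

end IdealPolygon

end Mating

namespace Mating

/-! ### Chords through a point and pairs of points -/

theorem eq_or_eq_of_chord_eq_zero {p q r : Circle} (hpq : p ≠ q) (h : chord p q r = 0) :
    r = p ∨ r = q := by
  by_contra hc
  push Not at hc
  rcases ccw_total hc.1.symm hpq hc.2 with h' | h'
  · unfold ccw at h'
    linarith
  · unfold ccw at h'
    rw [chord_swap, chord_rotate, h] at h'
    simp at h'

theorem eq_or_eq_or_ccw {p q r : Circle} (hpq : p ≠ q) (h : 0 ≤ chord p q r) :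
    r = p ∨ r = q ∨ ccw p r q := by
  rcases h.lt_or_eq with h | h
  · exact Or.inr (Or.inr h)
  · rcases eq_or_eq_of_chord_eq_zero hpq h.symm with h | h
    · exact Or.inl h
    · exact Or.inr (Or.inl h)

/-- Through every point of the disk there is a geodesic with a given ideal endpoint. -/
theorem exists_geodesic_through (u : Circle) {z : ClosedDisk} (hz : z ∈ openDisk) :
    ∃ u', u ≠ u' ∧ z ∈ geodesic s(u, u') := by
  have hw := norm_klein_lt hz
  set w : ℂ := ((klein z : ClosedDisk) : ℂ) with hwdef
  have hu := conj_coe_mul u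
  have hun : ‖(u : ℂ)‖ = 1 := Circle.norm_coe u
  have hd : (u : ℂ) * (starRingEnd ℂ) w - 1 ≠ 0 := by
    intro h0
    have h1 : (u : ℂ) * (starRingEnd ℂ) w = 1 := by linear_combination h0
    have h2 := congrArg norm h1
    rw [norm_mul, RCLike.norm_conj, hun, one_mul, norm_one] at h2
    linarith
  have hnum : (u : ℂ) - w = -((u : ℂ) * (starRingEnd ℂ) ((u : ℂ) * (starRingEnd ℂ) w - 1)) := by
    simp only [map_sub, map_mul, Complex.conj_conj, map_one]
    linear_combination w * hu
  have hnorm : ‖((u : ℂ) - w) / ((u : ℂ) * (starRingEnd ℂ) w - 1)‖ = 1 := by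
    rw [norm_div, hnum, norm_neg, norm_mul, RCLike.norm_conj, hun, one_mul]
    exact div_self (norm_ne_zero_iff.mpr hd)
  obtain ⟨u', hu'⟩ : ∃ u' : Circle, (u' : ℂ) = ((u : ℂ) - w) / ((u : ℂ) * (starRingEnd ℂ) w - 1) :=
    ⟨⟨_, mem_sphere_zero_iff_norm.mpr hnorm⟩, rfl⟩
  have hmul : (u' : ℂ) * ((u : ℂ) * (starRingEnd ℂ) w - 1) = (u : ℂ) - w := by
    rw [hu', div_mul_cancel₀ _ hd]
  have hne : u ≠ u' := by
    intro e
    rw [← e] at hmul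
    have h1 : (u : ℂ) * (u * (starRingEnd ℂ) w + (starRingEnd ℂ) u * w - 2) = 0 := by
      linear_combination hmul + w * hu
    have h2 : (u : ℂ) * (starRingEnd ℂ) w + (starRingEnd ℂ) u * w = 2 := by
      rcases mul_eq_zero.mp h1 with h | h
      · rw [h] at hun
        simp at hun
      · linear_combination h
    have h3 := congrArg norm h2
    have h4 := norm_add_le ((u : ℂ) * (starRingEnd ℂ) w) ((starRingEnd ℂ) u * w)
    rw [h3, norm_mul, norm_mul, RCLike.norm_conj, RCLike.norm_conj, hun] at h4
    norm_num at h4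
    linarith
  refine ⟨u', hne, hz, ?_⟩
  rw [side_eq_zero_iff]
  have hcu' := conj_coe_mul u'
  have hmulc := congrArg (starRingEnd ℂ) hmul
  simp only [map_sub, map_mul, Complex.conj_conj, map_one] at hmulc
  have e : (chord u u' w : ℂ) = ((w * (starRingEnd ℂ) ((u : ℂ) - u') + u * (starRingEnd ℂ) (u' : ℂ))
      - (starRingEnd ℂ) (w * (starRingEnd ℂ) ((u : ℂ) - u') + u * (starRingEnd ℂ) (u' : ℂ)))
        / (2 * Complex.I) := by
    rw [Complex.sub_conj, chord, Complex.add_im]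
    push_cast
    field_simp
  have e2 : (chord u u' w : ℂ) = 0 := by
    rw [e]
    simp only [map_add, map_sub, map_mul, Complex.conj_conj]
    rw [div_eq_zero_iff]
    left
    linear_combination (starRingEnd ℂ) (u : ℂ) * hmul - (u : ℂ) * hmulc
      + (w * (starRingEnd ℂ) (u' : ℂ) - u' * (starRingEnd ℂ) w) * hu
  exact_mod_cast e2

/-- A geodesic determines its endpoints. -/
theorem geodesic_injective {p q p' q' : Circle} (h : p ≠ q) (h' : p' ≠ q')
    (e : geodesic s(p, q) ⊆ geodesic s(p', q')) : s(p, q) = s(p', q') := by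
  have key : ∀ a : ℝ, 0 < a → a < 1 → (1 - a) * chord p' q' p + a * chord p' q' q = 0 := by
    intro a h0 h1
    have hk : ((klein (between (toDisk p) (toDisk q) a) : ClosedDisk) : ℂ)
        = ((1 - a : ℝ) : ℂ) * p + (a : ℂ) * q := by
      rw [klein_between h0.le h1.le, klein_toDisk, klein_toDisk]; rfl
    have h2 := e ((mem_geodesic_iff h).mpr ⟨a, h0, h1, hk⟩)
    have h3 := side_eq_zero_iff.mp h2.2
    rwa [hk, chord_combo _ _ _ _ _ _ (by ring)] at h3
  have k1 := key (1 / 2) (by norm_num) (by norm_num)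
  have k2 := key (1 / 3) (by norm_num) (by norm_num)
  have cp : chord p' q' p = 0 := by linarith
  have cq : chord p' q' q = 0 := by linarith
  rw [Sym2.eq_iff]
  rcases eq_or_eq_of_chord_eq_zero h' cp with h1 | h1 <;>
    rcases eq_or_eq_of_chord_eq_zero h' cq with h2 | h2
  · exact absurd (h1.trans h2.symm) h
  · exact Or.inl ⟨h1, h2⟩
  · exact Or.inr ⟨h1, h2⟩
  · exact absurd (h1.trans h2.symm) h

theorem image_geodesic (h : diskAut) (p q : Circle) :
    h.1 '' geodesic s(p, q) = geodesic s(onCircle h p, onCircle h q) := by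
  ext z
  constructor
  · rintro ⟨w, hw, rfl⟩
    exact (apply_mem_geodesic h).mpr hw
  · intro hz
    refine ⟨(h⁻¹).1 z, ?_, apply_inv_apply h z⟩
    rw [← apply_mem_geodesic h, apply_inv_apply]
    exact hz

/-- A half-plane of which the closure contains both endpoints of a geodesic contains the
geodesic. -/
theorem geodesic_subset_halfPlane {p q p' q' : Circle} (h : p ≠ q)
    (hp : toDisk p ∈ halfPlane p' q') (hq : toDisk q ∈ halfPlane p' q') :
    geodesic s(p, q) ⊆ halfPlane p' q' := by
  intro z hz
  obtain ⟨a, h0, h1, e⟩ := (mem_geodesic_iff h).mp hz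
  have cp := side_nonneg_iff.mp hp
  have cq := side_nonneg_iff.mp hq
  rw [klein_toDisk] at cp cq
  change 0 ≤ chord p' q' p at cp
  change 0 ≤ chord p' q' q at cq
  change 0 ≤ side p' q' z
  rw [side_nonneg_iff, e, chord_combo _ _ _ _ _ _ (by ring)]
  have := mul_nonneg h0.le cq
  have := mul_nonneg (sub_nonneg.mpr h1.le) cp
  linarith

theorem toDisk_mem_halfPlane_of_geodesic_subset {p q p' q' : Circle} (h : p ≠ q)
    (hs : geodesic s(p, q) ⊆ halfPlane p' q') :
    toDisk p ∈ halfPlane p' q' := by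
  have hcl : IsClosed (halfPlane p' q') := isClosed_le continuous_const (continuous_side _ _)
  refine hcl.mem_of_tendsto (tendsto_between (toDisk p) (toDisk q)) ?_
  filter_upwards [Ioo_mem_nhdsGT one_pos] with a ha
  refine hs ((mem_geodesic_iff h).mpr ⟨a, ha.1, ha.2, ?_⟩)
  rw [klein_between ha.1.le ha.2.le, klein_toDisk, klein_toDisk]; rfl

theorem mem_halfPlane_iff {p q r : Circle} (h : p ≠ q) :
    toDisk r ∈ halfPlane p q ↔ r = p ∨ r = q ∨ ccw p r q := by
  change 0 ≤ side p q (toDisk r) ↔ _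
  constructor
  · intro h1
    rw [side_nonneg_iff, klein_toDisk] at h1
    exact eq_or_eq_or_ccw h h1
  · rintro (rfl | rfl | h1)
    · rw [side_left]
    · rw [side_right]
    · exact (side_toDisk_pos.mpr h1).le

namespace IdealPolygon

variable (X : IdealPolygon)

theorem succ_lt_add_two_pi {l : ℕ} (hl : l < X.N) : X.φ (l + 1) < X.φ l + 2 * Real.pi := by
  have h3 := X.three_le
  have h4 := X.close
  rcases Nat.eq_zero_or_pos l with rfl | h0
  · have := X.lt_of_lt 1 X.N (by omega) le_rfl
    simpa [h4] using this
  · have := X.lt_of_lt 0 l h0 hl.le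
    have := X.le_of_le (Nat.succ_le_of_lt hl) le_rfl
    linarith

/-- The half-planes cut off by two different sides are disjoint. -/
theorem side_neg_of_nonneg {i j : ℕ} (hi : i < X.N) (hj : j < X.N) (h : i ≠ j)
    {z : ClosedDisk} (hz : z ∈ openDisk) (h1 : 0 ≤ side (X.v i) (X.v (i + 1)) z) :
    side (X.v j) (X.v (j + 1)) z < 0 := by
  by_contra hc
  push Not at hc
  obtain ⟨u', hu, hz'⟩ := exists_geodesic_through (X.v i) hz
  obtain ⟨a, a0, a1, e⟩ := (mem_geodesic_iff hu).mp hz'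
  have c1 := side_nonneg_iff.mp h1
  have c2 := side_nonneg_iff.mp hc
  rw [e, chord_combo _ _ _ _ _ _ (by ring)] at c1 c2
  rw [chord_left, mul_zero, zero_add] at c1
  have c3 : 0 ≤ chord (X.v i) (X.v (i + 1)) u' := by
    by_contra hc'
    push Not at hc'
    nlinarith
  have c4 := X.side_v_nonpos hj hi.le
  rw [side_nonpos_iff, klein_toDisk] at c4
  change chord _ _ (X.v i) ≤ 0 at c4
  have c5 : 0 ≤ chord (X.v j) (X.v (j + 1)) u' := by
    by_contra hc'
    push Not at hc'
    nlinarith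
  rcases eq_or_eq_or_ccw (X.v_ne_succ hi) c3 with h2 | h2 | h2
  · exact hu h2.symm
  · subst h2
    have := X.side_neg_of_mem_geodesic hj hi h.symm hz'
    linarith
  · have hout : u' ≠ X.v j ∧ u' ≠ X.v (j + 1) := by
      have : ∀ l ≤ X.N, u' ≠ X.v l := by
        intro l hl e
        have := X.side_v_nonpos hi hl
        rw [← e] at this
        have := side_toDisk_pos.mpr h2
        linarith
      exact ⟨this j hj.le, this (j + 1) hj⟩
    rcases eq_or_eq_or_ccw (X.v_ne_succ hj) c5 with h3 | h3 | h3
    · exact hout.1 h3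
    · exact hout.2 h3
    · -- the open arcs over two different sides are disjoint
      have aux : ∀ l : ℕ, l < X.N → ccw (X.v l) u' (X.v (l + 1)) →
          ∃ γ, X.φ l < γ ∧ γ < X.φ (l + 1) ∧ Circle.exp γ = u' := by
        intro l hl hcc
        obtain ⟨γ, g1, g2, rfl⟩ := exists_angle_of_ne (ccw_ne_left hcc).symm
        refine ⟨γ, g1, ?_, rfl⟩
        exact (ccw_exp_iff g1 g2 (X.lt_of_lt l (l + 1) (Nat.lt_succ_self l) hl)
          (X.succ_lt_add_two_pi hl)).mp hcc
      obtain ⟨γ, g1, g2, e1⟩ := aux i hi h2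
      obtain ⟨δ, d1, d2, e2⟩ := aux j hj h3
      have b3 := X.le_of_le (Nat.zero_le i) hi.le
      have b4 := X.le_of_le (Nat.succ_le_of_lt hi) le_rfl
      have b5 := X.le_of_le (Nat.zero_le j) hj.le
      have b6 := X.le_of_le (Nat.succ_le_of_lt hj) le_rfl
      have b7 := X.close
      rcases lt_or_gt_of_ne h with hij | hij
      · have b1 := X.le_of_le (show i + 1 ≤ j by omega) hj.le
        exact exp_ne_exp (show γ < δ by linarith) (by linarith) (e1.trans e2.symm)
      · have b1 := X.le_of_le (show j + 1 ≤ i by omega) hi.le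
        exact exp_ne_exp (show δ < γ by linarith) (by linarith) (e2.trans e1.symm)

end IdealPolygon

end Mating

namespace Mating

namespace PiecewiseMobius

variable {P : PiecewiseMobius}

/-! ### Break-points, arcs and regions -/

theorem x_add_k (j : ℤ) : P.x (j + P.k) = P.x j := by
  rw [x, P.θ_periodic, Circle.exp_add_two_pi]; rfl

theorem x_add_mul (j m : ℤ) : P.x (j + m * P.k) = P.x j := by
  induction m using Int.induction_on with
  | zero => simp
  | succ m ih => rw [add_mul, one_mul, ← add_assoc, x_add_k, ih]
  | pred m ih => rw [← ih, ← x_add_k (j + (-(m : ℤ) - 1) * P.k)]; congr 1; ring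

theorem g_add_mul (j m : ℤ) : P.g (j + m * P.k) = P.g j := by
  induction m using Int.induction_on with
  | zero => simp
  | succ m ih => rw [add_mul, one_mul, ← add_assoc, P.g_periodic, ih]
  | pred m ih => rw [← ih, ← P.g_periodic (j + (-(m : ℤ) - 1) * P.k)]; congr 1; ring

theorem x_ne {i j : ℤ} (h : i < j) (h' : j < i + P.k) : P.x i ≠ P.x j := by
  have h1 := P.θ_strictMono h
  have h2 := P.θ_strictMono h'
  rw [P.θ_periodic] at h2
  exact exp_ne_exp h1 h2

theorem ccw_x {i j l : ℤ} (h1 : i < j) (h2 : j < l) (h3 : l < i + P.k) :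
    ccw (P.x i) (P.x j) (P.x l) := by
  have h4 := P.θ_strictMono h3
  rw [P.θ_periodic] at h4
  exact ccw_exp (P.θ_strictMono h1) (P.θ_strictMono h2) h4

theorem ccw_x_iff {i j l : ℤ} (j1 : i < j) (j2 : j < i + P.k) (l1 : i < l) (l2 : l < i + P.k) :
    ccw (P.x i) (P.x j) (P.x l) ↔ j < l := by
  refine ⟨fun h => ?_, fun h => ccw_x j1 h l2⟩
  rcases lt_trichotomy j l with h' | h' | h'
  · exact h'
  · exact absurd (by rw [h']) (ccw_ne_right h)
  · exact absurd (ccw_x l1 h' j2) (ccw_asymm h)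

theorem exists_eq_add_mul (i j : ℤ) : ∃ r m : ℤ, 0 ≤ r ∧ r < P.k ∧ j = i + r + m * P.k := by
  have hk : (0 : ℤ) < P.k := by exact_mod_cast P.k_pos
  refine ⟨(j - i) % P.k, (j - i) / P.k, Int.emod_nonneg _ hk.ne', Int.emod_lt_of_pos _ hk, ?_⟩
  have := Int.emod_add_mul_ediv (j - i) P.k
  linarith

/-- Every vertex occurs once among `k` consecutive ones. -/
theorem exists_x_eq (i : ℤ) {v : Circle} (hv : v ∈ P.vertices) :
    ∃ r : ℤ, 0 ≤ r ∧ r < P.k ∧ v = P.x (i + r) := by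
  obtain ⟨j, rfl⟩ := hv
  obtain ⟨r, m, h0, h1, rfl⟩ := exists_eq_add_mul (P := P) i j
  exact ⟨r, h0, h1, x_add_mul _ _⟩

theorem x_eq_iff {i j : ℤ} : P.x i = P.x j ↔ ∃ m : ℤ, j = i + m * P.k := by
  constructor
  · intro h
    obtain ⟨r, m, h0, h1, rfl⟩ := exists_eq_add_mul (P := P) i j
    rw [x_add_mul] at h
    rcases h0.eq_or_lt with rfl | h0
    · exact ⟨m, by ring⟩
    · exact absurd h (x_ne (by omega) (by omega))
  · rintro ⟨m, rfl⟩
    exact (x_add_mul _ _).symm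

theorem g_mem (j : ℤ) : P.g j ∈ P.group := Subgroup.subset_closure ⟨j, rfl⟩

theorem A_arc {j : ℤ} {p : Circle} (h : p ∈ P.arc j) : P.A p = onCircle (P.g j) p := by
  obtain ⟨t, ht, rfl⟩ := h
  exact P.eq_piece j t ht

theorem x_mem_arc (j : ℤ) : P.x j ∈ P.arc j :=
  ⟨_, ⟨le_rfl, (P.θ_strictMono (by omega)).le⟩, rfl⟩

theorem x_succ_mem_arc (j : ℤ) : P.x (j + 1) ∈ P.arc j :=
  ⟨_, ⟨(P.θ_strictMono (by omega)).le, le_rfl⟩, rfl⟩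

theorem A_x (j : ℤ) : P.A (P.x j) = onCircle (P.g j) (P.x j) := A_arc (x_mem_arc j)

theorem A_x_succ (j : ℤ) : P.A (P.x (j + 1)) = onCircle (P.g j) (P.x (j + 1)) :=
  A_arc (x_succ_mem_arc j)

theorem exists_mem_arc (i : ℤ) (p : Circle) : ∃ r : ℤ, 0 ≤ r ∧ r < P.k ∧ p ∈ P.arc (i + r) := by
  obtain ⟨γ, g1, g2, rfl⟩ := exists_angle (P.θ i) p
  have hex : ∃ n : ℕ, γ < P.θ (i + n) := ⟨P.k, by rw [P.θ_periodic]; exact g2⟩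
  classical
  have h1 := Nat.find_spec hex
  have h0 : Nat.find hex ≠ 0 := by
    intro e
    rw [e] at h1
    simp only [Nat.cast_zero, add_zero] at h1
    linarith
  obtain ⟨n, hn⟩ := Nat.exists_eq_succ_of_ne_zero h0
  have h2 : P.θ (i + n) ≤ γ := by
    by_contra hc
    push Not at hc
    have := Nat.find_min' hex hc
    omega
  have h3 : Nat.find hex ≤ P.k := Nat.find_min' hex (by rw [P.θ_periodic]; exact g2)
  rw [hn] at h1
  refine ⟨n, by omega, by omega, ⟨γ, ⟨h2, ?_⟩, rfl⟩⟩
  push_cast at h1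
  rw [add_assoc]
  exact h1.le

theorem A_injOn_arc (j : ℤ) : Set.InjOn P.A (P.arc j) := by
  intro p hp q hq e
  rw [A_arc hp, A_arc hq] at e
  exact onCircle_injective _ e

/-- A covering of degree at least two has at least three pieces: with at most two pieces,
every arc contains the vertex `x 0`, so that the fibre through it is a singleton. -/
theorem three_le_k (h : IsHigherDegreeCovering P.A) : 3 ≤ P.k := by
  by_contra hc
  obtain ⟨-, d, hd, hf⟩ := h
  have key : P.A ⁻¹' {P.A (P.x 0)} = {P.x 0} := by
    ext p
    simp only [Set.mem_preimage, Set.mem_singleton_iff]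
    refine ⟨fun e => ?_, fun e => by rw [e]⟩
    obtain ⟨r, h0, h1, hp⟩ := exists_mem_arc (P := P) 0 p
    rw [zero_add] at hp
    refine A_injOn_arc r hp ?_ e
    by_cases hr : r = 0
    · rw [hr]
      exact x_mem_arc 0
    · have : r + 1 = 0 + P.k := by omega
      have h2 := x_succ_mem_arc (P := P) r
      rwa [this, x_add_k] at h2
  have := hf (P.A (P.x 0))
  rw [key, Set.ncard_singleton] at this
  omega

section
variable (hk : 3 ≤ P.k)
include hk

theorem mem_arc_iff {j : ℤ} {p : Circle} :
    p ∈ P.arc j ↔ p = P.x j ∨ p = P.x (j + 1) ∨ ccw (P.x j) p (P.x (j + 1)) := by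
  have h1 := P.θ_strictMono (show j < j + 1 by omega)
  have h2 := P.θ_strictMono (show j + 1 < j + P.k by omega)
  rw [P.θ_periodic] at h2
  constructor
  · rintro ⟨t, ⟨t1, t2⟩, rfl⟩
    rcases t1.eq_or_lt with e | t1
    · exact Or.inl (by rw [← e]; rfl)
    rcases t2.eq_or_lt with e | t2
    · exact Or.inr (Or.inl (by rw [e]; rfl))
    exact Or.inr (Or.inr (ccw_exp t1 t2 h2))
  · rintro (rfl | rfl | h)
    · exact x_mem_arc j
    · exact x_succ_mem_arc j
    · obtain ⟨γ, g1, g2, rfl⟩ := exists_angle_of_ne (ccw_ne_left h).symm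
      exact ⟨γ, ⟨g1.le, ((ccw_exp_iff g1 g2 h1 h2).mp h).le⟩, rfl⟩

theorem mem_arcInt_iff {j : ℤ} {p : Circle} :
    p ∈ P.arcInt j ↔ ccw (P.x j) p (P.x (j + 1)) := by
  have h1 := P.θ_strictMono (show j < j + 1 by omega)
  have h2 := P.θ_strictMono (show j + 1 < j + P.k by omega)
  rw [P.θ_periodic] at h2
  constructor
  · rintro ⟨t, ⟨t1, t2⟩, rfl⟩
    exact ccw_exp t1 t2 h2
  · intro h
    obtain ⟨γ, g1, g2, rfl⟩ := exists_angle_of_ne (ccw_ne_left h).symm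
    exact ⟨γ, ⟨g1, (ccw_exp_iff g1 g2 h1 h2).mp h⟩, rfl⟩

theorem mem_arc_iff_region {j : ℤ} {p : Circle} : p ∈ P.arc j ↔ toDisk p ∈ P.region j := by
  rw [mem_arc_iff hk, region, mem_halfPlane_iff (x_ne (by omega) (by omega))]

/-- By the Markov property, `A` maps break-points to break-points. -/
theorem A_mem_vertices (hM : P.IsMarkov) {v : Circle} (hv : v ∈ P.vertices) :
    P.A v ∈ P.vertices := by
  obtain ⟨j, rfl⟩ := hv
  by_contra hc
  obtain ⟨i, -, -, hi⟩ := exists_mem_arc (P := P) 0 (P.A (P.x j))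
  rw [zero_add, mem_arc_iff hk] at hi
  rcases hi with hi | hi | hi
  · exact hc ⟨_, hi.symm⟩
  · exact hc ⟨_, hi.symm⟩
  have hlt := P.θ_strictMono (show j < j + 1 by omega)
  have h1 : Tendsto (fun t => onCircle (P.g j) (Circle.exp t)) (𝓝[>] (P.θ j))
      (𝓝 (P.A (P.x j))) := by
    rw [A_x]
    exact (((continuous_onCircle (P.g j)).comp Circle.exp.continuous).tendsto
      (P.θ j)).mono_left nhdsWithin_le_nhds
  have hopen : IsOpen {p : Circle | ccw (P.x i) p (P.x (i + 1))} :=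
    isOpen_lt continuous_const ((continuous_chord _ _).comp continuous_subtype_val)
  have h2 := h1.eventually (hopen.mem_nhds hi)
  obtain ⟨t, ht, ht'⟩ := (h2.and (Ioo_mem_nhdsGT hlt)).exists
  have h3 : Circle.exp t ∈ P.arcInt j := ⟨t, ht', rfl⟩
  have h4 : P.A (Circle.exp t) = onCircle (P.g j) (Circle.exp t) :=
    P.eq_piece j t ⟨ht'.1.le, ht'.2.le⟩
  have h5 := hM j i ⟨P.A (Circle.exp t), ⟨_, h3, rfl⟩, by rw [h4, mem_arcInt_iff hk]; exact ht⟩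
  obtain ⟨q, hq, e⟩ := h5 ((mem_arcInt_iff hk).mpr hi)
  have hq' : q ∈ P.arc j := by
    obtain ⟨s, hs, rfl⟩ := hq
    exact ⟨s, ⟨hs.1.le, hs.2.le⟩, rfl⟩
  have := A_injOn_arc j hq' (x_mem_arc j) e
  rw [mem_arcInt_iff hk, this] at hq
  exact ccw_ne_left hq rfl

end

/-- The ideal polygon spanned by the break-points, listed from `x s` on. -/
def polygon (hk : 3 ≤ P.k) (s : ℤ) : IdealPolygon where
  N := P.k
  three_le := hk
  φ i := P.θ (s + i)
  lt_of_lt i j h _ := P.θ_strictMono (by omega)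
  close := by rw [P.θ_periodic]; simp

section
variable (hk : 3 ≤ P.k)

theorem polygon_v (s : ℤ) (i : ℕ) : (P.polygon hk s).v i = P.x (s + i) := rfl

theorem polygon_v_succ (s : ℤ) (i : ℕ) : (P.polygon hk s).v (i + 1) = P.x (s + i + 1) := by
  rw [polygon_v]; push_cast; rw [add_assoc]

theorem region_add_mul (j m : ℤ) : P.region (j + m * P.k) = P.region j := by
  rw [region, region, x_add_mul, show j + m * P.k + 1 = j + 1 + m * P.k by ring, x_add_mul]

/-- Every region is one of those over the sides of the polygon. -/
theorem exists_side_eq (s j : ℤ) : ∃ i < (P.polygon hk s).N, ∃ m : ℤ, j = s + i + m * P.k := by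
  obtain ⟨r, m, h0, h1, rfl⟩ := exists_eq_add_mul (P := P) s j
  exact ⟨r.toNat, by change r.toNat < P.k; omega, m, by rw [Int.toNat_of_nonneg h0]⟩

theorem R_eq (s : ℤ) : P.R = (P.polygon hk s).inner := by
  ext z
  constructor
  · rintro ⟨hz, hz'⟩
    refine ⟨hz, fun i hi => ?_⟩
    by_contra hc
    push Not at hc
    rw [polygon_v, polygon_v_succ] at hc
    exact hz' (Set.mem_iUnion.mpr ⟨s + i, hc⟩)
  · rintro ⟨hz, hz'⟩
    refine ⟨hz, fun h => ?_⟩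
    obtain ⟨j, hj⟩ := Set.mem_iUnion.mp h
    obtain ⟨i, hi, m, rfl⟩ := exists_side_eq hk s j
    rw [region_add_mul] at hj
    have := hz' i hi
    rw [polygon_v, polygon_v_succ] at this
    change 0 ≤ side _ _ _ at hj
    linarith

/-- The closure of `R` in the closed disk. -/
theorem closure_R (s : ℤ) : closure P.R = (P.polygon hk s).outer := by
  rw [R_eq hk s, IdealPolygon.closure_inner]

include hk in
/-- Regions which meet in the open disk coincide. -/
theorem eq_of_mem_region {i j : ℤ} {z : ClosedDisk} (hz : z ∈ openDisk) (hi : z ∈ P.region i)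
    (hj : z ∈ P.region j) : ∃ m : ℤ, j = i + m * P.k := by
  obtain ⟨a, ha, m, rfl⟩ := exists_side_eq hk 0 i
  obtain ⟨b, hb, m', rfl⟩ := exists_side_eq hk 0 j
  rw [region_add_mul] at hi hj
  by_cases h : a = b
  · subst h
    exact ⟨m' - m, by ring⟩
  · have h1 : 0 ≤ side ((P.polygon hk 0).v a) ((P.polygon hk 0).v (a + 1)) z := by
      rw [polygon_v, polygon_v_succ]; exact hi
    have h2 := (P.polygon hk 0).side_neg_of_nonneg ha hb h hz h1
    rw [polygon_v, polygon_v_succ] at h2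
    change 0 ≤ side _ _ _ at hj
    linarith

include hk in
theorem frontier_R : frontier P.R =
    (⋃ j : ℤ, geodesic s(P.x j, P.x (j + 1))) ∪ toDisk '' P.vertices := by
  have hfr : frontier P.R = (P.polygon hk 0).outer \ (P.polygon hk 0).inner := by
    rw [frontier, closure_R hk 0, R_eq hk 0, (P.polygon hk 0).isOpen_inner.interior_eq]
  rw [hfr]
  ext z
  constructor
  · rintro ⟨h1, h2⟩
    by_cases hz : z ∈ openDisk
    · left
      have : ∃ i, i < (P.polygon hk 0).N ∧
          0 ≤ side ((P.polygon hk 0).v i) ((P.polygon hk 0).v (i + 1)) z := by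
        by_contra hc
        push Not at hc
        exact h2 ⟨hz, hc⟩
      obtain ⟨i, hi, h3⟩ := this
      have h4 := le_antisymm (h1 i hi) h3
      rw [polygon_v, polygon_v_succ] at h4
      exact Set.mem_iUnion.mpr ⟨_, hz, h4⟩
    · right
      obtain ⟨p, rfl⟩ := not_mem_openDisk_iff.mp hz
      obtain ⟨i, -, rfl⟩ := (P.polygon hk 0).toDisk_mem_outer_iff.mp h1
      exact ⟨_, ⟨_, rfl⟩, rfl⟩
  · rintro (h | ⟨p, ⟨j, rfl⟩, rfl⟩)
    · obtain ⟨j, hj⟩ := Set.mem_iUnion.mp h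
      have h0 : 0 < (P.polygon hk j).N := P.k_pos
      have hj' : z ∈ geodesic s((P.polygon hk j).v 0, (P.polygon hk j).v (0 + 1)) := by
        rw [polygon_v, polygon_v_succ]; simpa using hj
      rw [← closure_R hk 0, ← R_eq hk 0, closure_R hk j, R_eq hk j]
      refine ⟨(P.polygon hk j).geodesic_subset_outer h0 hj', fun h1 => ?_⟩
      have := h1.2 0 h0
      have := hj'.2
      linarith
    · refine ⟨?_, fun h => toDisk_not_mem_openDisk _ h.1⟩
      rw [← closure_R hk 0, closure_R hk j]
      have := (P.polygon hk j).v_mem_outer (Nat.zero_le _)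
      rw [polygon_v] at this
      simpa using this

include hk in
theorem isEdge_iff {e : Sym2 Circle} : P.IsEdge e ↔ ∃ j : ℤ, e = s(P.x j, P.x (j + 1)) := by
  constructor
  · rintro ⟨hd, hs⟩
    induction e using Sym2.ind with
    | _ p q =>
    have hpq : p ≠ q := hd
    obtain ⟨z, hz⟩ := exists_mem_geodesic hpq
    rcases (frontier_R hk ▸ hs) hz with h | ⟨v, -, rfl⟩
    · obtain ⟨j, hj⟩ := Set.mem_iUnion.mp h
      refine ⟨j, geodesic_injective hpq (x_ne (by omega) (by omega)) ?_⟩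
      have hle : ∀ a : ℝ, 0 < a → a < 1 →
          (1 - a) * chord (P.x j) (P.x (j + 1)) p + a * chord (P.x j) (P.x (j + 1)) q ≤ 0 := by
        intro a h0 h1
        have hk' : ((klein (between (toDisk p) (toDisk q) a) : ClosedDisk) : ℂ)
            = ((1 - a : ℝ) : ℂ) * p + (a : ℂ) * q := by
          rw [klein_between h0.le h1.le, klein_toDisk, klein_toDisk]; rfl
        have h2 := hs ((mem_geodesic_iff hpq).mpr ⟨a, h0, h1, hk'⟩)
        have h3 := frontier_subset_closure h2
        rw [closure_R hk j] at h3
        have h4 := h3 0 P.k_pos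
        rw [polygon_v, polygon_v_succ, side_nonpos_iff, hk', chord_combo _ _ _ _ _ _ (by ring)]
          at h4
        simpa using h4
      obtain ⟨a, h0, h1, ez⟩ := (mem_geodesic_iff hpq).mp hz
      have h5 := side_eq_zero_iff.mp hj.2
      rw [ez, chord_combo _ _ _ _ _ _ (by ring)] at h5
      set c := chord (P.x j) (P.x (j + 1)) p
      set d := chord (P.x j) (P.x (j + 1)) q
      have h6 := hle (a / 2) (by linarith) (by linarith)
      have h7 := hle ((1 + a) / 2) (by linarith) (by linarith)
      -- an affine function with an interior maximum is constant
      have hc : c = 0 := by nlinarith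
      have hd : d = 0 := by nlinarith
      intro y hy
      obtain ⟨b, -, -, ey⟩ := (mem_geodesic_iff hpq).mp hy
      refine ⟨hy.1, ?_⟩
      rw [side_eq_zero_iff, ey, chord_combo _ _ _ _ _ _ (by ring)]
      change (1 - b) * c + b * d = 0
      rw [hc, hd]; ring
    · exact absurd hz.1 (toDisk_not_mem_openDisk v)
  · rintro ⟨j, rfl⟩
    refine ⟨x_ne (by omega) (by omega), ?_⟩
    rw [frontier_R hk]
    exact fun z hz => Or.inl (Set.mem_iUnion.mpr ⟨j, hz⟩)

include hk in
theorem isEdge_x (j : ℤ) : P.IsEdge s(P.x j, P.x (j + 1)) := (isEdge_iff hk).mpr ⟨j, rfl⟩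

/-! ### The canonical extension on geodesics -/

include hk in
/-- On geodesics joining two points of the same arc, the extension is given by the map on the
endpoints. -/
theorem extStep_of_mem_arc {i : ℤ} {p q : Circle} (hpq : p ≠ q) (hp : p ∈ P.arc i)
    (hq : q ∈ P.arc i) : P.ExtStep s(p, q) s(P.A p, P.A q) := by
  have hsub : geodesic s(p, q) ⊆ P.region i :=
    geodesic_subset_halfPlane hpq ((mem_arc_iff_region hk).mp hp) ((mem_arc_iff_region hk).mp hq)
  have hA : P.A p ≠ P.A q := fun e => hpq (A_injOn_arc i hp hq e)
  refine ⟨hpq, hA, fun z hz => Set.mem_iUnion.mpr ⟨i, hsub hz⟩, ?_⟩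
  rw [A_arc hp, A_arc hq, ← image_geodesic]
  ext w
  constructor
  · intro hw
    obtain ⟨j, z, ⟨hz, hz'⟩, rfl⟩ := Set.mem_iUnion.mp hw
    obtain ⟨m, rfl⟩ := eq_of_mem_region hk hz.1 (hsub hz) hz'
    rw [g_add_mul]
    exact ⟨z, hz, rfl⟩
  · rintro ⟨z, hz, rfl⟩
    exact Set.mem_iUnion.mpr ⟨i, z, ⟨hz, hsub hz⟩, rfl⟩

include hk in
/-- A geodesic in `Ω` is contained in one of the regions. -/
theorem exists_arc_of_subset {p q : Circle} (hpq : p ≠ q) (h : geodesic s(p, q) ⊆ P.Ω) :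
    ∃ i, p ∈ P.arc i ∧ q ∈ P.arc i := by
  obtain ⟨z, hz⟩ := exists_mem_geodesic hpq
  obtain ⟨i, hi⟩ := Set.mem_iUnion.mp (h hz)
  have hk' : ∀ a : ℝ, 0 ≤ a → a ≤ 1 →
      ((klein (between (toDisk p) (toDisk q) a) : ClosedDisk) : ℂ)
      = ((1 - a : ℝ) : ℂ) * p + (a : ℂ) * q := fun a h0 h1 => by
    rw [klein_between h0 h1, klein_toDisk, klein_toDisk]; rfl
  let f : ℤ → ℝ → ℝ := fun j a =>
    (1 - a) * chord (P.x j) (P.x (j + 1)) p + a * chord (P.x j) (P.x (j + 1)) q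
  have hf : ∀ j, Continuous (f j) := fun j => by fun_prop
  have hreg : ∀ j, ∀ a : ℝ, 0 < a → a < 1 →
      (between (toDisk p) (toDisk q) a ∈ P.region j ↔ 0 ≤ f j a) := by
    intro j a h0 h1
    change 0 ≤ side _ _ _ ↔ _
    rw [side_nonneg_iff, hk' a h0.le h1.le, chord_combo _ _ _ _ _ _ (by ring)]
  have hmem : ∀ a : ℝ, 0 < a → a < 1 → between (toDisk p) (toDisk q) a ∈ geodesic s(p, q) :=
    fun a h0 h1 => (mem_geodesic_iff hpq).mpr ⟨a, h0, h1, hk' a h0.le h1.le⟩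
  -- the regions other than `i`
  let V : Set ℝ := ⋃ n ∈ Finset.Ioo 0 P.k, {a | 0 ≤ f (i + n) a}
  have hV : IsClosed V := isClosed_biUnion_finset fun n _ =>
    isClosed_le continuous_const (hf _)
  have hcov : Set.Ioo (0 : ℝ) 1 ⊆ {a | 0 ≤ f i a} ∪ V := by
    intro a ha
    obtain ⟨j, hj⟩ := Set.mem_iUnion.mp (h (hmem a ha.1 ha.2))
    obtain ⟨r, m, h0, h1, rfl⟩ := exists_eq_add_mul (P := P) i j
    rw [region_add_mul] at hj
    rw [hreg _ a ha.1 ha.2] at hj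
    rcases h0.eq_or_lt with rfl | h0
    · left
      rw [add_zero] at hj
      exact hj
    · right
      refine Set.mem_iUnion₂.mpr ⟨r.toNat, Finset.mem_Ioo.mpr (by omega), ?_⟩
      rw [Set.mem_ofPred_eq, Int.toNat_of_nonneg h0.le]
      exact hj
  obtain ⟨a, h0, h1, ez⟩ := (mem_geodesic_iff hpq).mp hz
  have hza : between (toDisk p) (toDisk q) a = z := by
    apply klein.injective
    apply Subtype.ext
    rw [hk' a h0.le h1.le, ez]
  have hsub : Set.Ioo (0 : ℝ) 1 ⊆ {a | 0 ≤ f i a} := by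
    intro b hb
    by_contra hc
    have hb' := (hcov hb).resolve_left hc
    obtain ⟨c, hc1, hc2, hc3⟩ := (isPreconnected_closed_iff.mp isPreconnected_Ioo)
      {a | 0 ≤ f i a} V (isClosed_le continuous_const (hf _)) hV hcov
      ⟨a, ⟨h0, h1⟩, by rw [← hza, hreg i a h0 h1] at hi; exact hi⟩ ⟨b, hb, hb'⟩
    obtain ⟨n, hn, hn'⟩ := Set.mem_iUnion₂.mp hc3
    rw [Finset.mem_Ioo] at hn
    have r1 := (hreg i c hc1.1 hc1.2).mpr hc2
    have r2 := (hreg _ c hc1.1 hc1.2).mpr hn'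
    obtain ⟨m, hm⟩ := eq_of_mem_region hk (hmem c hc1.1 hc1.2).1 r1 r2
    have h3 : (n : ℤ) = m * P.k := by linarith
    have h4 : P.x i = P.x (i + n) := x_eq_iff.mpr ⟨m, hm⟩
    exact x_ne (by omega) (by omega) h4
  have hgsub : geodesic s(p, q) ⊆ P.region i := by
    intro y hy
    obtain ⟨b, b0, b1, ey⟩ := (mem_geodesic_iff hpq).mp hy
    have : between (toDisk p) (toDisk q) b = y := by
      apply klein.injective
      apply Subtype.ext
      rw [hk' b b0.le b1.le, ey]
    rw [← this, hreg i b b0 b1]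
    exact hsub ⟨b0, b1⟩
  refine ⟨i, ?_, ?_⟩
  · rw [mem_arc_iff_region hk]
    exact toDisk_mem_halfPlane_of_geodesic_subset hpq hgsub
  · rw [mem_arc_iff_region hk]
    rw [Sym2.eq_swap] at hgsub
    exact toDisk_mem_halfPlane_of_geodesic_subset hpq.symm hgsub

include hk in
theorem extStep_iff {e f : Sym2 Circle} : P.ExtStep e f ↔
    ∃ i p q, p ≠ q ∧ p ∈ P.arc i ∧ q ∈ P.arc i ∧ e = s(p, q) ∧ f = s(P.A p, P.A q) := by
  constructor
  · intro h
    induction e using Sym2.ind with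
    | _ p q =>
    induction f using Sym2.ind with
    | _ p' q' =>
    have hpq : p ≠ q := h.1
    obtain ⟨i, hp, hq⟩ := exists_arc_of_subset hk hpq h.2.2.1
    have h2 := extStep_of_mem_arc hk hpq hp hq
    refine ⟨i, p, q, hpq, hp, hq, rfl, ?_⟩
    refine geodesic_injective h.2.1 h2.2.1 ?_
    rw [← h.2.2.2, h2.2.2.2]
  · rintro ⟨i, p, q, hpq, hp, hq, rfl, rfl⟩
    exact extStep_of_mem_arc hk hpq hp hq

include hk in
theorem ExtStep.eq_map {e f : Sym2 Circle} (h : P.ExtStep e f) : f = e.map P.A := by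
  obtain ⟨i, p, q, -, -, -, rfl, rfl⟩ := (extStep_iff hk).mp h
  rfl

include hk in
/-- A vertex on a closed arc is one of its ends. -/
theorem eq_or_eq_of_mem_arc {i : ℤ} {v : Circle} (hv : v ∈ P.vertices)
    (hvi : v ∈ P.arc i) : v = P.x i ∨ v = P.x (i + 1) := by
  rcases (mem_arc_iff hk).mp hvi with h | h | h
  · exact Or.inl h
  · exact Or.inr h
  · exfalso
    obtain ⟨r, h0, h1, rfl⟩ := exists_x_eq i hv
    have hr : 0 < r := by
      rcases h0.eq_or_lt with e | e
      · rw [← e, add_zero] at h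
        exact absurd rfl (ccw_ne_left h)
      · exact e
    have := (ccw_x_iff (by omega) (by omega) (by omega) (by omega)).mp h
    omega

include hk in
/-- Two vertices on a common arc are equal or adjacent. -/
theorem isEdge_of_mem_arc {i : ℤ} {p q : Circle} (hp : p ∈ P.vertices) (hq : q ∈ P.vertices)
    (hpq : p ≠ q) (hpi : p ∈ P.arc i) (hqi : q ∈ P.arc i) : P.IsEdge s(p, q) := by
  rcases eq_or_eq_of_mem_arc hk hp hpi with rfl | rfl <;> rcases eq_or_eq_of_mem_arc hk hq hqi with rfl | rfl
  · exact absurd rfl hpq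
  · exact isEdge_x hk i
  · rw [Sym2.eq_swap]
    exact isEdge_x hk i
  · exact absurd rfl hpq

include hk in
/-- The extension is not defined on diagonals. -/
theorem not_extStep_of_isDiagonal {e f : Sym2 Circle} (h : P.IsDiagonal e) : ¬ P.ExtStep e f := by
  intro hs
  obtain ⟨i, p, q, hpq, hp, hq, rfl, rfl⟩ := (extStep_iff hk).mp hs
  exact h.2.2 (isEdge_of_mem_arc hk (h.2.1 p (by simp)) (h.2.1 q (by simp)) hpq hp hq)

end

end PiecewiseMobius

end Mating

namespace Mating

namespace PiecewiseMobius

variable {P : PiecewiseMobius}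

/-! ### Orbits of edges -/

/-- The standing assumptions on the map. -/
structure StandingAssumptions (P : PiecewiseMobius) : Prop where
  three_le : 3 ≤ P.k
  markov : P.IsMarkov
  expansive : IsExpansive P.A
  minimal : P.IsMinimal
  torsionFree : IsTorsionFree P.group
  noFolding : ¬ P.HasFolding
  equivalent : P.IsEdgeOrbitEquivalent P.group

/-- The translates under `Γ` of the edges of `R`. -/
def edgeOrbits (P : PiecewiseMobius) : Set (Sym2 Circle) :=
  {b | ∃ e, P.IsEdge e ∧ b ∈ pairGroupOrbit P.group e}

theorem map_onCircle_mul (h g : diskAut) (e : Sym2 Circle) :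
    e.map (onCircle (h * g)) = (e.map (onCircle g)).map (onCircle h) := by
  rw [Sym2.map_map, show onCircle (h * g) = onCircle h ∘ onCircle g from
    funext fun p => onCircle_mul h g p]

theorem map_onCircle_one (e : Sym2 Circle) : e.map (onCircle 1) = e := by
  have : onCircle 1 = id := funext fun p => onCircle_one p
  rw [this, Sym2.map_id]; rfl

theorem map_onCircle_inv (h : diskAut) (e : Sym2 Circle) :
    (e.map (onCircle h)).map (onCircle h⁻¹) = e := by
  rw [← map_onCircle_mul, inv_mul_cancel, map_onCircle_one]

theorem mem_edgeOrbits_of_isEdge {e : Sym2 Circle} (h : P.IsEdge e) : e ∈ P.edgeOrbits :=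
  ⟨e, h, 1, P.group.one_mem, (map_onCircle_one e).symm⟩

theorem map_mem_edgeOrbits {b : Sym2 Circle} (hb : b ∈ P.edgeOrbits) {h : diskAut}
    (hh : h ∈ P.group) : b.map (onCircle h) ∈ P.edgeOrbits := by
  obtain ⟨e, he, g, hg, rfl⟩ := hb
  exact ⟨e, he, h * g, P.group.mul_mem hh hg, (map_onCircle_mul _ _ _).symm⟩

theorem map_mem_edgeOrbits_iff {b : Sym2 Circle} {h : diskAut} (hh : h ∈ P.group) :
    b.map (onCircle h) ∈ P.edgeOrbits ↔ b ∈ P.edgeOrbits := by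
  refine ⟨fun hb => ?_, fun hb => map_mem_edgeOrbits hb hh⟩
  have := map_mem_edgeOrbits hb (P.group.inv_mem hh)
  rwa [map_onCircle_inv] at this

theorem A_pair_mem_edgeOrbits {p q : Circle} {i : ℤ} (hp : p ∈ P.arc i) (hq : q ∈ P.arc i)
    (h : s(p, q) ∈ P.edgeOrbits) : s(P.A p, P.A q) ∈ P.edgeOrbits := by
  rw [A_arc hp, A_arc hq]
  exact map_mem_edgeOrbits h (g_mem i)

theorem ExtReaches.iterate (hk : 3 ≤ P.k) {e f : Sym2 Circle} (h : P.ExtReaches e f) :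
    ∃ n, f = (Sym2.map P.A)^[n] e := by
  induction h with
  | refl => exact ⟨0, rfl⟩
  | tail _ hs ih =>
    obtain ⟨n, rfl⟩ := ih
    exact ⟨n + 1, by rw [Function.iterate_succ_apply', hs.eq_map hk]⟩

theorem ExtReaches.vertices (hk : 3 ≤ P.k) (hM : P.IsMarkov) {e f : Sym2 Circle}
    (h : P.ExtReaches e f) (he : ∀ p ∈ e, p ∈ P.vertices) : ∀ p ∈ f, p ∈ P.vertices := by
  induction h with
  | refl => exact he
  | tail _ hs ih =>
    intro p hp
    rw [hs.eq_map hk, Sym2.mem_map] at hp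
    obtain ⟨q, hq, rfl⟩ := hp
    exact A_mem_vertices hk hM (ih q hq)

theorem ExtReaches.eq_of_isDiagonal (hk : 3 ≤ P.k) {e f : Sym2 Circle} (h : P.ExtReaches e f)
    (he : P.IsDiagonal e) : f = e := by
  rcases h.cases_head with h | ⟨c, hc, -⟩
  · exact h.symm
  · exact absurd hc (not_extStep_of_isDiagonal hk he)

theorem extStep_rightUnique (hk : 3 ≤ P.k) : Relator.RightUnique P.ExtStep := fun _ _ _ h h' => by
  rw [h.eq_map hk, h'.eq_map hk]

theorem isEdge_vertices (hk : 3 ≤ P.k) {e : Sym2 Circle} (h : P.IsEdge e) :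
    ∀ p ∈ e, p ∈ P.vertices := by
  obtain ⟨j, rfl⟩ := (isEdge_iff hk).mp h
  intro p hp
  rcases Sym2.mem_iff.mp hp with rfl | rfl
  · exact ⟨_, rfl⟩
  · exact ⟨_, rfl⟩

theorem x_mem_vertices (j : ℤ) : P.x j ∈ P.vertices := ⟨j, rfl⟩

theorem not_isDiag_map {h : diskAut} {e : Sym2 Circle} (he : ¬ e.IsDiag) :
    ¬ (e.map (onCircle h)).IsDiag := by
  induction e using Sym2.ind with
  | _ p q => exact fun h' => he (onCircle_injective h h')

theorem not_isDiag_of_mem_edgeOrbits {b : Sym2 Circle} (hb : b ∈ P.edgeOrbits) : ¬ b.IsDiag := by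
  obtain ⟨e, he, h, -, rfl⟩ := hb
  exact not_isDiag_map he.1

/-- A point sharing an arc with the vertex `x j` lies on one of the two arcs at `x j`. -/
theorem mem_arc_of_mem_arc (hk : 3 ≤ P.k) {i j : ℤ} {y : Circle} (h : P.x j ∈ P.arc i)
    (hy : y ∈ P.arc i) : y ∈ P.arc j ∨ y ∈ P.arc (j - 1) := by
  have harc : ∀ a b : ℤ, P.x a = P.x b → P.arc a = P.arc b := by
    intro a b e
    obtain ⟨m, rfl⟩ := x_eq_iff.mp e
    ext p
    rw [mem_arc_iff hk, mem_arc_iff hk, x_add_mul, show a + m * P.k + 1 = a + 1 + m * P.k by ring,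
      x_add_mul]
  rcases eq_or_eq_of_mem_arc hk (x_mem_vertices j) h with e | e
  · rw [← harc _ _ e] at hy
    exact Or.inl hy
  · have : P.x (j - 1) = P.x i := by
      obtain ⟨m, hm⟩ := x_eq_iff.mp e
      exact x_eq_iff.mpr ⟨m, by linarith⟩
    rw [← harc _ _ this] at hy
    exact Or.inr hy

namespace StandingAssumptions

variable (H : P.StandingAssumptions)
include H

theorem reaches_of_isDiagonal {e d : Sym2 Circle} (he : P.IsEdge e) (hd : P.IsDiagonal d)
    (h : d ∈ pairGroupOrbit P.group e) : P.ExtReaches e d := by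
  obtain ⟨h1, h2⟩ := H.equivalent.1 e he
  rw [← h2, ← h1] at h
  obtain ⟨f, hf, hf'⟩ := h
  rwa [hf'.eq_of_isDiagonal H.three_le hd] at hf

/-- The edges are attached to the diagonals they eventually reach; a diagonal in the orbit of an
edge is unique. -/
theorem eq_of_isDiagonal {d d' : Sym2 Circle} (hd : P.IsDiagonal d) (hd' : P.IsDiagonal d')
    (hE : d ∈ P.edgeOrbits) {h : diskAut} (hh : h ∈ P.group) (e : d' = d.map (onCircle h)) :
    d' = d := by
  obtain ⟨b, hb, hd1⟩ := hE
  have hd2 : d' ∈ pairGroupOrbit P.group b := by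
    obtain ⟨g, hg, rfl⟩ := hd1
    exact ⟨h * g, P.group.mul_mem hh hg, by rw [e, map_onCircle_mul]⟩
  have r1 := H.reaches_of_isDiagonal hb hd hd1
  have r2 := H.reaches_of_isDiagonal hb hd' hd2
  rcases Relation.ReflTransGen.total_of_right_unique (extStep_rightUnique H.three_le) r1 r2 with
    r | r
  · exact ExtReaches.eq_of_isDiagonal H.three_le r hd
  · exact (ExtReaches.eq_of_isDiagonal H.three_le r hd').symm

/-- A diagonal reached by an edge has fixed endpoints: its image is equivalent to the edge as well,
and therefore comes back to the diagonal. -/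
theorem fixed_of_reaches {e d : Sym2 Circle} (he : P.IsEdge e) (hd : P.IsDiagonal d)
    (h : P.ExtReaches e d) : ∀ p ∈ d, P.A p = p := by
  apply H.equivalent.2 d hd
  obtain ⟨h1, h2⟩ := H.equivalent.1 e he
  have hfw : ∀ f, P.ExtReaches e f → f ∈ P.pairForwardOrbit e := by
    intro f hf
    induction hf with
    | refl => exact Relation.ReflTransGen.refl
    | tail _ hs ih => exact Relation.ReflTransGen.tail ih ⟨hs.1, hs.eq_map H.three_le⟩
  have h3 : d.map P.A ∈ P.pairForwardOrbit e :=
    Relation.ReflTransGen.tail (hfw d h) ⟨hd.1, rfl⟩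
  have h4 : d.map P.A ∈ P.extGrandOrbit e := h1 ▸ Or.inl h3
  obtain ⟨f, hf, hf'⟩ := h4
  have h5 : P.ExtReaches (d.map P.A) d := by
    rcases Relation.ReflTransGen.total_of_right_unique (extStep_rightUnique H.three_le) hf h with
      r | r
    · exact hf'.trans r
    · rwa [ExtReaches.eq_of_isDiagonal H.three_le r hd] at hf'
  obtain ⟨n, hn⟩ := h5.iterate H.three_le
  exact ⟨n + 1, Nat.succ_pos n, by
    rw [Function.IsPeriodicPt, Function.IsFixedPt, Function.iterate_succ_apply]; exact hn.symm⟩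

/-- A translate of an edge either lives over one of the arcs, or is a diagonal of `R` with fixed
endpoints. -/
theorem arc_or_diagonal {b : Sym2 Circle} (hb : b ∈ P.edgeOrbits) :
    (∃ i, ∀ p ∈ b, p ∈ P.arc i) ∨ (P.IsDiagonal b ∧ ∀ p ∈ b, P.A p = p) := by
  have hnd := not_isDiag_of_mem_edgeOrbits hb
  obtain ⟨e, he, hbe⟩ := hb
  obtain ⟨h1, h2⟩ := H.equivalent.1 e he
  rw [← h2, ← h1] at hbe
  obtain ⟨f, hf, hf'⟩ := hbe
  rcases hf'.cases_head with h | ⟨c, hc, -⟩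
  · subst h
    by_cases hbe : P.IsEdge b
    · left
      obtain ⟨j, rfl⟩ := (isEdge_iff H.three_le).mp hbe
      refine ⟨j, fun p hp => ?_⟩
      rcases Sym2.mem_iff.mp hp with rfl | rfl
      · exact x_mem_arc j
      · exact x_succ_mem_arc j
    · right
      have hd : P.IsDiagonal b :=
        ⟨hnd, hf.vertices H.three_le H.markov (isEdge_vertices H.three_le he), hbe⟩
      exact ⟨hd, H.fixed_of_reaches he hd hf⟩
  · left
    obtain ⟨i, p, q, hpq, hp, hq, rfl, rfl⟩ := (extStep_iff H.three_le).mp hc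
    refine ⟨i, fun r hr => ?_⟩
    rcases Sym2.mem_iff.mp hr with rfl | rfl
    · exact hp
    · exact hq

theorem edge_or_diagonal {p q : Circle} (hb : s(p, q) ∈ P.edgeOrbits) (hp : p ∈ P.vertices)
    (hq : q ∈ P.vertices) :
    P.IsEdge s(p, q) ∨ (P.IsDiagonal s(p, q) ∧ P.A p = p ∧ P.A q = q) := by
  rcases H.arc_or_diagonal hb with ⟨i, hi⟩ | ⟨h1, h2⟩
  · exact Or.inl (isEdge_of_mem_arc H.three_le hp hq (not_isDiag_of_mem_edgeOrbits hb)
      (hi p (by simp)) (hi q (by simp)))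
  · exact Or.inr ⟨h1, h2 p (by simp), h2 q (by simp)⟩

/-- Translates of edges do not cross edges. -/
theorem not_cross_edge {j : ℤ} {r s : Circle} (hb : s(r, s) ∈ P.edgeOrbits)
    (h1 : ccw (P.x j) r (P.x (j + 1))) (h2 : ccw (P.x (j + 1)) s (P.x j)) : False := by
  have hk := H.three_le
  have hne : ∀ v ∈ P.vertices, r ≠ v := by
    rintro v hv rfl
    have : r ∈ P.arc j := (mem_arc_iff hk).mpr (Or.inr (Or.inr h1))
    rcases eq_or_eq_of_mem_arc hk hv this with e | e
    · exact ccw_ne_left h1 e.symm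
    · exact ccw_ne_right h1 e
  rcases H.arc_or_diagonal hb with ⟨i, hi⟩ | ⟨h, -⟩
  · have hr := hi r (by simp)
    have hs := hi s (by simp)
    have hz : ∃ m : ℤ, j = i + m * P.k := by
      obtain ⟨a, m, a0, a1, rfl⟩ := exists_eq_add_mul (P := P) i j
      rcases a0.eq_or_lt with rfl | a0
      · exact ⟨m, by ring⟩
      exfalso
      rw [show i + a + m * P.k + 1 = i + a + 1 + m * P.k by ring, x_add_mul, x_add_mul] at h1
      rcases (mem_arc_iff hk).mp hr with e | e | e
      · exact hne _ (x_mem_vertices _) e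
      · exact hne _ (x_mem_vertices _) e
      · obtain ⟨γ, g1, g2, rfl⟩ := exists_angle_of_ne (ccw_ne_left e).symm
        have t1 := P.θ_strictMono (show i < i + 1 by omega)
        have t2 := P.θ_strictMono (show i + 1 < i + P.k by omega)
        have t3 : P.θ (i + 1) ≤ P.θ (i + a) := P.θ_strictMono.monotone (by omega)
        have t4 : P.θ (i + a + 1) ≤ P.θ (i + P.k) := P.θ_strictMono.monotone (by omega)
        have t5 := P.θ_strictMono (show i + a < i + a + 1 by omega)
        rw [P.θ_periodic] at t2 t4
        have g3 := (ccw_exp_iff g1 g2 t1 t2).mp e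
        have : ccw (P.x (i + a)) (P.x (i + a + 1)) (Circle.exp γ) := by
          have : ccw (P.x (i + a)) (P.x (i + a + 1)) (Circle.exp (γ + 2 * Real.pi)) :=
            ccw_exp t5 (by linarith) (by linarith)
          rwa [Circle.exp_add_two_pi] at this
        exact ccw_asymm h1 this
    obtain ⟨m, rfl⟩ := hz
    rw [show i + m * P.k + 1 = i + 1 + m * P.k by ring, x_add_mul, x_add_mul] at h2
    rcases (mem_arc_iff hk).mp hs with e | e | e
    · exact ccw_ne_right h2 e
    · exact ccw_ne_left h2 e.symm
    · exact ccw_asymm (ccw_rotate (ccw_rotate h2)) (ccw_rotate (ccw_rotate (ccw_rotate e)))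
  · exact hne r (h.2.1 r (by simp)) rfl

/-- Translates of edges do not cross each other. -/
theorem not_cross {p q r s : Circle} (hb : s(p, q) ∈ P.edgeOrbits) (hb' : s(r, s) ∈ P.edgeOrbits)
    (h1 : ccw p r q) (h2 : ccw q s p) : False := by
  obtain ⟨e, he, h, hh, hbe⟩ := hb
  obtain ⟨j, rfl⟩ := (isEdge_iff H.three_le).mp he
  have h3 := map_mem_edgeOrbits hb' (P.group.inv_mem hh)
  have hpq : s(onCircle h⁻¹ p, onCircle h⁻¹ q) = s(P.x j, P.x (j + 1)) := by
    rw [← map_onCircle_inv h s(P.x j, P.x (j + 1)), ← hbe]; rfl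
  rw [← ccw_onCircle h⁻¹] at h1 h2
  rcases Sym2.eq_iff.mp hpq with ⟨e1, e2⟩ | ⟨e1, e2⟩
  · rw [e1, e2] at h1 h2
    exact H.not_cross_edge h3 h1 h2
  · rw [e1, e2] at h1 h2
    rw [Sym2.map_mk, Sym2.eq_swap] at h3
    exact H.not_cross_edge h3 h2 h1

/-- An element of `Γ` fixing both ends of an edge moves the next vertex away along infinitely
many vertices, unless it is the identity. -/
theorem eq_one_of_fixed {j : ℤ} {h : diskAut} (hh : h ∈ P.group)
    (h1 : onCircle h (P.x j) = P.x j) (h2 : onCircle h (P.x (j + 1)) = P.x (j + 1)) : h = 1 := by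
  have hk := H.three_le
  set c := P.x j with hc
  set a := P.x (j + 1) with ha
  set b := P.x (j + 1 + 1) with hb
  have hcab : ccw c a b := ccw_x (by omega) (by omega) (by omega)
  have key : ∀ g ∈ P.group, onCircle g c = c → onCircle g a = a → ¬ ccw a b (onCircle g b) := by
    intro g hg gc ga hab
    have p1 : ∀ n : ℕ, onCircle (g ^ n) a = a ∧ onCircle (g ^ n) c = c := by
      intro n
      induction n with
      | zero => simp
      | succ n ih => rw [pow_succ, onCircle_mul, onCircle_mul, ga, gc]; exact ih
    -- the images of `b` under the powers of `g` stay on the arc from `b` to `c`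
    have p2 : ∀ n : ℕ, ccw a b (onCircle (g ^ (n + 1)) b) := by
      intro n
      induction n with
      | zero => simpa using hab
      | succ n ih =>
        have := (ccw_onCircle g).mpr ih
        rw [ga, ← onCircle_mul, ← pow_succ'] at this
        exact ccw_trans hab this
    have p3 : ∀ n : ℕ, ccw a (onCircle (g ^ (n + 1)) b) c := by
      intro n
      have := (ccw_onCircle (g ^ (n + 1))).mpr (ccw_rotate hcab)
      rwa [(p1 _).1, (p1 _).2] at this
    -- they are on neither of the arcs at `a`, so that they are endpoints of diagonals
    have p4 : ∀ n : ℕ, onCircle (g ^ (n + 1)) b ∈ P.vertices := by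
      intro n
      have hmem : s(a, onCircle (g ^ (n + 1)) b) ∈ P.edgeOrbits := by
        have := map_mem_edgeOrbits (mem_edgeOrbits_of_isEdge (isEdge_x hk (j + 1)))
          (P.group.pow_mem hg (n + 1))
        rw [Sym2.map_mk] at this
        change s(onCircle (g ^ (n + 1)) a, _) ∈ _ at this
        rwa [(p1 _).1] at this
      rcases H.arc_or_diagonal hmem with ⟨i, hi⟩ | ⟨hd, -⟩
      · exfalso
        have ia := hi a (by simp)
        have ib := hi _ (Sym2.mem_mk_right a _)
        have q2 := p2 n
        have q3 := p3 n
        rcases mem_arc_of_mem_arc hk ia ib with hy | hy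
        · rcases (mem_arc_iff hk).mp hy with e | e | e
          · exact ccw_ne_left q3 e.symm
          · exact ccw_ne_right q2 e.symm
          · exact ccw_asymm q2 e
        · rw [show j + 1 - 1 = j by ring] at hy
          rcases (mem_arc_iff hk).mp hy with e | e | e
          · exact ccw_ne_right q3 e
          · exact ccw_ne_left q3 e.symm
          · exact ccw_asymm (ccw_rotate (ccw_rotate q3)) e
      · exact hd.2.1 _ (Sym2.mem_mk_right a _)
    have hfin : P.vertices.Finite := by
      refine ((Set.finite_lt_nat P.k).image fun n : ℕ => P.x (0 + n)).subset fun v hv => ?_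
      obtain ⟨r, h0, h1, rfl⟩ := exists_x_eq 0 hv
      exact ⟨r.toNat, by change r.toNat < P.k; omega, by
        change P.x (0 + (r.toNat : ℤ)) = _
        rw [Int.toNat_of_nonneg h0]⟩
    have := hfin.to_subtype
    obtain ⟨m, n, hmn, e⟩ := Finite.exists_ne_map_eq_of_infinite
      (fun n : ℕ => (⟨_, p4 n⟩ : P.vertices))
    have e' : onCircle (g ^ (m + 1)) b = onCircle (g ^ (n + 1)) b := congrArg Subtype.val e
    have last : ∀ m n : ℕ, m < n → onCircle (g ^ (m + 1)) b = onCircle (g ^ (n + 1)) b → False := by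
      intro m n hmn e
      have e2 : onCircle (g ^ (n - m)) b = b := by
        apply onCircle_injective (g ^ (m + 1))
        rw [← onCircle_mul, ← pow_add, show m + 1 + (n - m) = n + 1 by omega, e]
      have e3 : g ^ (n - m) = 1 := eq_one_of_three_fixed _ (ccw_ne_left hcab) (ccw_ne_outer hcab)
        (ccw_ne_right hcab) (p1 _).2 (p1 _).1 e2
      have e4 : g = 1 := H.torsionFree g hg _ (by omega) e3
      rw [e4, onCircle_one] at hab
      exact ccw_ne_right hab rfl
    rcases lt_or_gt_of_ne hmn with h | h
    · exact last m n h e'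
    · exact last n m h e'.symm
  by_cases hfix : onCircle h b = b
  · exact eq_one_of_three_fixed h (ccw_ne_left hcab) (ccw_ne_outer hcab) (ccw_ne_right hcab)
      h1 h2 hfix
  exfalso
  have hab : a ≠ b := ccw_ne_right hcab
  have hab' : a ≠ onCircle h b := fun e => hab (onCircle_injective h (h2.trans e))
  rcases ccw_total hab hab' (fun e => hfix e.symm) with h3 | h3
  · exact key h hh h1 h2 h3
  · refine key h⁻¹ (P.group.inv_mem hh) ?_ ?_ ?_
    · rw [← h1, onCircle_inv_apply, h1]
    · rw [← h2, onCircle_inv_apply, h2]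
    · have := (ccw_onCircle h⁻¹).mpr h3
      rwa [onCircle_inv_apply, show onCircle h⁻¹ a = a by
        conv_lhs => rw [← h2, onCircle_inv_apply]] at this

/-- The stabilizer of an edge in `Γ` is trivial. -/
theorem eq_one_of_map_edge {e : Sym2 Circle} (he : P.IsEdge e) {h : diskAut} (hh : h ∈ P.group)
    (h1 : e.map (onCircle h) = e) : h = 1 := by
  obtain ⟨j, rfl⟩ := (isEdge_iff H.three_le).mp he
  rw [Sym2.map_mk] at h1
  rcases Sym2.eq_iff.mp h1 with ⟨e1, e2⟩ | ⟨e1, e2⟩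
  · exact H.eq_one_of_fixed hh e1 e2
  · refine H.torsionFree h hh 2 two_pos (H.eq_one_of_fixed (j := j) (P.group.pow_mem hh 2) ?_ ?_)
    · rw [pow_two, onCircle_mul, e1, e2]
    · rw [pow_two, onCircle_mul, e2, e1]

/-- The stabilizer in `Γ` of any translate of an edge is trivial. -/
theorem eq_one_of_map_eq {b : Sym2 Circle} (hb : b ∈ P.edgeOrbits) {h : diskAut}
    (hh : h ∈ P.group) (h1 : b.map (onCircle h) = b) : h = 1 := by
  obtain ⟨e, he, g, hg, rfl⟩ := hb
  have h2 : e.map (onCircle (g⁻¹ * (h * g))) = e := by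
    rw [map_onCircle_mul, map_onCircle_mul, h1, map_onCircle_inv]
  have h3 := H.eq_one_of_map_edge he
    (P.group.mul_mem (P.group.inv_mem hg) (P.group.mul_mem hh hg)) h2
  have h4 : h * g = g := (inv_mul_eq_one.mp h3).symm
  exact mul_eq_right.mp h4

theorem g_ne_one (j : ℤ) : P.g j ≠ 1 := by
  intro h
  obtain ⟨δ, hδ, hexp⟩ := H.expansive
  have hfix : ∀ p ∈ P.arc j, P.A p = p := fun p hp => by rw [A_arc hp, h, onCircle_one]
  have hlt := P.θ_strictMono (show j < j + 1 by omega)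
  have hcont : Tendsto (fun t => Circle.exp t) (𝓝[>] (P.θ j)) (𝓝 (P.x j)) :=
    (Circle.exp.continuous.tendsto (P.θ j)).mono_left nhdsWithin_le_nhds
  obtain ⟨t, ht, ht'⟩ := ((hcont.eventually (Metric.ball_mem_nhds (P.x j) hδ)).and
    (Ioo_mem_nhdsGT hlt)).exists
  have htarc : Circle.exp t ∈ P.arc j := ⟨t, ⟨ht'.1.le, ht'.2.le⟩, rfl⟩
  have hne : Circle.exp t ≠ P.x j := by
    have h3 := P.θ_strictMono (show j + 1 < j + P.k by have := H.three_le; omega)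
    rw [P.θ_periodic] at h3
    exact (exp_ne_exp ht'.1 (by linarith [ht'.2])).symm
  obtain ⟨n, hn⟩ := hexp _ _ hne
  have hit : ∀ p ∈ P.arc j, P.A^[n] p = p := fun p hp =>
    Function.iterate_fixed (hfix p hp) n
  rw [hit _ htarc, hit _ (x_mem_arc j)] at hn
  have : dist (Circle.exp t) (P.x j) < δ := ht
  linarith

/-- No edge is mapped onto itself. -/
theorem map_edge_ne (j : ℤ) : s(P.A (P.x j), P.A (P.x (j + 1))) ≠ s(P.x j, P.x (j + 1)) := by
  rw [A_x, A_x_succ]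
  intro h
  exact H.g_ne_one j (H.eq_one_of_map_edge (isEdge_x H.three_le j) (g_mem j) h)

/-- Adjacent vertices are not both fixed. -/
theorem not_both_fixed {j : ℤ} (h1 : P.A (P.x j) = P.x j) (h2 : P.A (P.x (j + 1)) = P.x (j + 1)) :
    False := H.map_edge_ne j (by rw [h1, h2])

theorem A_x_ne (j : ℤ) : P.A (P.x j) ≠ P.A (P.x (j + 1)) := fun e =>
  x_ne (show j < j + 1 by omega) (by have := H.three_le; omega)
    (A_injOn_arc j (x_mem_arc j) (x_succ_mem_arc j) e)

/-- There is no folding at any vertex. -/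
theorem A_pred_ne_A_succ (j : ℤ) : P.A (P.x (j - 1)) ≠ P.A (P.x (j + 1)) := by
  intro e
  have hk := H.three_le
  have ed : P.IsEdge s(P.x (j - 1), P.x j) := by
    simpa using isEdge_x hk (j - 1)
  refine H.noFolding ⟨P.x (j - 1), P.x j, P.x (j + 1), x_ne (by omega) (by omega), ed,
    isEdge_x hk j, ?_⟩
  have s1 := extStep_of_mem_arc hk ed.1 (x_mem_arc (j - 1))
    (by simpa using x_succ_mem_arc (P := P) (j - 1))
  have s2 := extStep_of_mem_arc hk (isEdge_x hk j).1 (x_mem_arc j) (x_succ_mem_arc j)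
  rw [s1.2.2.2, s2.2.2.2, e, Sym2.eq_swap]

theorem g_ne (j : ℤ) : P.g (j - 1) ≠ P.g j := fun e =>
  H.minimal ⟨j, P.g j, g_mem j, fun _ hz => A_arc hz, fun _ hz => by rw [A_arc hz, e]⟩

theorem A_edge_mem_edgeOrbits (j : ℤ) : s(P.A (P.x j), P.A (P.x (j + 1))) ∈ P.edgeOrbits :=
  A_pair_mem_edgeOrbits (x_mem_arc j) (x_succ_mem_arc j)
    (mem_edgeOrbits_of_isEdge (isEdge_x H.three_le j))

/-- The image of an edge is an edge or a diagonal with fixed endpoints. -/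
theorem edge_or_diagonal_map (j : ℤ) : P.IsEdge s(P.A (P.x j), P.A (P.x (j + 1))) ∨
    (P.IsDiagonal s(P.A (P.x j), P.A (P.x (j + 1))) ∧
      P.A (P.A (P.x j)) = P.A (P.x j) ∧ P.A (P.A (P.x (j + 1))) = P.A (P.x (j + 1))) :=
  H.edge_or_diagonal (H.A_edge_mem_edgeOrbits j)
    (A_mem_vertices H.three_le H.markov (x_mem_vertices _))
    (A_mem_vertices H.three_le H.markov (x_mem_vertices _))

end StandingAssumptions

end PiecewiseMobius

end Mating

namespace Mating

/-- If an automorphism takes a side of one polygon to a side of another one, preserving the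
orientation, then the image of the first polygon meets the second one. -/
theorem IdealPolygon.exists_mem_inner (X Y : IdealPolygon) {i j : ℕ} (hi : i < X.N) (hj : j < Y.N)
    {h : diskAut} (h1 : onCircle h (X.v i) = Y.v j) (h2 : onCircle h (X.v (i + 1)) = Y.v (j + 1)) :
    ∃ z ∈ X.inner, h.1 z ∈ Y.inner := by
  obtain ⟨z, hz⟩ := exists_mem_geodesic (X.v_ne_succ hi)
  have hz' : h.1 z ∈ geodesic s(Y.v j, Y.v (j + 1)) := by
    rw [← h1, ← h2]
    exact (apply_mem_geodesic h).mpr hz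
  have e1 := X.eventually_mem_inner hi hz
  have e2 := h.1.continuous.continuousAt.eventually (Y.eventually_mem_inner hj hz')
  obtain ⟨w, ⟨hw1, hw2⟩, hw⟩ := exists_side_neg (X.v_ne_succ hi) hz (e1.and e2)
  refine ⟨w, hw1 hw, hw2 ?_⟩
  rw [← h1, ← h2]
  exact (side_onCircle_neg h).mpr hw

namespace PiecewiseMobius

variable {P : PiecewiseMobius}

/-! ### Edges which reach diagonals and edges which do not -/

theorem eq_of_isEdge_x (hk : 3 ≤ P.k) {i : ℤ} {y : Circle} (h : P.IsEdge s(P.x i, y)) :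
    y = P.x (i + 1) ∨ y = P.x (i - 1) := by
  obtain ⟨j, hj⟩ := (isEdge_iff hk).mp h
  rcases Sym2.eq_iff.mp hj with ⟨e1, e2⟩ | ⟨e1, e2⟩
  · obtain ⟨m, rfl⟩ := x_eq_iff.mp e1
    left
    rw [e2, show i + m * P.k + 1 = i + 1 + m * P.k by ring, x_add_mul]
  · obtain ⟨m, hm⟩ := x_eq_iff.mp e1
    right
    rw [e2, show j = i - 1 + m * P.k by linarith, x_add_mul]

theorem isEdge_pred (hk : 3 ≤ P.k) (j : ℤ) : P.IsEdge s(P.x j, P.x (j - 1)) := by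
  rw [Sym2.eq_swap]
  simpa using isEdge_x hk (j - 1)

theorem x_pred_ne_succ (hk : 3 ≤ P.k) (j : ℤ) : P.x (j - 1) ≠ P.x (j + 1) :=
  x_ne (by omega) (by omega)

/-- Some iterate of the edge is a diagonal. -/
def Hits (P : PiecewiseMobius) (e : Sym2 Circle) : Prop :=
  ∃ n, P.IsDiagonal ((Sym2.map P.A)^[n] e)

theorem hits_map {e : Sym2 Circle} (h : P.Hits (e.map P.A)) : P.Hits e := by
  obtain ⟨n, hn⟩ := h
  exact ⟨n + 1, hn⟩

/-- The pair of the neighbours of `x m`, in either order. -/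
def AreNeighbors (P : PiecewiseMobius) (m : ℤ) (y y' : Circle) : Prop :=
  (y = P.x (m + 1) ∧ y' = P.x (m - 1)) ∨ (y = P.x (m - 1) ∧ y' = P.x (m + 1))

theorem AreNeighbors.swap {m : ℤ} {y y' : Circle} (h : P.AreNeighbors m y y') :
    P.AreNeighbors m y' y := by
  rcases h with ⟨h1, h2⟩ | ⟨h1, h2⟩
  · exact Or.inr ⟨h2, h1⟩
  · exact Or.inl ⟨h2, h1⟩

theorem AreNeighbors.isEdge (hk : 3 ≤ P.k) {m : ℤ} {y y' : Circle} (h : P.AreNeighbors m y y') :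
    P.IsEdge s(P.x m, y) := by
  rcases h with ⟨rfl, -⟩ | ⟨rfl, -⟩
  · exact isEdge_x hk m
  · exact isEdge_pred hk m

namespace StandingAssumptions

variable (H : P.StandingAssumptions)
include H

theorem map_isEdge_or {e : Sym2 Circle} (he : P.IsEdge e) : P.IsEdge (e.map P.A) ∨
    (P.IsDiagonal (e.map P.A) ∧ ∀ p ∈ e, P.A (P.A p) = P.A p) := by
  obtain ⟨j, rfl⟩ := (isEdge_iff H.three_le).mp he
  rcases H.edge_or_diagonal_map j with h | ⟨h, h1, h2⟩
  · exact Or.inl h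
  · refine Or.inr ⟨h, fun p hp => ?_⟩
    rcases Sym2.mem_iff.mp hp with rfl | rfl
    · exact h1
    · exact h2

theorem exists_A_x (j : ℤ) : ∃ i, P.A (P.x j) = P.x i := by
  obtain ⟨i, hi⟩ := A_mem_vertices H.three_le H.markov (x_mem_vertices j)
  exact ⟨i, hi.symm⟩

/-- If both edges at a vertex are mapped to edges, then `A` is locally an isometry or a reflection
of the cyclic graph of edges. -/
theorem areNeighbors_map {j i : ℤ} {y y' : Circle}
    (hn : P.AreNeighbors j y y') (h1 : P.IsEdge s(P.x i, P.A y))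
    (h2 : P.IsEdge s(P.x i, P.A y')) : P.AreNeighbors i (P.A y) (P.A y') := by
  have hne : P.A y ≠ P.A y' := by
    rcases hn with ⟨rfl, rfl⟩ | ⟨rfl, rfl⟩
    · exact (H.A_pred_ne_A_succ j).symm
    · exact H.A_pred_ne_A_succ j
  rcases eq_of_isEdge_x H.three_le h1 with e1 | e1 <;>
    rcases eq_of_isEdge_x H.three_le h2 with e2 | e2
  · exact absurd (e1.trans e2.symm) hne
  · exact Or.inl ⟨e1, e2⟩
  · exact Or.inr ⟨e1, e2⟩
  · exact absurd (e1.trans e2.symm) hne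

theorem areNeighbors_map_of_not_fixed {j i : ℤ} {y y' : Circle} (hi : P.A (P.x j) = P.x i)
    (hn : P.AreNeighbors j y y') (hf : P.A (P.x i) ≠ P.x i) :
    P.AreNeighbors i (P.A y) (P.A y') := by
  have key : ∀ y y', P.AreNeighbors j y y' → P.IsEdge s(P.x i, P.A y) := by
    intro y y' hn
    rcases H.map_isEdge_or (hn.isEdge H.three_le) with h | ⟨-, h⟩
    · rw [← hi]; exact h
    · have := h (P.x j) (by simp)
      rw [hi] at this
      exact absurd this hf
  exact H.areNeighbors_map hn (key y y' hn) (key y' y hn.swap)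

/-- If one of the edges at a vertex reaches a diagonal and the other one does not, then the
forward images of the second one arrive at a fixed vertex. -/
theorem exists_fixed_not_hits (n : ℕ) : ∀ (m : ℤ) (y y' : Circle), P.AreNeighbors m y y' →
    P.IsDiagonal ((Sym2.map P.A)^[n] s(P.x m, y)) → ¬ P.Hits s(P.x m, y') →
    ∃ (p : ℤ) (z z' : Circle), P.A (P.x p) = P.x p ∧ P.AreNeighbors p z z' ∧
      ¬ P.Hits s(P.x p, z) := by
  have hk := H.three_le
  induction n with
  | zero => exact fun m y y' hn hd _ => absurd (hn.isEdge hk) hd.2.2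
  | succ n ih =>
    intro m y y' hn hd hnh
    obtain ⟨i, hi⟩ := H.exists_A_x m
    have hnh' : ¬ P.Hits s(P.x i, P.A y') := by
      rw [← hi]
      exact fun h => hnh (hits_map h)
    have he' : P.IsEdge s(P.x i, P.A y') := by
      rcases H.map_isEdge_or (hn.swap.isEdge hk) with h | ⟨h, -⟩
      · rw [← hi]; exact h
      · exact absurd ⟨1, h⟩ hnh
    rcases H.map_isEdge_or (hn.isEdge hk) with h | ⟨-, h⟩
    · rw [Sym2.map_mk, hi] at h
      rw [Function.iterate_succ_apply, Sym2.map_mk, hi] at hd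
      exact ih i _ _ (H.areNeighbors_map hn h he') hd hnh'
    · have hf := h (P.x m) (by simp)
      rw [hi] at hf
      rcases eq_of_isEdge_x hk he' with e | e
      · exact ⟨i, _, _, hf, Or.inl ⟨e, rfl⟩, hnh'⟩
      · exact ⟨i, _, _, hf, Or.inr ⟨e, rfl⟩, hnh'⟩

/-- If an edge at a fixed vertex does not reach a diagonal, then `A` acts on the vertices as a
reflection. -/
theorem reflection_of_not_hits {p : ℤ} {z z' : Circle} (hp : P.A (P.x p) = P.x p)
    (hn : P.AreNeighbors p z z') (hh : ¬ P.Hits s(P.x p, z)) :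
    ∀ j : ℤ, P.A (P.x (p + j)) = P.x (p - j) := by
  have hk := H.three_le
  have step : ∀ z z', P.AreNeighbors p z z' → ¬ P.Hits s(P.x p, z) → P.A z = z' := by
    intro z z' hn hh
    have he : P.IsEdge s(P.x p, P.A z) := by
      rcases H.map_isEdge_or (hn.isEdge hk) with h | ⟨h, -⟩
      · rw [Sym2.map_mk, hp] at h; exact h
      · exact absurd ⟨1, h⟩ hh
    have hne : P.A z ≠ z := by
      intro e
      rcases hn with ⟨rfl, -⟩ | ⟨rfl, -⟩
      · exact H.not_both_fixed hp e
      · exact H.not_both_fixed (j := p - 1) e (by simpa using hp)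
    rcases eq_of_isEdge_x hk he with e | e <;> rcases hn with ⟨h1, h2⟩ | ⟨h1, h2⟩
    · exact absurd (e.trans h1.symm) hne
    · exact e.trans h2.symm
    · exact e.trans h2.symm
    · exact absurd (e.trans h1.symm) hne
  have s1 := step z z' hn hh
  have s2 : P.A z' = z := by
    refine step z' z hn.swap fun h => hh (hits_map ?_)
    rw [Sym2.map_mk, hp, s1]
    exact h
  have hone : P.A (P.x (p + 1)) = P.x (p - 1) ∧ P.A (P.x (p - 1)) = P.x (p + 1) := by
    rcases hn with ⟨rfl, rfl⟩ | ⟨rfl, rfl⟩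
    · exact ⟨s1, s2⟩
    · exact ⟨s2, s1⟩
  have key : ∀ i : ℕ, 2 * i < P.k →
      (P.A (P.x (p + i)) = P.x (p - i) ∧ P.A (P.x (p - i)) = P.x (p + i)) ∧
      (P.A (P.x (p + (i + 1))) = P.x (p - (i + 1)) ∧
        P.A (P.x (p - (i + 1))) = P.x (p + (i + 1))) := by
    intro i
    induction i with
    | zero => exact fun _ => ⟨by simpa using hp, by simpa using hone⟩
    | succ i ih =>
      intro hi
      obtain ⟨⟨a1, a2⟩, b1, b2⟩ := ih (by omega)
      push_cast
      refine ⟨⟨b1, b2⟩, ?_⟩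
      have hne : P.x (p - (i + 1)) ≠ P.x (p + (i + 1)) := x_ne (by omega) (by omega)
      have n1 := H.areNeighbors_map_of_not_fixed b1 (Or.inl ⟨rfl, rfl⟩) (by rw [b2]; exact hne.symm)
      have n2 := H.areNeighbors_map_of_not_fixed b2 (Or.inl ⟨rfl, rfl⟩) (by rw [b1]; exact hne)
      constructor
      · rcases n1 with ⟨-, h⟩ | ⟨h, -⟩
        · rw [show p + ((i : ℤ) + 1) - 1 = p + i by ring, a1] at h
          have := x_pred_ne_succ hk (p - (i + 1))
          rw [← h, show p - ((i : ℤ) + 1) + 1 = p - i by ring] at this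
          exact absurd rfl this
        · rw [show p + ((i : ℤ) + 1 + 1) = p + (i + 1) + 1 by ring, h]
          congr 1; ring
      · rcases n2 with ⟨h, -⟩ | ⟨-, h⟩
        · rw [show p - ((i : ℤ) + 1) + 1 = p - i by ring, a2] at h
          have := x_pred_ne_succ hk (p + (i + 1))
          rw [← h, show p + ((i : ℤ) + 1) - 1 = p + i by ring] at this
          exact absurd rfl this
        · rw [show p - ((i : ℤ) + 1 + 1) = p - (i + 1) - 1 by ring, h]
          congr 1; ring
  intro j
  obtain ⟨r, m, h0, h1, e⟩ := exists_eq_add_mul (P := P) 0 j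
  rw [zero_add] at e
  have ej : P.x (p + j) = P.x (p + r) ∧ P.x (p - j) = P.x (p - r) := by
    refine ⟨by rw [e, ← add_assoc, x_add_mul], ?_⟩
    rw [e, show p - (r + m * P.k) = p - r + (-m) * P.k by ring, x_add_mul]
  rw [ej.1, ej.2]
  rcases lt_or_ge (2 * r) P.k with hr | hr
  · have := (key r.toNat (by omega)).1.1
    rwa [Int.toNat_of_nonneg h0] at this
  · have := (key (P.k - r - 1).toNat (by omega)).2.2
    rw [Int.toNat_of_nonneg (by omega)] at this
    rw [show p - ((P.k : ℤ) - r - 1 + 1) = p + r + (-1) * P.k by ring, x_add_mul,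
      show p + ((P.k : ℤ) - r - 1 + 1) = p - r + 1 * P.k by ring, x_add_mul] at this
    exact this

/-- Either all edges reach diagonals, or all edges are mapped to edges. -/
theorem hits_or_isEdge :
    (∀ e, P.IsEdge e → P.Hits e) ∨ ∀ e, P.IsEdge e → P.IsEdge (e.map P.A) := by
  have hk := H.three_le
  by_cases hall : ∀ e, P.IsEdge e → P.Hits e
  · exact Or.inl hall
  right
  by_cases hnone : ∀ e, P.IsEdge e → ¬ P.Hits e
  · intro e he
    rcases H.map_isEdge_or he with h | ⟨h, -⟩
    · exact h
    · exact absurd ⟨1, h⟩ (hnone e he)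
  push Not at hall hnone
  obtain ⟨e, he, he'⟩ := hall
  obtain ⟨f, hf, hf'⟩ := hnone
  obtain ⟨a, rfl⟩ := (isEdge_iff hk).mp he
  obtain ⟨b, rfl⟩ := (isEdge_iff hk).mp hf
  -- somewhere between the two edges there is a vertex with edges of both kinds
  have hex : ∃ (m : ℤ) (y y' : Circle), P.AreNeighbors m y y' ∧ P.Hits s(P.x m, y) ∧
      ¬ P.Hits s(P.x m, y') := by
    by_contra hc
    push Not at hc
    have hup : ∀ j, P.Hits s(P.x j, P.x (j + 1)) → P.Hits s(P.x (j + 1), P.x (j + 1 + 1)) := by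
      intro j hj
      refine hc (j + 1) (P.x j) _ (Or.inr ⟨by rw [add_sub_cancel_right], rfl⟩) ?_
      rwa [Sym2.eq_swap]
    obtain ⟨r, m, h0, h1, hr⟩ := exists_eq_add_mul (P := P) b a
    have : ∀ n : ℕ, P.Hits s(P.x (b + n), P.x (b + n + 1)) := by
      intro n
      induction n with
      | zero => simpa using hf'
      | succ n ih =>
        have := hup _ ih
        push_cast
        rwa [← add_assoc]
    have h2 := this r.toNat
    rw [Int.toNat_of_nonneg h0, ← x_add_mul _ m, ← x_add_mul (b + r + 1) m,
      show b + r + 1 + m * P.k = b + r + m * P.k + 1 by ring, ← hr] at h2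
    exact he' h2
  obtain ⟨m, y, y', hn, ⟨n, hd⟩, hnh⟩ := hex
  obtain ⟨p, z, z', hp, hn', hnh'⟩ := H.exists_fixed_not_hits n m y y' hn hd hnh
  have hrefl := H.reflection_of_not_hits hp hn' hnh'
  intro e he
  obtain ⟨j, rfl⟩ := (isEdge_iff hk).mp he
  have h1 := hrefl (j - p)
  have h2 := hrefl (j + 1 - p)
  rw [show p + (j - p) = j by ring] at h1
  rw [show p + (j + 1 - p) = j + 1 by ring] at h2
  rw [Sym2.map_mk, h1, h2, show p - (j + 1 - p) = p - (j - p) - 1 by ring]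
  exact isEdge_pred hk _

/-- A translate of an edge which enters `R` is a diagonal with fixed endpoints. -/
theorem isDiagonal_of_mem_R {b : Sym2 Circle} (hb : b ∈ P.edgeOrbits) {z : ClosedDisk}
    (hz : z ∈ P.R) (hzb : z ∈ geodesic b) : P.IsDiagonal b ∧ ∀ p ∈ b, P.A p = p := by
  rcases H.arc_or_diagonal hb with ⟨i, hi⟩ | h
  · exfalso
    have hnd := not_isDiag_of_mem_edgeOrbits hb
    induction b using Sym2.ind with
    | _ p q =>
    have := geodesic_subset_halfPlane hnd
      ((mem_arc_iff_region H.three_le).mp (hi p (by simp)))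
      ((mem_arc_iff_region H.three_le).mp (hi q (by simp)))
    exact hz.2 (Set.mem_iUnion.mpr ⟨i, this hzb⟩)
  · exact h

/-- If all edges are mapped to edges, then no translate of an edge is a diagonal. -/
theorem not_isDiagonal_of_isEdge_map (hE : ∀ e, P.IsEdge e → P.IsEdge (e.map P.A))
    {b : Sym2 Circle} (hb : b ∈ P.edgeOrbits) : ¬ P.IsDiagonal b := by
  intro hd
  obtain ⟨e, he, hbe⟩ := hb
  obtain ⟨n, hn⟩ := (H.reaches_of_isDiagonal he hd hbe).iterate H.three_le
  have : ∀ n, P.IsEdge ((Sym2.map P.A)^[n] e) := by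
    intro n
    induction n with
    | zero => exact he
    | succ n ih =>
      rw [Function.iterate_succ_apply']
      exact hE _ ih
  exact hd.2.2 (hn ▸ this n)

/-- If all edges are mapped to edges, then the translates of `R` are pairwise disjoint. -/
theorem eq_one_of_mem_R (hE : ∀ e, P.IsEdge e → P.IsEdge (e.map P.A)) {h : diskAut}
    (hh : h ∈ P.group) {z : ClosedDisk} (hz : z ∈ P.R) (hz' : h.1 z ∈ P.R) : h = 1 := by
  have hk := H.three_le
  rw [R_eq hk 0] at hz hz'
  refine (P.polygon hk 0).eq_one_of_mem_inner H.torsionFree (fun g hg i _ w hw hwg => ?_) hh hz hz'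
  rw [← R_eq hk 0] at hw
  rw [polygon_v, polygon_v_succ] at hwg
  have hb := map_mem_edgeOrbits (mem_edgeOrbits_of_isEdge (isEdge_x hk (0 + (i : ℤ)))) hg
  exact H.not_isDiagonal_of_isEdge_map hE hb (H.isDiagonal_of_mem_R hb hw hwg).1

/-- If all edges are mapped to edges, then `A` acts on the vertices as the reflection in a vertex,
and the number of vertices is even. -/
theorem exists_reflection (hE : ∀ e, P.IsEdge e → P.IsEdge (e.map P.A)) :
    ∃ (p : ℤ) (n : ℕ), P.k = 2 * n ∧ ∀ j : ℤ, P.A (P.x (p + j)) = P.x (p - j) := by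
  have hk := H.three_le
  have nb : ∀ j i, P.A (P.x j) = P.x i →
      P.AreNeighbors i (P.A (P.x (j + 1))) (P.A (P.x (j - 1))) := by
    intro j i hi
    refine H.areNeighbors_map (Or.inl ⟨rfl, rfl⟩) ?_ ?_
    · rw [← hi]; exact hE _ (isEdge_x hk j)
    · rw [← hi]; exact hE _ (isEdge_pred hk j)
  obtain ⟨c, hc⟩ := H.exists_A_x 0
  rcases nb 0 c hc with ⟨h1, -⟩ | ⟨h1, -⟩
  · -- a rotation of the vertices preserves `R`
    exfalso
    rw [A_x] at hc
    rw [A_x_succ] at h1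
    obtain ⟨z, hz, hz'⟩ := (P.polygon hk 0).exists_mem_inner (P.polygon hk c) (i := 0) (j := 0)
      (h := P.g 0) P.k_pos P.k_pos (by rw [polygon_v, polygon_v]; simpa using hc)
      (by rw [polygon_v_succ, polygon_v_succ]; simpa using h1)
    rw [← R_eq hk] at hz hz'
    exact H.g_ne_one 0 (H.eq_one_of_mem_R hE (g_mem 0) hz hz')
  · have key : ∀ j : ℤ, P.A (P.x j) = P.x (c - j) ∧ P.A (P.x (j + 1)) = P.x (c - j - 1) := by
      intro j
      induction j using Int.induction_on with
      | zero => exact ⟨by simpa using hc, by simpa using h1⟩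
      | succ j ih =>
        obtain ⟨i1, i2⟩ := ih
        refine ⟨by rw [i2]; congr 1; ring, ?_⟩
        rcases nb _ _ i2 with ⟨-, h⟩ | ⟨h, -⟩
        · rw [add_sub_cancel_right, i1] at h
          have := x_pred_ne_succ hk (c - j - 1)
          rw [← h, sub_add_cancel] at this
          exact absurd rfl this
        · rw [h]; congr 1; ring
      | pred j ih =>
        obtain ⟨i1, i2⟩ := ih
        rw [sub_add_cancel]
        refine ⟨?_, by rw [i1]; congr 1; ring⟩
        rcases nb _ _ i1 with ⟨h, -⟩ | ⟨-, h⟩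
        · rw [i2] at h
          exact absurd h (x_pred_ne_succ hk _)
        · rw [h]; congr 1; ring
    have hne : ∀ j m : ℤ, c = 2 * j + 1 + m * P.k → False := by
      intro j m hm
      refine H.map_edge_ne j ?_
      rw [(key j).1, (key j).2, Sym2.eq_swap,
        show c - j - 1 = j + m * P.k by linarith, x_add_mul,
        show c - j = j + 1 + m * P.k by linarith, x_add_mul]
    obtain ⟨p, hp⟩ | ⟨p, hp⟩ := Int.even_or_odd c
    · obtain ⟨n, hn⟩ | ⟨n, hn⟩ := Nat.even_or_odd P.k
      · refine ⟨p, n, by omega, fun j => ?_⟩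
        rw [(key _).1]
        congr 1
        linarith
      · exact (hne (p + n) (-1) (by rw [hn]; push_cast; linarith)).elim
    · exact (hne p 0 (by linarith)).elim

end StandingAssumptions

end PiecewiseMobius

end Mating

namespace Mating

/-! ### Triangles and nested half-planes -/

/-- The ideal triangle with vertices at three given angles. -/
def IdealPolygon.triangle (α β γ : ℝ) (h1 : α < β) (h2 : β < γ) (h3 : γ < α + 2 * Real.pi) :
    IdealPolygon where
  N := 3
  three_le := le_rfl
  φ i := if i = 0 then α else if i = 1 then β else if i = 2 then γ else α + 2 * Real.pi
  lt_of_lt i j hij hj := by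
    interval_cases j <;> interval_cases i <;> simp <;> linarith
  close := by simp

theorem exists_triangle {p q r : Circle} (h : ccw p q r) :
    ∃ X : IdealPolygon, X.N = 3 ∧ X.v 0 = p ∧ X.v 1 = q ∧ X.v 2 = r ∧ X.v 3 = p := by
  obtain ⟨α, rfl⟩ := Circle.exp_surjective p
  obtain ⟨β, b1, b2, rfl⟩ := exists_angle_of_ne (ccw_ne_left h).symm
  obtain ⟨γ, c1, c2, rfl⟩ := exists_angle_of_ne (ccw_ne_outer h).symm
  refine ⟨IdealPolygon.triangle α β γ b1 ((ccw_exp_iff b1 b2 c1 c2).mp h) c2, rfl, ?_, ?_, ?_, ?_⟩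
  · simp [IdealPolygon.v, IdealPolygon.triangle]
  · simp [IdealPolygon.v, IdealPolygon.triangle]
  · simp [IdealPolygon.v, IdealPolygon.triangle]
  · simp only [IdealPolygon.v, IdealPolygon.triangle]
    norm_num

/-- Half-planes over disjoint arcs with one common end are disjoint. -/
theorem side_neg_of_adjacent {p q r : Circle} (h : ccw p q r) {z : ClosedDisk}
    (hz : z ∈ openDisk) (h1 : 0 ≤ side p q z) : side q r z < 0 := by
  obtain ⟨X, hN, e0, e1, e2, e3⟩ := exists_triangle h
  rw [← e1, ← e2]
  rw [← e0, ← e1] at h1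
  exact X.side_neg_of_nonneg (i := 0) (j := 1) (by omega) (by omega) (by omega) hz h1

theorem side_pos_of_left {p q r : Circle} (h : ccw p q r) {z : ClosedDisk}
    (hz : z ∈ openDisk) (h1 : 0 ≤ side p q z) : 0 < side p r z := by
  obtain ⟨X, hN, e0, e1, e2, e3⟩ := exists_triangle h
  rw [side_swap, neg_pos, ← e2, ← e3]
  rw [← e0, ← e1] at h1
  exact X.side_neg_of_nonneg (i := 0) (j := 2) (by omega) (by omega) (by omega) hz h1

theorem side_pos_of_right {p q r : Circle} (h : ccw p q r) {z : ClosedDisk}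
    (hz : z ∈ openDisk) (h1 : 0 ≤ side q r z) : 0 < side p r z := by
  obtain ⟨X, hN, e0, e1, e2, e3⟩ := exists_triangle h
  rw [side_swap, neg_pos, ← e2, ← e3]
  rw [← e1, ← e2] at h1
  exact X.side_neg_of_nonneg (i := 1) (j := 2) (by omega) (by omega) (by omega) hz h1

/-- The cyclic order with either orientation. -/
def cyc (o : Bool) (p q r : Circle) : Prop := if o then ccw p q r else ccw p r q

theorem cyc_trans {o : Bool} {v p q r : Circle} (h1 : cyc o v p q) (h2 : cyc o v q r) :
    cyc o v p r := by
  cases o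
  · exact ccw_trans (show ccw v r q from h2) (show ccw v q p from h1)
  · exact ccw_trans (show ccw v p q from h1) h2

theorem cyc_asymm {o : Bool} {p q r : Circle} (h : cyc o p q r) : ¬ cyc o p r q := by
  cases o
  · exact ccw_asymm (show ccw p r q from h)
  · exact ccw_asymm (show ccw p q r from h)

theorem cyc_irrefl {o : Bool} {p q : Circle} : ¬ cyc o p q q := fun h => cyc_asymm h h

theorem cyc_onCircle {o : Bool} (h : diskAut) {p q r : Circle} :
    cyc o (onCircle h p) (onCircle h q) (onCircle h r) ↔ cyc o p q r := by
  cases o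
  · exact ccw_onCircle h
  · exact ccw_onCircle h

namespace PiecewiseMobius

variable {P : PiecewiseMobius}

/-! ### Polygons inscribed in `R` -/

/-- The ideal polygon spanned by some of the break-points. -/
def subPolygon (N : ℕ) (hN : 3 ≤ N) (idx : ℕ → ℤ) (mono : ∀ i j, i < j → j ≤ N → idx i < idx j)
    (hc : idx N = idx 0 + P.k) : IdealPolygon where
  N := N
  three_le := hN
  φ i := P.θ (idx i)
  lt_of_lt i j h hj := P.θ_strictMono (mono i j h hj)
  close := by rw [hc, P.θ_periodic]

theorem side_nonneg_of_nested {a b c d : ℤ} (h1 : a ≤ c) (h2 : c < d) (h3 : d ≤ b)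
    (h4 : b < a + P.k) {z : ClosedDisk} (hz : z ∈ openDisk)
    (h : 0 ≤ side (P.x c) (P.x d) z) : 0 ≤ side (P.x a) (P.x b) z := by
  have h5 : 0 ≤ side (P.x a) (P.x d) z := by
    rcases h1.eq_or_lt with rfl | h1
    · exact h
    · exact (side_pos_of_right (ccw_x h1 h2 (by omega)) hz h).le
  rcases h3.eq_or_lt with rfl | h3
  · exact h5
  · exact (side_pos_of_left (ccw_x (by omega) h3 h4) hz h5).le

section
variable {N : ℕ} {hN : 3 ≤ N} {idx : ℕ → ℤ} {mono : ∀ i j, i < j → j ≤ N → idx i < idx j}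
  {hc : idx N = idx 0 + P.k}

theorem subPolygon_v (i : ℕ) : (subPolygon N hN idx mono hc).v i = P.x (idx i) := rfl

include mono hc in
theorem idx_succ_lt (hN : 3 ≤ N) {i : ℕ} (hi : i < N) : idx (i + 1) < idx i + P.k := by
  rcases Nat.eq_zero_or_pos i with rfl | h0
  · rw [← hc]
    exact mono _ _ (by omega) le_rfl
  · have h1 := mono 0 i h0 hi.le
    rcases (Nat.succ_le_of_lt hi).eq_or_lt with h | h
    · rw [show i + 1 = N from h, hc]
      omega
    · have := mono (i + 1) N h le_rfl
      omega

theorem subPolygon_inner_subset (hk : 3 ≤ P.k) : (subPolygon N hN idx mono hc).inner ⊆ P.R := by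
  intro z hz
  rw [R_eq hk (idx 0)]
  refine ⟨hz.1, fun i hi => ?_⟩
  rw [polygon_v, polygon_v_succ]
  have hi' : (i : ℤ) < P.k := by exact_mod_cast hi
  -- the side of the small polygon which cuts off the given edge
  have hex : ∃ l, l < N ∧ idx l ≤ idx 0 + i ∧ idx 0 + i + 1 ≤ idx (l + 1) := by
    classical
    have hex : ∃ n, idx 0 + i < idx n := ⟨N, by omega⟩
    have h1 := Nat.find_spec hex
    have h2 : Nat.find hex ≤ N := Nat.find_min' hex (by omega)
    have h0 : Nat.find hex ≠ 0 := by
      intro e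
      rw [e] at h1
      omega
    obtain ⟨n, hn⟩ := Nat.exists_eq_succ_of_ne_zero h0
    have h3 : ¬ idx 0 + i < idx n := Nat.find_min hex (by omega)
    rw [hn, Nat.succ_eq_add_one] at h1
    exact ⟨n, by omega, by omega, by omega⟩
  obtain ⟨l, hl, l1, l2⟩ := hex
  by_contra hcon
  push Not at hcon
  have h1 := side_nonneg_of_nested l1 (by omega) l2 (idx_succ_lt (mono := mono) (hc := hc) hN hl)
    hz.1 hcon
  have h2 := hz.2 l hl
  rw [subPolygon_v, subPolygon_v] at h2
  linarith

end

/-! ### Extremal diagonals at a fixed vertex -/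

/-- The neighbour of `x j` on the given side. -/
def nbr (P : PiecewiseMobius) (o : Bool) (j : ℤ) : Circle := if o then P.x (j + 1) else P.x (j - 1)

/-- The piece of the map on the arc at `x j` on the given side. -/
def piece (P : PiecewiseMobius) (o : Bool) (j : ℤ) : diskAut := if o then P.g j else P.g (j - 1)

theorem A_x_piece (o : Bool) (j : ℤ) : P.A (P.x j) = onCircle (P.piece o j) (P.x j) := by
  cases o
  · have := A_x_succ (P := P) (j - 1)
    rwa [sub_add_cancel] at this
  · exact A_x j

theorem A_nbr (o : Bool) (j : ℤ) : P.A (P.nbr o j) = onCircle (P.piece o j) (P.nbr o j) := by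
  cases o
  · exact A_x (j - 1)
  · exact A_x_succ j

theorem piece_mem (o : Bool) (j : ℤ) : P.piece o j ∈ P.group := by
  cases o <;> exact g_mem _

theorem cyc_nbr (hk : 3 ≤ P.k) (o : Bool) (j : ℤ) :
    cyc o (P.x j) (P.nbr o j) (P.nbr (!o) j) := by
  have h : ccw (P.x j) (P.x (j + 1)) (P.x (j - 1)) := by
    have := ccw_x (P := P) (i := j) (j := j + 1) (l := j - 1 + 1 * P.k) (by omega) (by omega)
      (by omega)
    rwa [x_add_mul] at this
  cases o <;> exact h

theorem isEdge_nbr (hk : 3 ≤ P.k) (o : Bool) (j : ℤ) : P.IsEdge s(P.x j, P.nbr o j) := by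
  cases o
  · exact isEdge_pred hk j
  · exact isEdge_x hk j

theorem cyc_of_isDiagonal (hk : 3 ≤ P.k) (o : Bool) {j : ℤ} {y : Circle}
    (h : P.IsDiagonal s(P.x j, y)) :
    cyc o (P.x j) (P.nbr o j) y ∧ cyc o (P.x j) y (P.nbr (!o) j) := by
  have key : ccw (P.x j) (P.x (j + 1)) y ∧ ccw (P.x j) y (P.x (j - 1)) := by
    obtain ⟨r, h0, h1, rfl⟩ := exists_x_eq j (h.2.1 y (by simp))
    have r0 : r ≠ 0 := by
      rintro rfl
      exact h.1 (by simp)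
    have r1 : r ≠ 1 := by
      rintro rfl
      exact h.2.2 (isEdge_x hk j)
    have r2 : r ≠ P.k - 1 := by
      rintro rfl
      refine h.2.2 ?_
      rw [show j + ((P.k : ℤ) - 1) = j - 1 + 1 * P.k by ring, x_add_mul]
      exact isEdge_pred hk j
    refine ⟨ccw_x (by omega) (by omega) (by omega), ?_⟩
    have := ccw_x (P := P) (i := j) (j := j + r) (l := j - 1 + 1 * P.k) (by omega) (by omega)
      (by omega)
    rwa [x_add_mul] at this
  cases o
  · exact ⟨key.2, key.1⟩
  · exact key

namespace StandingAssumptions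

variable (H : P.StandingAssumptions)
include H

theorem piece_ne_one (o : Bool) (j : ℤ) : P.piece o j ≠ 1 := by
  cases o <;> exact H.g_ne_one _

theorem piece_ne (o : Bool) (j : ℤ) : P.piece o j ≠ P.piece (!o) j := by
  cases o
  · exact H.g_ne j
  · exact (H.g_ne j).symm

/-- The position of the other end of a translate of an edge ending at a vertex. -/
theorem position (o : Bool) {j : ℤ} {y : Circle} (h : s(P.x j, y) ∈ P.edgeOrbits) :
    (y = P.nbr o j ∨ cyc o (P.x j) y (P.nbr o j)) ∨
      (y = P.nbr (!o) j ∨ cyc o (P.x j) (P.nbr (!o) j) y) ∨ P.IsDiagonal s(P.x j, y) := by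
  have hk := H.three_le
  have hne : y ≠ P.x j := fun e => not_isDiag_of_mem_edgeOrbits h e.symm
  have key : (y = P.x (j + 1) ∨ ccw (P.x j) y (P.x (j + 1))) ∨
      (y = P.x (j - 1) ∨ ccw (P.x j) (P.x (j - 1)) y) ∨ P.IsDiagonal s(P.x j, y) := by
    rcases H.arc_or_diagonal h with ⟨i, hi⟩ | ⟨h, -⟩
    · rcases mem_arc_of_mem_arc hk (hi _ (Sym2.mem_mk_left _ y)) (hi _ (Sym2.mem_mk_right _ y))
        with h | h
      · left
        rcases (mem_arc_iff hk).mp h with e | e | e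
        · exact absurd e hne
        · exact Or.inl e
        · exact Or.inr e
      · right; left
        rcases (mem_arc_iff hk).mp h with e | e | e
        · exact Or.inl e
        · rw [sub_add_cancel] at e
          exact absurd e hne
        · rw [sub_add_cancel] at e
          exact Or.inr (ccw_rotate (ccw_rotate e))
    · exact Or.inr (Or.inr h)
  cases o
  · rcases key with h | h | h
    · exact Or.inr (Or.inl h)
    · exact Or.inl h
    · exact Or.inr (Or.inr h)
  · exact key

theorem fixed_of_isDiagonal {p q : Circle} (h : s(p, q) ∈ P.edgeOrbits)
    (hd : P.IsDiagonal s(p, q)) : P.A p = p ∧ P.A q = q := by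
  rcases H.edge_or_diagonal h (hd.2.1 p (by simp)) (hd.2.1 q (by simp)) with h' | h'
  · exact absurd h' hd.2.2
  · exact h'.2

/-- If the two edges at a vertex which is not fixed are mapped to diagonals, then these are
extremal among the diagonals at their common vertex. Otherwise, minimality excludes that the two
pieces of the map at the vertex agree. -/
theorem not_cyc_of_not_fixed (o : Bool) {j i : ℤ} (hi : P.A (P.x j) = P.x i)
    (hf : P.A (P.x j) ≠ P.x j) (hα : P.IsDiagonal s(P.x i, P.A (P.nbr o j)))
    (hβ : P.IsDiagonal s(P.x i, P.A (P.nbr (!o) j))) {y : Circle}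
    (hy : s(P.x i, y) ∈ P.edgeOrbits) (hyd : P.IsDiagonal s(P.x i, y)) :
    ¬ cyc o (P.x i) (P.A (P.nbr o j)) y := by
  have hk := H.three_le
  intro hc
  obtain ⟨g, hgdef⟩ : ∃ g, g = P.piece o j := ⟨_, rfl⟩
  have hg : g ∈ P.group := hgdef ▸ piece_mem o j
  have gx : onCircle g (P.x j) = P.x i := by rw [← hi, A_x_piece o j, hgdef]
  have gn : onCircle g (P.nbr o j) = P.A (P.nbr o j) := by rw [A_nbr, hgdef]
  have hγ : cyc o (P.x i) (P.A (P.nbr o j)) (onCircle g (P.nbr (!o) j)) := by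
    rw [← gx, ← gn]
    exact (cyc_onCircle g).mpr (cyc_nbr hk o j)
  have eb : s(P.x j, P.nbr (!o) j) ∈ P.edgeOrbits := mem_edgeOrbits_of_isEdge (isEdge_nbr hk _ j)
  have hγE : s(P.x i, onCircle g (P.nbr (!o) j)) ∈ P.edgeOrbits := by
    rw [← gx]
    exact map_mem_edgeOrbits eb hg
  have hyγ : cyc o (P.x i) y (onCircle g (P.nbr (!o) j)) := by
    have hyb := (cyc_of_isDiagonal hk o hyd).2
    rcases H.position o hγE with h | h | h
    · exfalso
      have h2 := cyc_trans (cyc_of_isDiagonal hk o hα).1 hγ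
      rcases h with h | h
      · rw [h] at h2
        exact cyc_irrefl h2
      · exact cyc_asymm h h2
    · rcases h with h | h
      · rw [h]; exact hyb
      · exact cyc_trans hyb h
    · exfalso
      -- two equivalent diagonals are equal, so both pieces at `x j` have the same effect
      obtain ⟨g', hg'def⟩ : ∃ g', g' = P.piece (!o) j := ⟨_, rfl⟩
      have hg' : g' ∈ P.group := hg'def ▸ piece_mem _ j
      have e1 : s(P.x i, P.A (P.nbr (!o) j)) = s(P.x j, P.nbr (!o) j).map (onCircle g') := by
        rw [Sym2.map_mk, ← hi, A_x_piece (!o) j, A_nbr, hg'def]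
      have hβE : s(P.x i, P.A (P.nbr (!o) j)) ∈ P.edgeOrbits := by
        rw [e1]; exact map_mem_edgeOrbits eb hg'
      have e2 : s(P.x i, onCircle g (P.nbr (!o) j))
          = s(P.x i, P.A (P.nbr (!o) j)).map (onCircle (g * g'⁻¹)) := by
        rw [map_onCircle_mul, e1, map_onCircle_inv, Sym2.map_mk, gx]
      have hgg := P.group.mul_mem hg (P.group.inv_mem hg')
      have e3 := H.eq_of_isDiagonal hβ h hβE hgg e2
      have e4 := H.eq_one_of_map_eq hβE hgg (e2.symm.trans e3)
      exact H.piece_ne o j (by rw [← hgdef, ← hg'def]; exact mul_inv_eq_one.mp e4)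
  obtain ⟨y', rfl⟩ : ∃ y', onCircle g y' = y := ⟨onCircle g⁻¹ y, onCircle_apply_inv g y⟩
  rw [← gx, ← gn, cyc_onCircle] at hc
  rw [← gx, cyc_onCircle] at hyγ
  rw [← gx] at hy
  have hy' : s(P.x j, y') ∈ P.edgeOrbits := (map_mem_edgeOrbits_iff hg).mp hy
  rcases H.position o hy' with h | h | h
  · rcases h with h | h
    · rw [h] at hc
      exact cyc_irrefl hc
    · exact cyc_asymm h hc
  · rcases h with h | h
    · rw [h] at hyγ
      exact cyc_irrefl hyγ
    · exact cyc_asymm h hyγ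
  · exact hf (H.fixed_of_isDiagonal hy' h).1

/-- If an edge at a fixed vertex is mapped to a diagonal, then it is an extremal one. -/
theorem not_cyc_of_fixed (o : Bool) {j : ℤ} (hf : P.A (P.x j) = P.x j)
    (hα : P.IsDiagonal s(P.x j, P.A (P.nbr o j))) {y : Circle}
    (hy : s(P.x j, y) ∈ P.edgeOrbits) (hyd : P.IsDiagonal s(P.x j, y)) :
    ¬ cyc o (P.x j) (P.A (P.nbr o j)) y := by
  have hk := H.three_le
  intro hc
  obtain ⟨g, hgdef⟩ : ∃ g, g = P.piece o j := ⟨_, rfl⟩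
  have hg : g ∈ P.group := hgdef ▸ piece_mem o j
  have hg1 : g ≠ 1 := hgdef ▸ H.piece_ne_one o j
  have gx : onCircle g (P.x j) = P.x j := by rw [hgdef, ← A_x_piece o j, hf]
  have gn : onCircle g (P.nbr o j) = P.A (P.nbr o j) := by rw [A_nbr, hgdef]
  obtain ⟨α, hαdef⟩ : ∃ α, α = P.A (P.nbr o j) := ⟨_, rfl⟩
  rw [← hαdef] at hα hc gn
  have hαE : s(P.x j, α) ∈ P.edgeOrbits := by
    have := map_mem_edgeOrbits (mem_edgeOrbits_of_isEdge (isEdge_nbr hk o j)) hg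
    rwa [Sym2.map_mk, gx, gn] at this
  have hnα := (cyc_of_isDiagonal hk o hα).1
  have hαα : cyc o (P.x j) α (onCircle g α) := by
    have := (cyc_onCircle (o := o) g).mpr hnα
    rwa [gx, gn] at this
  have hE : s(P.x j, onCircle g α) ∈ P.edgeOrbits := by
    have := map_mem_edgeOrbits hαE hg
    rwa [Sym2.map_mk, gx] at this
  have hyα : cyc o (P.x j) y (onCircle g α) := by
    have hyb := (cyc_of_isDiagonal hk o hyd).2
    rcases H.position o hE with h | h | h
    · exfalso
      have h2 := cyc_trans hnα hαα
      rcases h with h | h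
      · rw [h] at h2
        exact cyc_irrefl h2
      · exact cyc_asymm h h2
    · rcases h with h | h
      · rw [h]; exact hyb
      · exact cyc_trans hyb h
    · exfalso
      have e : s(P.x j, onCircle g α) = s(P.x j, α).map (onCircle g) := by rw [Sym2.map_mk, gx]
      have e2 := H.eq_of_isDiagonal hα h hαE hg e
      exact hg1 (H.eq_one_of_map_eq hαE hg (e.symm.trans e2))
  obtain ⟨y', rfl⟩ : ∃ y', onCircle g y' = y := ⟨onCircle g⁻¹ y, onCircle_apply_inv g y⟩
  have c1 : cyc o (P.x j) (P.nbr o j) y' := by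
    rw [← cyc_onCircle g, gx, gn]; exact hc
  have c2 : cyc o (P.x j) y' α := by
    rw [← cyc_onCircle g, gx]; exact hyα
  have hy' : s(P.x j, y') ∈ P.edgeOrbits := by
    rw [← map_mem_edgeOrbits_iff hg, Sym2.map_mk, gx]; exact hy
  rcases H.position o hy' with h | h | h
  · rcases h with h | h
    · rw [h] at c1
      exact cyc_irrefl c1
    · exact cyc_asymm h c1
  · have c3 := cyc_trans c2 (cyc_of_isDiagonal hk o hα).2
    rcases h with h | h
    · rw [h] at c3
      exact cyc_irrefl c3
    · exact cyc_asymm h c3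
  · have e : s(P.x j, onCircle g y') = s(P.x j, y').map (onCircle g) := by rw [Sym2.map_mk, gx]
    have e2 := H.eq_of_isDiagonal h hyd hy' hg e
    exact hg1 (H.eq_one_of_map_eq hy' hg (e.symm.trans e2))

end StandingAssumptions

end PiecewiseMobius

end Mating

namespace Mating

namespace PiecewiseMobius

variable {P : PiecewiseMobius}

/-! ### Chains of edges between consecutive fixed vertices -/

/-- The vertex `x j` is fixed by `A`. -/
def FixedAt (P : PiecewiseMobius) (j : ℤ) : Prop := P.A (P.x j) = P.x j

theorem fixedAt_congr {i j : ℤ} (h : P.x i = P.x j) (hi : P.FixedAt i) : P.FixedAt j := by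
  unfold FixedAt at *
  rwa [← h]

theorem exists_prev {w : ℤ} (hw : P.FixedAt w) (a : ℤ) :
    ∃ i < a, P.FixedAt i ∧ ∀ t, i < t → t < a → ¬ P.FixedAt t := by
  classical
  have hex : ∃ n : ℕ, P.FixedAt (a - 1 - n) := by
    obtain ⟨r, m, h0, h1, rfl⟩ := exists_eq_add_mul (P := P) (a - P.k) w
    refine ⟨(P.k - 1 - r).toNat, ?_⟩
    rw [Int.toNat_of_nonneg (by omega)]
    refine fixedAt_congr ?_ hw
    rw [x_add_mul]
    congr 1
    ring
  refine ⟨a - 1 - Nat.find hex, by omega, Nat.find_spec hex, fun t h1 h2 h3 => ?_⟩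
  refine Nat.find_min hex (m := (a - 1 - t).toNat) (by omega) ?_
  rwa [Int.toNat_of_nonneg (by omega), show a - 1 - (a - 1 - t) = t by ring]

theorem exists_next {w : ℤ} (hw : P.FixedAt w) (a : ℤ) :
    ∃ i > a, P.FixedAt i ∧ ∀ t, a < t → t < i → ¬ P.FixedAt t := by
  classical
  have hex : ∃ n : ℕ, P.FixedAt (a + 1 + n) := by
    obtain ⟨r, m, h0, h1, rfl⟩ := exists_eq_add_mul (P := P) (a + 1) w
    refine ⟨r.toNat, ?_⟩
    rw [Int.toNat_of_nonneg (by omega)]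
    exact fixedAt_congr (x_add_mul _ _) hw
  refine ⟨a + 1 + Nat.find hex, by omega, Nat.find_spec hex, fun t h1 h2 h3 => ?_⟩
  refine Nat.find_min hex (m := (t - a - 1).toNat) (by omega) ?_
  rwa [Int.toNat_of_nonneg (by omega), show a + 1 + (t - a - 1) = t by ring]

/-- The edges with numbers from `p` to `r - 1` form a chain between two consecutive fixed
vertices. -/
structure IsChain (P : PiecewiseMobius) (p r : ℤ) : Prop where
  lt : p < r
  left : P.FixedAt p
  right : P.FixedAt r
  inner : ∀ t, p < t → t < r → ¬ P.FixedAt t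

theorem exists_isChain {w : ℤ} (hw : P.FixedAt w) (a : ℤ) :
    ∃ p r, P.IsChain p r ∧ p ≤ a ∧ a < r := by
  obtain ⟨p, hp, hp', hp2⟩ := exists_prev hw (a + 1)
  obtain ⟨r, hr, hr', hr2⟩ := exists_next hw a
  refine ⟨p, r, ⟨by omega, hp', hr', fun t h1 h2 => ?_⟩, by omega, hr⟩
  rcases lt_or_ge t (a + 1) with h | h
  · exact hp2 t h1 h
  · exact hr2 t (by omega) h2

/-- One of the first `m` iterates of the edge is a diagonal. -/
def HitsWithin (P : PiecewiseMobius) (m : ℕ) (e : Sym2 Circle) : Prop :=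
  ∃ n ≤ m, P.IsDiagonal ((Sym2.map P.A)^[n] e)

namespace StandingAssumptions

variable (H : P.StandingAssumptions)
include H

/-- If an edge of a chain is mapped to an edge at a vertex which is not fixed, then one of the
adjacent edges of the chain is mapped to the next edge at this vertex. -/
theorem exists_adjacent {p r j v : ℤ} (hC : P.IsChain p r) (h1 : p ≤ j) (h2 : j < r)
    {w w' : Circle} (hv : ¬ P.FixedAt v) (hn : P.AreNeighbors v w w')
    (he : s(P.A (P.x j), P.A (P.x (j + 1))) = s(P.x v, w)) :
    ∃ j', p ≤ j' ∧ j' < r ∧ s(P.A (P.x j'), P.A (P.x (j' + 1))) = s(P.x v, w') := by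
  have hnf : ∀ u, P.FixedAt u → P.A (P.x u) ≠ P.x v := by
    intro u hu e
    exact hv (fixedAt_congr (hu.symm.trans e) hu)
  have hne : w ≠ w' := by
    have := x_pred_ne_succ H.three_le v
    rcases hn with ⟨rfl, rfl⟩ | ⟨rfl, rfl⟩
    · exact this.symm
    · exact this
  have key : ∀ y y', P.AreNeighbors v y y' → y = w → y' = w' := by
    rintro y y' (⟨rfl, rfl⟩ | ⟨rfl, rfl⟩) e
    · rcases hn with ⟨rfl, rfl⟩ | ⟨rfl, rfl⟩
      · rfl
      · exact absurd e (x_pred_ne_succ H.three_le v).symm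
    · rcases hn with ⟨rfl, rfl⟩ | ⟨rfl, rfl⟩
      · exact absurd e (x_pred_ne_succ H.three_le v)
      · rfl
  rcases Sym2.eq_iff.mp he with ⟨e1, e2⟩ | ⟨e1, e2⟩
  · have hj : j ≠ p := by
      rintro rfl
      exact hnf _ hC.left e1
    refine ⟨j - 1, by omega, by omega, ?_⟩
    have := H.areNeighbors_map_of_not_fixed e1 (Or.inl ⟨rfl, rfl⟩) hv
    rw [sub_add_cancel, e1, key _ _ this e2, Sym2.eq_swap]
  · have hj : j + 1 ≠ r := by
      rintro rfl
      exact hnf _ hC.right e2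
    refine ⟨j + 1, by omega, by omega, ?_⟩
    have := H.areNeighbors_map_of_not_fixed e2 (Or.inr ⟨rfl, rfl⟩) hv
    rw [add_sub_cancel_right] at this
    rw [e2, key _ _ this e1]

/-- If all edges reach diagonals, there is a chain all edges of which are mapped to diagonals.
Otherwise, the edges of a chain with the smallest maximal number of steps cover another chain. -/
theorem exists_direct_chain (hall : ∀ e, P.IsEdge e → P.Hits e) {w : ℤ} (hw : P.FixedAt w) :
    ∃ p r, P.IsChain p r ∧
      ∀ j, p ≤ j → j < r → P.IsDiagonal s(P.A (P.x j), P.A (P.x (j + 1))) := by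
  classical
  have hk := H.three_le
  have hex : ∃ m, ∃ p r, P.IsChain p r ∧
      ∀ j, p ≤ j → j < r → P.HitsWithin m s(P.x j, P.x (j + 1)) := by
    choose N hN using fun j => hall _ (isEdge_x hk j)
    obtain ⟨p, r, hC, -, -⟩ := exists_isChain hw 0
    refine ⟨(Finset.Ico p r).sup N, p, r, hC, fun j h1 h2 => ⟨N j, ?_, hN j⟩⟩
    exact Finset.le_sup (f := N) (Finset.mem_Ico.mpr ⟨h1, h2⟩)
  obtain ⟨p, r, hC, hm⟩ := Nat.find_spec hex
  set m := Nat.find hex with hmdef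
  refine ⟨p, r, hC, fun j h1 h2 => ?_⟩
  by_contra hnd
  have hjE : P.IsEdge s(P.A (P.x j), P.A (P.x (j + 1))) := by
    rcases H.edge_or_diagonal_map j with h | h
    · exact h
    · exact absurd h.1 hnd
  obtain ⟨a, ha⟩ := (isEdge_iff hk).mp hjE
  obtain ⟨p', r', hC', a1, a2⟩ := exists_isChain hw a
  -- all edges of the chain containing the image of the edge `j` are images of edges of the first
  -- chain: continue in both directions until a fixed vertex is met
  have up : ∀ n : ℕ, a + n < r' → ∃ j, p ≤ j ∧ j < r ∧
      s(P.A (P.x j), P.A (P.x (j + 1))) = s(P.x (a + n), P.x (a + n + 1)) := by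
    intro n
    induction n with
    | zero => exact fun _ => ⟨j, h1, h2, by simpa using ha⟩
    | succ n ih =>
      intro hn
      push_cast at hn ⊢
      obtain ⟨j, j1, j2, e⟩ := ih (by omega)
      rw [← add_assoc]
      refine H.exists_adjacent hC j1 j2 (hC'.inner _ (by omega) (by omega)) (Or.inr ⟨?_, rfl⟩)
        (e.trans Sym2.eq_swap)
      rw [add_sub_cancel_right]
  have down : ∀ n : ℕ, p' ≤ a - n → ∃ j, p ≤ j ∧ j < r ∧
      s(P.A (P.x j), P.A (P.x (j + 1))) = s(P.x (a - n), P.x (a - n + 1)) := by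
    intro n
    induction n with
    | zero => exact fun _ => ⟨j, h1, h2, by simpa using ha⟩
    | succ n ih =>
      intro hn
      push_cast at hn ⊢
      obtain ⟨j, j1, j2, e⟩ := ih (by omega)
      obtain ⟨j', j1', j2', e'⟩ := H.exists_adjacent hC j1 j2
        (hC'.inner (a - n) (by omega) (by omega)) (Or.inl ⟨rfl, rfl⟩) e
      refine ⟨j', j1', j2', e'.trans ?_⟩
      rw [Sym2.eq_swap, show a - n - 1 = a - ((n : ℤ) + 1) by ring,
        show a - ((n : ℤ) + 1) + 1 = a - n by ring]
  have cover : ∀ i, p' ≤ i → i < r' → ∃ j, p ≤ j ∧ j < r ∧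
      s(P.A (P.x j), P.A (P.x (j + 1))) = s(P.x i, P.x (i + 1)) := by
    intro i i1 i2
    rcases le_total a i with h | h
    · have := up (i - a).toNat (by omega)
      rwa [Int.toNat_of_nonneg (by omega), show a + (i - a) = i by ring] at this
    · have := down (a - i).toNat (by omega)
      rwa [Int.toNat_of_nonneg (by omega), show a - (a - i) = i by ring] at this
  have hpos : ∀ j, P.HitsWithin m s(P.x j, P.x (j + 1)) →
      0 < m ∧ P.HitsWithin (m - 1) s(P.A (P.x j), P.A (P.x (j + 1))) := by
    rintro j ⟨n, hn, hd⟩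
    rcases Nat.eq_zero_or_pos n with rfl | h0
    · exact absurd (isEdge_x hk j) hd.2.2
    · obtain ⟨n, rfl⟩ := Nat.exists_eq_succ_of_ne_zero h0.ne'
      exact ⟨by omega, n, by omega, hd⟩
  -- the covered chain needs one step less, contrary to the choice of `m`
  have hm0 := (hpos j (hm j h1 h2)).1
  refine Nat.find_min hex (m := m - 1) (by omega) ⟨p', r', hC', fun i i1 i2 => ?_⟩
  obtain ⟨j', j1, j2, e⟩ := cover i i1 i2
  rw [← e]
  exact (hpos j' (hm j' j1 j2)).2

/-- The diagonals at the image of a vertex of a chain of edges mapped to diagonals: the image of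
the next vertex is the last one. -/
theorem not_ccw_succ {p r : ℤ} (hC : P.IsChain p r)
    (hd : ∀ j, p ≤ j → j < r → P.IsDiagonal s(P.A (P.x j), P.A (P.x (j + 1)))) {j : ℤ}
    (h1 : p ≤ j) (h2 : j < r) {y : Circle} (hy : s(P.A (P.x j), y) ∈ P.edgeOrbits)
    (hyd : P.IsDiagonal s(P.A (P.x j), y)) : ¬ ccw (P.A (P.x j)) (P.A (P.x (j + 1))) y := by
  rcases h1.eq_or_lt with rfl | h1
  · have hp : P.A (P.x p) = P.x p := hC.left
    have := hd p le_rfl h2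
    rw [hp] at hy hyd this ⊢
    exact H.not_cyc_of_fixed true hp this hy hyd
  · obtain ⟨i, hi⟩ := H.exists_A_x j
    have d1 := hd j h1.le h2
    have d2 := hd (j - 1) (by omega) (by omega)
    rw [sub_add_cancel, Sym2.eq_swap] at d2
    rw [hi] at hy hyd d1 d2 ⊢
    exact H.not_cyc_of_not_fixed true hi (hC.inner j h1 h2) d1 d2 hy hyd

/-- The image of the previous vertex is the first one. -/
theorem not_ccw_pred {p r : ℤ} (hC : P.IsChain p r)
    (hd : ∀ j, p ≤ j → j < r → P.IsDiagonal s(P.A (P.x j), P.A (P.x (j + 1)))) {j : ℤ}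
    (h1 : p ≤ j) (h2 : j < r) {y : Circle} (hy : s(P.A (P.x (j + 1)), y) ∈ P.edgeOrbits)
    (hyd : P.IsDiagonal s(P.A (P.x (j + 1)), y)) :
    ¬ ccw (P.A (P.x (j + 1))) y (P.A (P.x j)) := by
  have d1 := hd j h1 h2
  rw [Sym2.eq_swap] at d1
  have hnb : P.nbr false (j + 1) = P.x j := by
    change P.x (j + 1 - 1) = _
    rw [add_sub_cancel_right]
  by_cases hr : j + 1 = r
  · have hp : P.A (P.x (j + 1)) = P.x (j + 1) := hr ▸ hC.right
    rw [hp] at hy hyd d1 ⊢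
    have := H.not_cyc_of_fixed false hp (by rw [hnb]; exact d1) hy hyd
    rwa [hnb] at this
  · obtain ⟨i, hi⟩ := H.exists_A_x (j + 1)
    have d2 := hd (j + 1) (by omega) (by omega)
    rw [hi] at hy hyd d1 d2 ⊢
    have := H.not_cyc_of_not_fixed false hi (hC.inner _ (by omega) (by omega))
      (by rw [hnb]; exact d1) d2 hy hyd
    rwa [hnb] at this

/-- If all edges reach diagonals, some iterate of `A` maps all edges to diagonals. -/
theorem exists_iterate_isDiagonal (hall : ∀ e, P.IsEdge e → P.Hits e) :
    ∃ N : ℕ, ∀ j, s(P.A^[N] (P.x j), P.A^[N] (P.x (j + 1))) ∈ P.edgeOrbits ∧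
      P.IsDiagonal s(P.A^[N] (P.x j), P.A^[N] (P.x (j + 1))) := by
  have hk := H.three_le
  have hstep : ∀ n j, s(P.A^[n] (P.x j), P.A^[n] (P.x (j + 1))) ∈ P.edgeOrbits ∧
      (P.IsEdge s(P.A^[n] (P.x j), P.A^[n] (P.x (j + 1))) ∨
        P.IsDiagonal s(P.A^[n] (P.x j), P.A^[n] (P.x (j + 1)))) := by
    intro n j
    induction n with
    | zero => exact ⟨mem_edgeOrbits_of_isEdge (isEdge_x hk j), Or.inl (isEdge_x hk j)⟩
    | succ n ih =>
      obtain ⟨i1, i2⟩ := ih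
      rw [Function.iterate_succ_apply', Function.iterate_succ_apply']
      rcases i2 with i2 | i2
      · obtain ⟨i, hi⟩ := (isEdge_iff hk).mp i2
        have e : s(P.A (P.A^[n] (P.x j)), P.A (P.A^[n] (P.x (j + 1))))
            = s(P.A (P.x i), P.A (P.x (i + 1))) := by
          rw [← Sym2.map_mk, hi, Sym2.map_mk]
        rw [e]
        exact ⟨H.A_edge_mem_edgeOrbits i, (H.edge_or_diagonal_map i).imp id fun h => h.1⟩
      · obtain ⟨f1, f2⟩ := H.fixed_of_isDiagonal i1 i2
        rw [f1, f2]
        exact ⟨i1, Or.inr i2⟩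
  have hmono : ∀ n j, P.IsDiagonal s(P.A^[n] (P.x j), P.A^[n] (P.x (j + 1))) → ∀ l : ℕ,
      P.IsDiagonal s(P.A^[n + l] (P.x j), P.A^[n + l] (P.x (j + 1))) := by
    intro n j hd l
    induction l with
    | zero => exact hd
    | succ l ih =>
      obtain ⟨f1, f2⟩ := H.fixed_of_isDiagonal (hstep _ _).1 ih
      rw [← add_assoc, Function.iterate_succ_apply', Function.iterate_succ_apply', f1, f2]
      exact ih
  have hit : ∀ (n : ℕ) (p q : Circle), (Sym2.map P.A)^[n] s(p, q) = s(P.A^[n] p, P.A^[n] q) := by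
    intro n
    induction n with
    | zero => exact fun _ _ => rfl
    | succ n ih =>
      intro p q
      rw [Function.iterate_succ_apply, Function.iterate_succ_apply, Function.iterate_succ_apply,
        Sym2.map_mk, ih]
  choose N hN using fun j => hall _ (isEdge_x hk j)
  refine ⟨(Finset.Ico (0 : ℤ) P.k).sup N, fun j => ⟨(hstep _ _).1, ?_⟩⟩
  obtain ⟨i, m, i0, i1, rfl⟩ := exists_eq_add_mul (P := P) 0 j
  rw [zero_add, show i + m * P.k + 1 = i + 1 + m * P.k by ring, x_add_mul, x_add_mul]
  have h1 : N i ≤ (Finset.Ico (0 : ℤ) P.k).sup N :=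
    Finset.le_sup (f := N) (Finset.mem_Ico.mpr ⟨i0, i1⟩)
  have h2 := hN i
  rw [hit] at h2
  have := hmono _ _ h2 ((Finset.Ico (0 : ℤ) P.k).sup N - N i)
  rwa [Nat.add_sub_cancel' h1] at this

/-- Between the images of adjacent vertices of the chain there are no fixed vertices: walking
along the vertices from such a fixed vertex, and mapping the walk forward until it runs through
diagonals, one would have to cross the diagonal joining the two images, or end on it. -/
theorem no_fixed_between (hall : ∀ e, P.IsEdge e → P.Hits e) {p r : ℤ} (hC : P.IsChain p r)
    (hd : ∀ j, p ≤ j → j < r → P.IsDiagonal s(P.A (P.x j), P.A (P.x (j + 1)))) {j a : ℤ}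
    (h1 : p ≤ j) (h2 : j < r) (ha : P.FixedAt a)
    (hc : ccw (P.A (P.x (j + 1))) (P.x a) (P.A (P.x j))) : False := by
  obtain ⟨N, hN⟩ := H.exists_iterate_isDiagonal hall
  have hE := H.A_edge_mem_edgeOrbits j
  obtain ⟨f1, f2⟩ := H.fixed_of_isDiagonal hE (hd j h1 h2)
  -- walking along `∂R` from `x a`, the `N`-th images stay on the arc between the endpoints of the
  -- diagonal, although they finally have to reach one of these endpoints, which is fixed
  have walk : ∀ i : ℕ, ccw (P.A (P.x (j + 1))) (P.A^[N] (P.x (a + i))) (P.A (P.x j)) := by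
    intro i
    induction i with
    | zero =>
      rw [Nat.cast_zero, add_zero, Function.iterate_fixed ha]
      exact hc
    | succ i ih =>
      obtain ⟨n1, n2⟩ := hN (a + i)
      push_cast
      rw [← add_assoc]
      by_cases e1 : P.A^[N] (P.x (a + i + 1)) = P.A (P.x (j + 1))
      · rw [e1, Sym2.eq_swap] at n1 n2
        exact absurd ih (H.not_ccw_pred hC hd h1 h2 n1 n2)
      by_cases e2 : P.A^[N] (P.x (a + i + 1)) = P.A (P.x j)
      · rw [e2, Sym2.eq_swap] at n1 n2
        exact absurd (ccw_rotate (ccw_rotate ih)) (H.not_ccw_succ hC hd h1 h2 n1 n2)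
      rcases ccw_total (Ne.symm e1) (H.A_x_ne j).symm e2 with h | h
      · exact h
      · rw [Sym2.eq_swap] at hE
        exact (H.not_cross hE n1 ih (ccw_rotate h)).elim
  obtain ⟨b, hb⟩ := H.exists_A_x j
  obtain ⟨ρ, m, r0, r1, e⟩ := exists_eq_add_mul (P := P) a b
  have := walk ρ.toNat
  rw [Int.toNat_of_nonneg r0, ← x_add_mul (a + ρ) m, ← e, ← hb, Function.iterate_fixed f1] at this
  exact ccw_ne_right this rfl

/-- The combinatorial structure of the map when all edges reach diagonals: there are two
consecutive fixed vertices `x p` and `x (p + q)` such that `A` maps the vertices between them, in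
the given order, to the fixed vertices in the reversed order. -/
theorem exists_fan (hall : ∀ e, P.IsEdge e → P.Hits e) {w : ℤ} (hw : P.FixedAt w) :
    ∃ (p : ℤ) (q : ℕ) (ζ : ℕ → ℤ), 2 ≤ q ∧ ζ 0 = p + P.k ∧ ζ q = p + q ∧
      (∀ t, ζ (t + 1) < ζ t) ∧ (∀ t ≤ q, P.A (P.x (p + t)) = P.x (ζ t)) ∧
      (∀ t ≤ q, P.FixedAt (ζ t)) ∧
      ∀ t < q, P.IsDiagonal s(P.x (ζ t), P.x (ζ (t + 1))) := by
  have hk := H.three_le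
  obtain ⟨p, r, hC, hd⟩ := H.exists_direct_chain hall hw
  have hprev : ∀ a, ∃ i < a, P.FixedAt i ∧ ∀ t, i < t → t < a → ¬ P.FixedAt t :=
    fun a => exists_prev hw a
  choose prev hp1 hp2 hp3 using hprev
  obtain ⟨ζ, hζ⟩ : ∃ ζ : ℕ → ℤ, ζ = fun t => prev^[t] (p + P.k) := ⟨_, rfl⟩
  have z0 : ζ 0 = p + P.k := by rw [hζ]; rfl
  have zs : ∀ t, ζ (t + 1) = prev (ζ t) := by
    intro t
    rw [hζ]
    exact Function.iterate_succ_apply' prev t _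
  have zlt : ∀ t, ζ (t + 1) < ζ t := fun t => by rw [zs]; exact hp1 _
  have zanti : StrictAnti ζ := strictAnti_nat_of_succ_lt zlt
  have zfix : ∀ t, P.FixedAt (ζ t) := by
    intro t
    cases t with
    | zero => rw [z0]; exact fixedAt_congr (x_add_k p).symm hC.left
    | succ t => rw [zs]; exact hp2 _
  have znone : ∀ t i, ζ (t + 1) < i → i < ζ t → ¬ P.FixedAt i := by
    intro t i h1 h2
    rw [zs] at h1
    exact hp3 _ i h1 h2
  have hpr := hC.lt
  obtain ⟨q, hq⟩ : ∃ q : ℕ, r = p + q := ⟨(r - p).toNat, by omega⟩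
  subst hq
  have zA : ∀ t : ℕ, t ≤ q → P.A (P.x (p + t)) = P.x (ζ t) := by
    intro t
    induction t with
    | zero =>
      intro _
      rw [z0, x_add_k, Nat.cast_zero, add_zero]
      exact hC.left
    | succ t ih =>
      intro ht
      have iht := ih (by omega)
      have hdt := hd (p + t) (by omega) (by omega)
      obtain ⟨f1, f2⟩ := H.fixed_of_isDiagonal (H.A_edge_mem_edgeOrbits _) hdt
      obtain ⟨ρ, r0, r1, e⟩ := exists_x_eq (ζ t - P.k) (hdt.2.1 _ (Sym2.mem_mk_right _ _))
      have hρ : ρ ≠ 0 := by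
        rintro rfl
        refine hdt.1 ?_
        rw [e, add_zero, iht, show ζ t - (P.k : ℤ) = ζ t + (-1) * P.k by ring, x_add_mul]
        rfl
      have hfix : P.FixedAt (ζ t - P.k + ρ) := by
        unfold FixedAt
        rw [← e]; exact f2
      push_cast
      rw [← add_assoc, e]
      congr 1
      by_contra hne
      have h3 : ζ t - P.k + ρ < ζ (t + 1) := by
        by_contra hcon
        exact znone t _ (by omega) (by omega) hfix
      refine H.no_fixed_between hall hC hd (j := p + t) (by omega) (by omega) (zfix (t + 1)) ?_
      rw [e, iht]
      exact ccw_x h3 (zlt t) (by omega)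
  have hdiag : ∀ t < q, P.IsDiagonal s(P.x (ζ t), P.x (ζ (t + 1))) := by
    intro t ht
    have := hd (p + t) (by omega) (by omega)
    rwa [zA t ht.le, show p + (t : ℤ) + 1 = p + ((t + 1 : ℕ) : ℤ) by push_cast; ring,
      zA (t + 1) ht] at this
  have hE : ∀ t < q, s(P.x (ζ t), P.x (ζ (t + 1))) ∈ P.edgeOrbits := by
    intro t ht
    have := H.A_edge_mem_edgeOrbits (p + t)
    rwa [zA t ht.le, show p + (t : ℤ) + 1 = p + ((t + 1 : ℕ) : ℤ) by push_cast; ring,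
      zA (t + 1) ht] at this
  have hq2 : 2 ≤ q := by
    by_contra hcon
    have : q = 1 := by omega
    subst this
    exact H.not_both_fixed hC.left hC.right
  have hxq : P.x (ζ q) = P.x (p + q) := by rw [← zA q le_rfl]; exact hC.right
  refine ⟨p, q, ζ, hq2, z0, ?_, zlt, zA, fun t _ => zfix t, hdiag⟩
  have hqk : (q : ℤ) < P.k := by
    -- a chain around the whole polygon would have only one fixed vertex
    by_contra hcon
    have h1 := hdiag 0 (by omega)
    refine h1.1 ?_
    have h2 : ζ (0 + 1) = p := by
      have a1 : ¬ p < ζ (0 + 1) := fun h => by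
        have := zlt 0
        exact hC.inner _ h (by omega) (zfix 1)
      have a2 : ¬ ζ (0 + 1) < p := fun h => znone 0 p h (by omega) hC.left
      omega
    rw [h2, z0, x_add_k]
    rfl
  have hzq0 : ζ q < ζ 0 := zanti (by omega)
  obtain ⟨m, hm⟩ := x_eq_iff.mp hxq
  rcases lt_trichotomy (ζ q) (p + q) with hlt | heq | hgt
  · exfalso
    have hzp : ζ q ≤ p := by
      by_contra hcon
      exact hC.inner _ (by omega) hlt (zfix q)
    classical
    have hex : ∃ l, ζ l ≤ p := ⟨q, hzp⟩
    have hl := Nat.find_spec hex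
    have hlq : Nat.find hex ≤ q := Nat.find_min' hex hzp
    have hl0 : Nat.find hex ≠ 0 := by
      intro e
      rw [e, z0] at hl
      omega
    obtain ⟨l, hl'⟩ := Nat.exists_eq_succ_of_ne_zero hl0
    have hlp : ¬ ζ l ≤ p := Nat.find_min hex (by omega)
    rw [hl', Nat.succ_eq_add_one] at hl
    have e1 : ζ (l + 1) = p := by
      by_contra hcon
      exact znone l p (by omega) (by omega) hC.left
    have e2 : ζ l = p + q := by
      have a1 : ¬ ζ l < p + q := fun h => hC.inner _ (by omega) h (zfix l)
      have a2 : ¬ p + q < ζ l := fun h => znone l _ (by omega) h hC.right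
      omega
    have hl1 : l + 1 < q := by
      rcases (show l + 1 ≤ q by omega).eq_or_lt with h | h
      · exfalso
        rw [← h, e1] at hxq
        rw [h] at hxq
        exact x_ne (by omega) (by omega) hxq
      · exact h
    -- the first and the `l + 1`-st edge of the chain have the same image
    have e3 : P.x (ζ (l + 1 + 1)) = P.x (ζ 1) := by
      have a0 : P.x (ζ (l + 1)) = P.x (ζ 0) := by rw [e1, z0, x_add_k]
      have b1 := hE (l + 1) hl1
      have b2 := hdiag (l + 1) hl1
      have b3 := hE 0 (by omega)
      have b4 := hdiag 0 (by omega)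
      have c1 := H.not_ccw_succ hC hd (j := p + (0 : ℕ)) (by omega) (by omega)
        (y := P.x (ζ (l + 1 + 1))) (by rw [zA 0 (by omega), ← a0]; exact b1)
        (by rw [zA 0 (by omega), ← a0]; exact b2)
      have c2 := H.not_ccw_succ hC hd (j := p + (l + 1 : ℕ)) (by omega) (by omega)
        (y := P.x (ζ (0 + 1))) (by rw [zA (l + 1) (by omega), a0]; exact b3)
        (by rw [zA (l + 1) (by omega), a0]; exact b4)
      rw [show p + ((0 : ℕ) : ℤ) + 1 = p + (1 : ℕ) by push_cast; ring, zA 0 (by omega),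
        zA 1 (by omega)] at c1
      rw [show p + ((l + 1 : ℕ) : ℤ) + 1 = p + ((l + 1 + 1 : ℕ) : ℤ) by push_cast; ring,
        zA (l + 1) (by omega), zA (l + 1 + 1) (by omega), a0] at c2
      by_contra hne
      rw [a0] at b2
      rcases ccw_total b4.1 b2.1 (Ne.symm hne) with h | h
      · exact c1 h
      · exact c2 h
    -- the polygon `X` spanned by the vertices of the chain is disjoint from its translates
    let idx : ℕ → ℤ := fun i => if i ≤ q then p + i else p + P.k
    have mono : ∀ i j, i < j → j ≤ q + 1 → idx i < idx j := by
      intro i j hij hj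
      simp only [idx]
      split_ifs <;> omega
    have hc : idx (q + 1) = idx 0 + P.k := by simp [idx]
    obtain ⟨X, hX⟩ : ∃ X, X = subPolygon (q + 1) (by omega) idx mono hc := ⟨_, rfl⟩
    have hXN : X.N = q + 1 := by rw [hX]; rfl
    have hXv : ∀ i ≤ q, X.v i = P.x (p + i) := by
      intro i hi
      rw [hX, subPolygon_v]
      simp only [idx, if_pos hi]
    have hXq : X.v (q + 1) = P.x p := by
      rw [hX, subPolygon_v, hc]
      simp only [idx, x_add_k]
      simp
    have hXR : X.inner ⊆ P.R := hX ▸ subPolygon_inner_subset hk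
    have hXE : ∀ i < X.N, s(X.v i, X.v (i + 1)) ∈ P.edgeOrbits := by
      intro i hi
      rw [hXN] at hi
      rcases (Nat.lt_succ_iff.mp hi).eq_or_lt with rfl | hi'
      · rw [hXq, hXv i le_rfl]
        have := hE l (by omega)
        rwa [e2, e1] at this
      · rw [hXv i hi'.le, hXv (i + 1) hi']
        push_cast
        rw [← add_assoc]
        exact mem_edgeOrbits_of_isEdge (isEdge_x hk _)
    have hfixside : ∀ y ∈ P.vertices, P.A y = y → toDisk y ∈ halfPlane (P.x (p + q)) (P.x p) := by
      intro y hy hfy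
      obtain ⟨ρ, r0, r1, rfl⟩ := exists_x_eq p hy
      rw [mem_halfPlane_iff (x_ne (show p < p + q by omega) (by omega)).symm]
      rcases r0.eq_or_lt with rfl | r0
      · right; left; rw [add_zero]
      rcases lt_trichotomy ρ q with h | h | h
      · exact absurd hfy (hC.inner _ (by omega) (by omega))
      · left; rw [h]
      · right; right
        exact ccw_rotate (ccw_x (show p < p + q by omega) (by omega) (by omega))
    have hdisj : ∀ h ∈ P.group, ∀ i < X.N, ∀ z ∈ X.inner,
        z ∉ geodesic s(onCircle h (X.v i), onCircle h (X.v (i + 1))) := by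
      intro h hh i hi z hz hzg
      have hb := map_mem_edgeOrbits (hXE i hi) hh
      obtain ⟨d1, d2⟩ := H.isDiagonal_of_mem_R hb (hXR hz) hzg
      rw [Sym2.map_mk] at d1 d2
      have h5 := geodesic_subset_halfPlane d1.1
        (hfixside _ (d1.2.1 _ (Sym2.mem_mk_left _ _)) (d2 _ (Sym2.mem_mk_left _ _)))
        (hfixside _ (d1.2.1 _ (Sym2.mem_mk_right _ _)) (d2 _ (Sym2.mem_mk_right _ _))) hzg
      have h6 := hz.2 q (by omega)
      rw [hXq, hXv q le_rfl] at h6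
      change 0 ≤ side _ _ _ at h5
      linarith
    -- this element of `Γ` maps a side of `X` to another one, orientation preserved, so that it
    -- maps a point of the polygon into the polygon
    have k1 : onCircle ((P.g (p + (l + 1 : ℕ)))⁻¹ * P.g p) (X.v 0) = X.v (l + 1) := by
      rw [hXv 0 (by omega), hXv (l + 1) (by omega), onCircle_mul]
      apply onCircle_injective (P.g (p + (l + 1 : ℕ)))
      rw [onCircle_apply_inv, ← A_x, zA (l + 1) (by omega), e1, Nat.cast_zero, add_zero, ← A_x]
      exact hC.left
    have k2 : onCircle ((P.g (p + (l + 1 : ℕ)))⁻¹ * P.g p) (X.v (0 + 1)) = X.v (l + 1 + 1) := by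
      rw [hXv (0 + 1) (by omega), hXv (l + 1 + 1) (by omega), onCircle_mul]
      apply onCircle_injective (P.g (p + (l + 1 : ℕ)))
      have a1 : P.A (P.x (p + ((0 + 1 : ℕ) : ℤ))) = onCircle (P.g p) (P.x (p + ((0 + 1 : ℕ) : ℤ))) := by
        have := A_x_succ (P := P) p
        simpa using this
      have a2 : P.A (P.x (p + ((l + 1 + 1 : ℕ) : ℤ)))
          = onCircle (P.g (p + (l + 1 : ℕ))) (P.x (p + ((l + 1 + 1 : ℕ) : ℤ))) := by
        have := A_x_succ (P := P) (p + (l + 1 : ℕ))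
        rwa [show p + ((l + 1 : ℕ) : ℤ) + 1 = p + ((l + 1 + 1 : ℕ) : ℤ) by push_cast; ring] at this
      rw [onCircle_apply_inv, ← a1, ← a2, zA (0 + 1) (by omega), zA (l + 1 + 1) (by omega), e3]
    obtain ⟨z, hz, hz'⟩ := X.exists_mem_inner X (i := 0) (j := l + 1) (by omega) (by omega) k1 k2
    have k3 := X.eq_one_of_mem_inner H.torsionFree hdisj
      (P.group.mul_mem (P.group.inv_mem (g_mem _)) (g_mem _)) hz hz'
    rw [k3, onCircle_one] at k1
    exact X.v_ne (i := 0) (j := l + 1) (by omega) (by omega) k1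
  · exact heq
  · exact absurd hxq (x_ne hgt (by omega)).symm

end StandingAssumptions

end PiecewiseMobius

end Mating

namespace Mating

/-- Barycentric coordinates with respect to the vertices of an ideal triangle. -/
theorem chord_barycentric (a b p q r : Circle) (z : ℂ) :
    chord a b z * chord p q r
      = chord q r z * chord a b p + chord r p z * chord a b q + chord p q z * chord a b r := by
  simp only [chord, map_sub, Complex.mul_im, Complex.sub_re, Complex.sub_im, Complex.conj_re,
    Complex.conj_im]
  ring

namespace PiecewiseMobius

variable {P : PiecewiseMobius}

/-! ### The inner domain -/

/-- The vertices fixed by `A`. -/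
def fixedVertices (P : PiecewiseMobius) : Set Circle := {w | w ∈ P.vertices ∧ P.A w = w}

theorem innerDomainClosure_subset_idealHull :
    P.innerDomainClosure ⊆ idealHull P.fixedVertices := by
  let C : Set ClosedDisk := {z | ∀ p q : Circle, p ≠ q →
    (∀ w ∈ P.fixedVertices, toDisk w ∈ halfPlane p q) → z ∈ halfPlane p q}
  have hC : IsClosed C := by
    have : C = ⋂ p, ⋂ q, ⋂ (_ : p ≠ q), ⋂ (_ : ∀ w ∈ P.fixedVertices, toDisk w ∈ halfPlane p q),
        halfPlane p q := by
      ext z; simp [C]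
    rw [this]
    exact isClosed_iInter fun p => isClosed_iInter fun q => isClosed_iInter fun _ =>
      isClosed_iInter fun _ => isClosed_le continuous_const (continuous_side _ _)
  rintro z ⟨hz, hz'⟩
  refine ⟨hz', hC.closure_subset_iff.mpr ?_ hz⟩
  intro w hw
  exact (interior_subset hw).2

/-- The geodesics joining two of at least three fixed vertices are contained in the closure of the
inner domain. -/
theorem geodesic_subset_innerDomainClosure {p q r : Circle} (hp : p ∈ P.fixedVertices)
    (hq : q ∈ P.fixedVertices) (hr : r ∈ P.fixedVertices) (hpq : p ≠ q) (hpr : p ≠ r)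
    (hqr : q ≠ r) : geodesic s(p, q) ⊆ P.innerDomainClosure := by
  wlog h : ccw p q r generalizing p q
  · rw [Sym2.eq_swap]
    refine this hq hp hpq.symm hqr hpr ?_
    exact ccw_rotate (ccw_rotate ((ccw_total hpq hpr hqr).resolve_left h))
  obtain ⟨X, hN, e0, e1, e2, e3⟩ := exists_triangle h
  have hsub : X.inner ⊆ P.innerDomain := by
    refine interior_maximal (fun z hz => ⟨hz.1, fun a b _ hW => ?_⟩) X.isOpen_inner
    have s0 := hz.2 0 (by omega)
    have s1 := hz.2 1 (by omega)
    have s2 := hz.2 2 (by omega)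
    rw [e0, e1, side_neg_iff] at s0
    rw [e1, e2, side_neg_iff] at s1
    rw [e2, e3, side_neg_iff] at s2
    have c : ∀ w ∈ P.fixedVertices, 0 ≤ chord a b w := by
      intro w hw
      have := hW w hw
      change 0 ≤ side _ _ _ at this
      rwa [side_nonneg_iff, klein_toDisk] at this
    change 0 ≤ side a b z
    rw [side_nonneg_iff]
    have hb := chord_barycentric a b p q r (klein z : ClosedDisk)
    have hneg : chord p q r < 0 := by
      have h' : 0 < chord p r q := h
      rw [chord_swap r p, chord_rotate r p q] at h'
      linarith
    by_contra hcon
    push Not at hcon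
    have t0 := mul_pos_of_neg_of_neg hcon hneg
    have t1 := mul_nonneg (neg_nonneg.mpr s1.le) (c p hp)
    have t2 := mul_nonneg (neg_nonneg.mpr s2.le) (c q hq)
    have t3 := mul_nonneg (neg_nonneg.mpr s0.le) (c r hr)
    linarith
  intro z hz
  refine ⟨closure_mono hsub ?_, hz.1⟩
  rw [X.closure_inner]
  refine X.geodesic_subset_outer (j := 0) (by omega) ?_
  rwa [e0, e1]

namespace StandingAssumptions

variable (H : P.StandingAssumptions)
include H

/-- As no two adjacent vertices are fixed, the hull of the fixed vertices is contained in `R`. -/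
theorem innerDomainClosure_subset_R : P.innerDomainClosure ⊆ P.R := by
  intro z hz
  obtain ⟨hz, hW⟩ := innerDomainClosure_subset_idealHull hz
  have hk := H.three_le
  refine ⟨hz, fun h => ?_⟩
  obtain ⟨j, hj⟩ := Set.mem_iUnion.mp h
  change 0 ≤ side _ _ _ at hj
  have key : ∀ i : ℤ, P.A (P.x i) ≠ P.x i → 0 ≤ side (P.x (i + 1)) (P.x (i + P.k - 1)) z := by
    intro i hi
    refine hW _ _ (x_ne (by omega) (by omega)) ?_
    rintro w ⟨hw, hw'⟩
    rw [mem_halfPlane_iff (x_ne (by omega) (by omega))]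
    obtain ⟨r, r0, r1, rfl⟩ := exists_x_eq i hw
    have hr0 : r ≠ 0 := by
      rintro rfl
      rw [add_zero] at hw'
      exact hi hw'
    by_cases h1 : r = 1
    · left; rw [h1]
    by_cases h2 : r = P.k - 1
    · right; left; rw [h2]; congr 1; ring
    · right; right
      exact ccw_x (by omega) (by omega) (by omega)
  by_cases h1 : P.A (P.x j) = P.x j
  · have h2 : P.A (P.x (j + 1)) ≠ P.x (j + 1) := fun h2 => H.not_both_fixed h1 h2
    have h3 := key (j + 1) h2
    rw [show j + 1 + P.k - 1 = j + P.k by ring] at h3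
    have h4 : ccw (P.x (j + 1 + 1)) (P.x (j + P.k)) (P.x (j + P.k + 1)) :=
      ccw_x (by omega) (by omega) (by omega)
    have h5 := side_neg_of_adjacent h4 hz h3
    rw [x_add_k, show j + P.k + 1 = j + 1 + P.k by ring, x_add_k] at h5
    linarith
  · have h3 := key j h1
    have h4 : ccw (P.x j) (P.x (j + 1)) (P.x (j + P.k - 1)) :=
      ccw_x (by omega) (by omega) (by omega)
    have h5 := side_neg_of_adjacent h4 hz hj
    linarith

theorem extStep_map {e : Sym2 Circle} (he : P.IsEdge e) : P.ExtStep e (e.map P.A) := by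
  obtain ⟨j, rfl⟩ := (isEdge_iff H.three_le).mp he
  exact extStep_of_mem_arc H.three_le he.1 (x_mem_arc j) (x_succ_mem_arc j)

theorem exists_fixed_of_hits {e : Sym2 Circle} (he : P.IsEdge e) (h : P.Hits e) :
    ∃ f, P.ExtReaches e f ∧ P.IsDiagonal f ∧ ∀ p ∈ f, P.A p = p := by
  obtain ⟨n, hn⟩ := h
  induction n generalizing e with
  | zero => exact absurd he hn.2.2
  | succ n ih =>
    rcases H.map_isEdge_or he with h | ⟨h, hf⟩
    · obtain ⟨f, h1, h2⟩ := ih h hn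
      exact ⟨f, Relation.ReflTransGen.head (H.extStep_map he) h1, h2⟩
    · refine ⟨_, Relation.ReflTransGen.single (H.extStep_map he), h, fun p hp => ?_⟩
      obtain ⟨q, hq, rfl⟩ := Sym2.mem_map.mp hp
      exact hf q hq

/-- If all edges reach diagonals, there are at least three fixed vertices. -/
theorem exists_third (hall : ∀ e, P.IsEdge e → P.Hits e) (p q : Circle) :
    ∃ r ∈ P.fixedVertices, p ≠ r ∧ q ≠ r := by
  have hk := H.three_le
  obtain ⟨f, -, hd, hf⟩ := H.exists_fixed_of_hits (isEdge_x hk 0) (hall _ (isEdge_x hk 0))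
  obtain ⟨w, hw⟩ : ∃ w : ℤ, P.FixedAt w := by
    induction f using Sym2.ind with
    | _ a b =>
    obtain ⟨w, rfl⟩ := hd.2.1 a (by simp)
    exact ⟨w, hf _ (by simp)⟩
  obtain ⟨s, n, ζ, hn, z0, zn, zlt, -, zf, -⟩ := H.exists_fan hall hw
  have zanti : StrictAnti ζ := strictAnti_nat_of_succ_lt zlt
  have h2 : ζ n ≤ ζ 2 := zanti.antitone hn
  have l1 : ζ 1 < ζ 0 := zlt 0
  have l2 : ζ 2 < ζ 1 := zlt 1
  have n01 : P.x (ζ 1) ≠ P.x (ζ 0) := x_ne l1 (by omega)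
  have n12 : P.x (ζ 2) ≠ P.x (ζ 1) := x_ne l2 (by omega)
  have n02 : P.x (ζ 2) ≠ P.x (ζ 0) := x_ne (by omega) (by omega)
  have m0 : P.x (ζ 0) ∈ P.fixedVertices := ⟨x_mem_vertices _, zf 0 (by omega)⟩
  have m1 : P.x (ζ 1) ∈ P.fixedVertices := ⟨x_mem_vertices _, zf 1 (by omega)⟩
  have m2 : P.x (ζ 2) ∈ P.fixedVertices := ⟨x_mem_vertices _, zf 2 (by omega)⟩
  by_contra hc
  push Not at hc
  have c0 := hc _ m0
  have c1 := hc _ m1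
  have c2 := hc _ m2
  by_cases e0 : p = P.x (ζ 0)
  · have d1 := c1 (by rw [e0]; exact n01.symm)
    have d2 := c2 (by rw [e0]; exact n02.symm)
    exact n12 (d2.symm.trans d1)
  · have d0 := c0 e0
    by_cases e1 : p = P.x (ζ 1)
    · have d2 := c2 (by rw [e1]; exact n12.symm)
      exact n02 (d2.symm.trans d0)
    · exact n01 ((c1 e1).symm.trans d0)

theorem geodesic_subset_of_isDiagonal (hall : ∀ e, P.IsEdge e → P.Hits e) {f : Sym2 Circle}
    (hd : P.IsDiagonal f) (hf : ∀ p ∈ f, P.A p = p) : geodesic f ⊆ P.innerDomainClosure := by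
  induction f using Sym2.ind with
  | _ p q =>
  obtain ⟨r, hr, h1, h2⟩ := H.exists_third hall p q
  exact geodesic_subset_innerDomainClosure ⟨hd.2.1 p (by simp), hf p (by simp)⟩
    ⟨hd.2.1 q (by simp), hf q (by simp)⟩ hr hd.1 h1 h2

/-- If all edges are mapped to edges, then the boundary of `R` is invariant. -/
theorem extImage_frontier (hE : ∀ e, P.IsEdge e → P.IsEdge (e.map P.A)) :
    P.extImage (frontier P.R) = frontier P.R := by
  have hk := H.three_le
  obtain ⟨p, n, -, hp⟩ := H.exists_reflection hE
  have hA : ∀ j, P.A (P.x j) = P.x (2 * p - j) := by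
    intro j
    have := hp (j - p)
    rwa [show p + (j - p) = j by ring, show p - (j - p) = 2 * p - j by ring] at this
  have hreg : ∀ j, P.x j ∈ P.arc j := x_mem_arc
  ext z
  constructor
  · intro hz
    obtain ⟨j, w, ⟨hw, hwj⟩, rfl⟩ := Set.mem_iUnion.mp hz
    rw [frontier_R hk] at hw
    rcases hw with hw | ⟨v, hv, rfl⟩
    · obtain ⟨i, hi⟩ := Set.mem_iUnion.mp hw
      have hi' : w ∈ P.region i := by
        change 0 ≤ side _ _ _
        rw [hi.2]
      obtain ⟨m, rfl⟩ := eq_of_mem_region hk hi.1 hi' hwj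
      have h1 := hE _ (isEdge_x hk i)
      rw [Sym2.map_mk, A_x, A_x_succ] at h1
      rw [g_add_mul]
      exact h1.2 ((apply_mem_geodesic _).mpr hi)
    · rw [frontier_R hk]
      right
      rw [← mem_arc_iff_region hk] at hwj
      exact ⟨P.A v, A_mem_vertices hk H.markov hv, by rw [A_arc hwj, toDisk_onCircle]⟩
  · intro hz
    rw [frontier_R hk] at hz
    rcases hz with hz | ⟨v, ⟨i, rfl⟩, rfl⟩
    · obtain ⟨i, hi⟩ := Set.mem_iUnion.mp hz
      refine Set.mem_iUnion.mpr ⟨2 * p - i - 1, ?_⟩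
      have h1 : onCircle (P.g (2 * p - i - 1)) (P.x (2 * p - i - 1)) = P.x (i + 1) := by
        rw [← A_x, hA]; congr 1; ring
      have h2 : onCircle (P.g (2 * p - i - 1)) (P.x (2 * p - i - 1 + 1)) = P.x i := by
        rw [← A_x_succ, hA]; congr 1; ring
      rw [Sym2.eq_swap, ← h1, ← h2, ← image_geodesic] at hi
      obtain ⟨w, hw, rfl⟩ := hi
      refine ⟨w, ⟨(isEdge_x hk _).2 hw, ?_⟩, rfl⟩
      change 0 ≤ side _ _ _
      rw [hw.2]
    · refine Set.mem_iUnion.mpr ⟨2 * p - i, toDisk (P.x (2 * p - i)), ⟨?_, ?_⟩, ?_⟩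
      · rw [frontier_R hk]
        exact Or.inr ⟨_, x_mem_vertices _, rfl⟩
      · rw [← mem_arc_iff_region hk]
        exact x_mem_arc _
      · rw [← toDisk_onCircle, ← A_x, hA]
        congr 2
        ring

end StandingAssumptions

end PiecewiseMobius

end Mating

namespace Mating

/-! ### Expansive maps -/

/-- For an expansive map which is injective on the pairs of a closed invariant relation, any set of
pairwise related points is finite: two such points stay a definite distance apart as soon as they
have once been separated by the expansivity constant, so the images of many points would eventually
be separated simultaneously. -/
theorem finite_of_expansive {X : Type*} [MetricSpace X] [CompactSpace X] {f : X → X}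
    (hf : Continuous f) {K : Set (X × X)} (hK : IsClosed K)
    (hinv : ∀ a b, (a, b) ∈ K → (f a, f b) ∈ K) (hinj : ∀ a b, (a, b) ∈ K → f a = f b → a = b)
    {δ : ℝ} (hexp : ∀ a b, a ≠ b → ∃ n : ℕ, δ < dist (f^[n] a) (f^[n] b)) {S : Set X}
    (hS : ∀ a ∈ S, ∀ b ∈ S, (a, b) ∈ K) (hδ : 0 < δ) : S.Finite := by
  have hinvn : ∀ (n : ℕ) a b, (a, b) ∈ K → (f^[n] a, f^[n] b) ∈ K := by
    intro n
    induction n with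
    | zero => exact fun _ _ h => h
    | succ n ih =>
      intro a b h
      rw [Function.iterate_succ_apply, Function.iterate_succ_apply]
      exact ih _ _ (hinv _ _ h)
  have hinjn : ∀ (n : ℕ) a b, (a, b) ∈ K → a ≠ b → f^[n] a ≠ f^[n] b := by
    intro n
    induction n with
    | zero => exact fun _ _ _ h => h
    | succ n ih =>
      intro a b h hab
      rw [Function.iterate_succ_apply, Function.iterate_succ_apply]
      exact ih _ _ (hinv _ _ h) fun e => hab (hinj _ _ h e)
  let L : Set (X × X) := K ∩ {c | δ ≤ dist c.1 c.2}
  have hL : IsCompact L :=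
    (hK.inter (isClosed_le continuous_const (continuous_fst.dist continuous_snd))).isCompact
  have hLne : ∀ c ∈ L, c.1 ≠ c.2 := by
    intro c hc e
    have : δ ≤ dist c.1 c.2 := hc.2
    rw [e, dist_self] at this
    linarith
  have hcont : ∀ n, Continuous fun c : X × X => dist (f^[n] c.1) (f^[n] c.2) := fun n =>
    ((hf.iterate n).comp continuous_fst).dist ((hf.iterate n).comp continuous_snd)
  -- separated pairs are separated again after at most `N` steps
  obtain ⟨N, hN⟩ : ∃ N : ℕ, ∀ c ∈ L, ∃ n < N, δ < dist (f^[n + 1] c.1) (f^[n + 1] c.2) := by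
    obtain ⟨t, ht⟩ := hL.elim_finite_subcover
      (fun n : ℕ => {c : X × X | δ < dist (f^[n + 1] c.1) (f^[n + 1] c.2)})
      (fun n => isOpen_lt continuous_const (hcont _)) (by
        intro c hc
        obtain ⟨n, hn⟩ := hexp (f c.1) (f c.2) fun e => hLne c hc (hinj _ _ hc.1 e)
        exact Set.mem_iUnion.mpr ⟨n, hn⟩)
    refine ⟨t.sup id + 1, fun c hc => ?_⟩
    obtain ⟨n, hn, hn'⟩ := Set.mem_iUnion₂.mp (ht hc)
    exact ⟨n, Nat.lt_succ_of_le (Finset.le_sup (f := id) hn), hn'⟩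
  -- in the meantime they stay at a definite distance
  obtain ⟨κ, hκ, hκ'⟩ : ∃ κ > 0, ∀ i ≤ N, ∀ c ∈ L, κ ≤ dist (f^[i] c.1) (f^[i] c.2) := by
    have one : ∀ i, ∃ κ > 0, ∀ c ∈ L, κ ≤ dist (f^[i] c.1) (f^[i] c.2) := by
      intro i
      rcases L.eq_empty_or_nonempty with h | h
      · exact ⟨1, one_pos, by simp [h]⟩
      · obtain ⟨c, hc, hmin⟩ := hL.exists_isMinOn h (hcont i).continuousOn
        exact ⟨_, dist_pos.mpr (hinjn i _ _ hc.1 (hLne c hc)), fun d hd => hmin hd⟩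
    generalize N = M
    induction M with
    | zero =>
      obtain ⟨κ, h0, h1⟩ := one 0
      exact ⟨κ, h0, fun i hi => by rw [Nat.le_zero.mp hi]; exact h1⟩
    | succ M ih =>
      obtain ⟨κ, h0, h1⟩ := ih
      obtain ⟨κ', h0', h1'⟩ := one (M + 1)
      refine ⟨min κ κ', lt_min h0 h0', fun i hi c hc => ?_⟩
      rcases hi.eq_or_lt with rfl | hi
      · exact (min_le_right _ _).trans (h1' c hc)
      · exact (min_le_left _ _).trans (h1 i (by omega) c hc)
  have hsep : ∀ n : ℕ, ∀ c ∈ L, κ ≤ dist (f^[n] c.1) (f^[n] c.2) := by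
    intro n
    induction n using Nat.strong_induction_on with
    | _ n ih =>
      intro c hc
      rcases le_or_gt n N with h | h
      · exact hκ' n h c hc
      · obtain ⟨m, hm, hm'⟩ := hN c hc
        have := ih (n - (m + 1)) (by omega) (f^[m + 1] c.1, f^[m + 1] c.2)
          ⟨hinvn _ _ _ hc.1, hm'.le⟩
        simp only [← Function.iterate_add_apply] at this
        rwa [show n - (m + 1) + (m + 1) = n by omega] at this
  have hev : ∀ a ∈ S, ∀ b ∈ S, a ≠ b → ∃ n₀, ∀ n ≥ n₀, κ ≤ dist (f^[n] a) (f^[n] b) := by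
    intro a ha b hb hab
    obtain ⟨n₀, h₀⟩ := hexp a b hab
    refine ⟨n₀, fun n hn => ?_⟩
    have := hsep (n - n₀) (f^[n₀] a, f^[n₀] b) ⟨hinvn _ _ _ (hS a ha b hb), h₀.le⟩
    simp only [← Function.iterate_add_apply] at this
    rwa [Nat.sub_add_cancel hn] at this
  by_contra hinf
  obtain ⟨t, ht, hcov⟩ :=
    (Metric.totallyBounded_iff.mp (isCompact_univ (X := X)).totallyBounded) (κ / 2) (by linarith)
  obtain ⟨T, hTS, hT⟩ := Set.Infinite.exists_subset_card_eq hinf (ht.toFinset.card + 1)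
  classical
  choose! n₀ hn₀ using hev
  let n := (T ×ˢ T).sup fun c => n₀ c.1 c.2
  have hcov' : ∀ a : X, ∃ y ∈ ht.toFinset, dist (f^[n] a) y < κ / 2 := by
    intro a
    obtain ⟨y, hy, hy'⟩ := Set.mem_iUnion₂.mp (hcov (Set.mem_univ (f^[n] a)))
    exact ⟨y, ht.mem_toFinset.mpr hy, hy'⟩
  choose y hy hy' using hcov'
  obtain ⟨a, ha, b, hb, hab, e⟩ := Finset.exists_ne_map_eq_of_card_lt_of_maps_to
    (by rw [hT]; exact Nat.lt_succ_self _) (fun a (_ : a ∈ T) => hy a)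
  have h1 := hn₀ a (hTS ha) b (hTS hb) hab n
    (Finset.le_sup (f := fun c : X × X => n₀ c.1 c.2) (Finset.mk_mem_product ha hb))
  have h2 := hy' a
  have h3 := hy' b
  rw [← e, dist_comm] at h3
  have := dist_triangle (f^[n] a) (y a) (f^[n] b)
  linarith

/-! ### Covering by the translates of the closure of `R` -/

/-- The geodesic through a point with a given ideal endpoint is unique. -/
theorem eq_of_mem_geodesics {u v w : Circle} (hu : u ≠ w) (hv : v ≠ w) {z : ClosedDisk}
    (h1 : z ∈ geodesic s(u, w)) (h2 : z ∈ geodesic s(v, w)) : u = v := by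
  by_contra huv
  have key : ∀ a b : Circle, ccw a b w → z ∈ geodesic s(a, w) → z ∈ geodesic s(b, w) → False := by
    intro a b h ha hb
    obtain ⟨X, hN, e0, e1, e2, e3⟩ := exists_triangle h
    rw [← e1, ← e2] at hb
    rw [Sym2.eq_swap] at ha
    have h1 := ha.2
    rw [← e2, ← e3] at h1
    have := X.side_neg_of_mem_geodesic (i := 2) (j := 1) (by omega) (by omega) (by omega) hb
    linarith
  rcases ccw_total huv hu hv with h | h
  · exact key u v h h1 h2
  · exact key v u (ccw_rotate (ccw_rotate h)) h2 h1

/-- The arcs over two intersecting half-planes overlap. -/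
theorem exists_ccw_of_side_pos {p q r s : Circle} {z : ClosedDisk} (hz : z ∈ openDisk)
    (h1 : 0 < side p q z) (h2 : 0 < side r s z) : ∃ v, ccw p v q ∧ ccw r v s := by
  have hpq : p ≠ q := by
    rintro rfl
    have := side_swap p p z
    linarith
  obtain ⟨u, hpu, hzu⟩ := exists_geodesic_through p hz
  obtain ⟨a, a0, a1, e⟩ := (mem_geodesic_iff hpu).mp hzu
  rw [side_pos_iff, e, chord_combo _ _ _ _ _ _ (by ring)] at h1 h2
  rw [chord_left, mul_zero, zero_add] at h1
  have hu : ccw p u q := by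
    unfold ccw
    by_contra hc
    push Not at hc
    nlinarith
  by_cases h3 : 0 < chord r s u
  · exact ⟨u, hu, h3⟩
  · push Not at h3
    have h4 : 0 < chord r s p := by
      by_contra hc
      push Not at hc
      nlinarith
    obtain ⟨α, rfl⟩ := Circle.exp_surjective p
    obtain ⟨β, b1, b2, rfl⟩ := exists_angle_of_ne hpq.symm
    have hopen : IsOpen {v : Circle | ccw r v s} :=
      isOpen_lt continuous_const ((continuous_chord _ _).comp continuous_subtype_val)
    have hlim : Tendsto (fun t => Circle.exp t) (𝓝[>] α) (𝓝 (Circle.exp α)) :=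
      (Circle.exp.continuous.tendsto α).mono_left nhdsWithin_le_nhds
    obtain ⟨t, ht, t1, t2⟩ := ((hlim.eventually (hopen.mem_nhds h4)).and
      (Ioo_mem_nhdsGT b1)).exists
    exact ⟨Circle.exp t, ccw_exp t1 t2 b2, ht⟩

theorem infinite_circle : Set.Infinite (Set.univ : Set Circle) := by
  have h1 : Set.InjOn (fun t : ℝ => Circle.exp t) (Set.Ioo 0 1) := by
    intro a ha b hb e
    have hpi := Real.pi_gt_three
    rcases lt_trichotomy a b with h | h | h
    · exact absurd e (exp_ne_exp h (by linarith [ha.1, hb.2]))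
    · exact h
    · exact absurd e.symm (exp_ne_exp h (by linarith [hb.1, ha.2]))
  exact ((Set.Ioo_infinite (zero_lt_one (α := ℝ))).image h1).mono (Set.subset_univ _)

namespace PiecewiseMobius

variable {P : PiecewiseMobius}

theorem isClosed_arc (j : ℤ) : IsClosed (P.arc j) :=
  (isCompact_Icc.image Circle.exp.continuous).isClosed

/-- If the image of the half-plane over the arc `i` meets the half-plane over the arc `j`, then by
the Markov property the image of the arc `i` covers the arc `j`. -/
theorem arc_subset_image (hk : 3 ≤ P.k) (hM : P.IsMarkov) {i j : ℤ} {w : ClosedDisk}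
    (hw : w ∈ openDisk) (h1 : 0 < side (P.x i) (P.x (i + 1)) w)
    (h2 : 0 < side (P.x j) (P.x (j + 1)) ((P.g i).1 w)) :
    P.arc j ⊆ onCircle (P.g i) '' P.arc i := by
  rw [← side_onCircle_pos (P.g i)] at h1
  obtain ⟨v, v1, v2⟩ := exists_ccw_of_side_pos ((apply_mem_openDisk _).mpr hw) h1 h2
  obtain ⟨u, rfl⟩ : ∃ u, onCircle (P.g i) u = v := ⟨_, onCircle_apply_inv (P.g i) v⟩
  rw [ccw_onCircle] at v1
  have hu : u ∈ P.arc i := (mem_arc_iff hk).mpr (Or.inr (Or.inr v1))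
  have h3 := hM i j ⟨onCircle (P.g i) u, ⟨u, (mem_arcInt_iff hk).mpr v1, A_arc hu⟩,
    (mem_arcInt_iff hk).mpr v2⟩
  have h4 : P.arcInt j ⊆ onCircle (P.g i) '' P.arc i := by
    intro p hp
    obtain ⟨q, hq, rfl⟩ := h3 hp
    have hq' : q ∈ P.arc i := (mem_arc_iff hk).mpr (Or.inr (Or.inr ((mem_arcInt_iff hk).mp hq)))
    exact ⟨q, hq', (A_arc hq').symm⟩
  have h5 : IsClosed (onCircle (P.g i) '' P.arc i) :=
    ((isCompact_Icc.image Circle.exp.continuous).image (continuous_onCircle _)).isClosed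
  have h6 : P.arc j ⊆ closure (P.arcInt j) := by
    unfold arc arcInt
    rw [← closure_Ioo (P.θ_strictMono (show j < j + 1 by omega)).ne]
    exact image_closure_subset_closure_image Circle.exp.continuous
  exact h6.trans (h5.closure_subset_iff.mpr h4)

namespace StandingAssumptions

variable (H : P.StandingAssumptions)
include H

/-- Every point of the disk is equivalent to a point of the closure of `R`. Otherwise, the images
of the point under the pieces of the map run through half-planes over arcs forever. The pull-backs
of these arcs are nested, and each of them contains an endpoint of every geodesic through the point;
so infinitely many points of the circle would have the same itinerary. -/
theorem exists_mem_closure_R (hA : Continuous P.A) {z : ClosedDisk} (hz : z ∈ openDisk) :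
    ∃ h ∈ P.group, h.1 z ∈ closure P.R := by
  have hk := H.three_le
  by_contra hcon
  push Not at hcon
  have hside : ∀ h : P.group, ∃ i : ℕ, i < P.k ∧ 0 < side (P.x i) (P.x (i + 1)) (h.1.1 z) := by
    intro h
    by_contra hc
    push Not at hc
    refine hcon h.1 h.2 ?_
    rw [closure_R hk 0]
    intro i hi
    rw [polygon_v, polygon_v_succ, zero_add]
    exact hc i hi
  choose J hJk hJ using hside
  let step : P.group → P.group := fun h => ⟨P.g (J h), g_mem _⟩ * h
  obtain ⟨h, h0, hs⟩ : ∃ h : ℕ → P.group, h 0 = 1 ∧ ∀ n, h (n + 1) = step (h n) :=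
    ⟨fun n => step^[n] 1, rfl, fun n => Function.iterate_succ_apply' step n 1⟩
  have hs' : ∀ n y, onCircle (h (n + 1)).1 y = onCircle (P.g (J (h n))) (onCircle (h n).1 y) := by
    intro n y
    rw [hs, ← onCircle_mul]
    rfl
  have hsz : ∀ n, (h (n + 1)).1.1 z = (P.g (J (h n))).1 ((h n).1.1 z) := by
    intro n
    rw [hs]
    rfl
  have hnest : ∀ n y, onCircle (h (n + 1)).1 y ∈ P.arc (J (h (n + 1))) →
      onCircle (h n).1 y ∈ P.arc (J (h n)) := by
    intro n y hy
    have h2 := hJ (h (n + 1))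
    rw [hsz] at h2
    obtain ⟨q, hq, e⟩ := arc_subset_image hk H.markov ((apply_mem_openDisk _).mpr hz)
      (hJ (h n)) h2 hy
    rw [hs'] at e
    rwa [← onCircle_injective _ e]
  have hnest' : ∀ n m, m ≤ n → ∀ y, onCircle (h n).1 y ∈ P.arc (J (h n)) →
      onCircle (h m).1 y ∈ P.arc (J (h m)) := by
    intro n m hmn y
    induction n, hmn using Nat.le_induction with
    | base => exact id
    | succ n _ ih => exact fun hy => ih (hnest n y hy)
  let S : Set Circle := {y | ∀ n, onCircle (h n).1 y ∈ P.arc (J (h n))}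
  have hit : ∀ y ∈ S, ∀ n, P.A^[n] y = onCircle (h n).1 y := by
    intro y hy n
    induction n with
    | zero =>
      rw [h0]
      exact (onCircle_one y).symm
    | succ n ih => rw [Function.iterate_succ_apply', ih, A_arc (hy n), hs']
  have hfin : S.Finite := by
    obtain ⟨δ, hδ, hexp⟩ := H.expansive
    let K : Set (Circle × Circle) :=
      ⋂ n : ℕ, ⋃ j ∈ Finset.range P.k, {c | P.A^[n] c.1 ∈ P.arc (j : ℕ) ∧ P.A^[n] c.2 ∈ P.arc (j : ℕ)}
    have hKmem : ∀ a b, (a, b) ∈ K ↔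
        ∀ n : ℕ, ∃ j < P.k, P.A^[n] a ∈ P.arc (j : ℕ) ∧ P.A^[n] b ∈ P.arc (j : ℕ) := by
      intro a b
      simp only [K, Set.mem_iInter, Set.mem_iUnion, Finset.mem_range, exists_prop]
      rfl
    refine finite_of_expansive (K := K) hA ?_ ?_ ?_ hexp ?_ hδ
    · refine isClosed_iInter fun n => isClosed_biUnion_finset fun j _ => IsClosed.and ?_ ?_
      · exact (isClosed_arc _).preimage ((hA.iterate n).comp continuous_fst)
      · exact (isClosed_arc _).preimage ((hA.iterate n).comp continuous_snd)
    · intro a b hab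
      rw [hKmem] at hab ⊢
      exact fun n => hab (n + 1)
    · intro a b hab e
      rw [hKmem] at hab
      obtain ⟨j, -, ha, hb⟩ := hab 0
      exact A_injOn_arc _ ha hb e
    · intro a ha b hb
      rw [hKmem]
      intro n
      refine ⟨J (h n), hJk _, ?_, ?_⟩
      · rw [hit a ha]; exact ha n
      · rw [hit b hb]; exact hb n
  choose ι hne hι using fun u => exists_geodesic_through u hz
  have hor : ∀ u, u ∈ S ∨ ι u ∈ S := by
    intro u
    by_contra hc
    push Not at hc
    obtain ⟨c1, c2⟩ := hc
    have c1' : ∃ n, onCircle (h n).1 u ∉ P.arc (J (h n)) := by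
      by_contra hc
      push Not at hc
      exact c1 hc
    have c2' : ∃ n, onCircle (h n).1 (ι u) ∉ P.arc (J (h n)) := by
      by_contra hc
      push Not at hc
      exact c2 hc
    obtain ⟨n, hn⟩ := c1'
    obtain ⟨m, hm⟩ := c2'
    have d1 : onCircle (h (max n m)).1 u ∉ P.arc (J (h (max n m))) := fun hc =>
      hn (hnest' _ _ (le_max_left n m) _ hc)
    have d2 : onCircle (h (max n m)).1 (ι u) ∉ P.arc (J (h (max n m))) := fun hc =>
      hm (hnest' _ _ (le_max_right n m) _ hc)
    have e1 := (apply_mem_geodesic (h (max n m)).1).mpr (hι u)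
    obtain ⟨a, a0, a1, e⟩ :=
      (mem_geodesic_iff fun e => hne u (onCircle_injective _ e)).mp e1
    have e2 := hJ (h (max n m))
    rw [side_pos_iff, e, chord_combo _ _ _ _ _ _ (by ring)] at e2
    have e3 : ∀ y, y ∉ P.arc (J (h (max n m))) →
        chord (P.x (J (h (max n m)))) (P.x (J (h (max n m)) + 1)) y ≤ 0 := by
      intro y hy
      by_contra hc
      push Not at hc
      exact hy ((mem_arc_iff hk).mpr (Or.inr (Or.inr hc)))
    have e4 := e3 _ d1
    have e5 := e3 _ d2
    nlinarith
  have hinj : Function.Injective ι := by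
    intro u v e
    have h2 := hι v
    have h3 := hne v
    rw [← e] at h2 h3
    exact eq_of_mem_geodesics (hne u) h3 (hι u) h2
  refine infinite_circle ((hfin.union (hfin.preimage hinj.injOn)).subset fun u _ => hor u)

end StandingAssumptions

end PiecewiseMobius

end Mating

namespace Mating

/-! ### Fundamental polygons with mirror-symmetric side pairing -/

/-- An ideal polygon with `2 n ≥ 4` sides and a pairing of the side number `t` with the side number
`2 n - 1 - t`, for `t < n`, by the element `h t` of `Γ`, such that the translates of the polygon
under `Γ` tile the disk. -/
structure FoldedPolygon (Γ : Subgroup diskAut) where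
  X : IdealPolygon
  n : ℕ
  two_le : 2 ≤ n
  N_eq : X.N = 2 * n
  h : ℕ → diskAut
  h_mem : ∀ t < n, h t ∈ Γ
  h_left : ∀ t < n, onCircle (h t) (X.v t) = X.v (2 * n - t)
  h_right : ∀ t < n, onCircle (h t) (X.v (t + 1)) = X.v (2 * n - 1 - t)
  tile : ∀ g ∈ Γ, ∀ z ∈ X.inner, g.1 z ∈ X.inner → g = 1
  cover : ∀ z ∈ openDisk, ∃ g ∈ Γ, g.1 z ∈ X.outer

namespace PiecewiseMobius

variable {P : PiecewiseMobius}

namespace StandingAssumptions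

variable (H : P.StandingAssumptions)
include H

/-- If all edges are mapped to edges, then `R` is a fundamental polygon. -/
theorem exists_foldedPolygon_of_isEdge_map (hA : Continuous P.A)
    (hE : ∀ e, P.IsEdge e → P.IsEdge (e.map P.A)) : Nonempty (FoldedPolygon P.group) := by
  have hk := H.three_le
  obtain ⟨p, n, hn, hp⟩ := H.exists_reflection hE
  refine ⟨{ X := P.polygon hk p, n := n, two_le := by omega, N_eq := hn,
            h := fun t => P.g (p + t), h_mem := fun t _ => g_mem _, h_left := ?_, h_right := ?_,
            tile := ?_, cover := ?_ }⟩
  · intro t ht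
    rw [polygon_v, polygon_v, ← A_x, hp, ← x_add_k]
    congr 1
    omega
  · intro t ht
    rw [polygon_v_succ, polygon_v, ← A_x_succ, add_assoc, hp, ← x_add_k]
    congr 1
    omega
  · intro g hg z hz hz'
    rw [← R_eq hk] at hz hz'
    exact H.eq_one_of_mem_R hE hg hz hz'
  · intro z hz
    rw [← closure_R hk]
    exact H.exists_mem_closure_R hA hz

/-- If all edges reach diagonals, then a fundamental polygon is spanned by the vertices of a chain
all edges of which are mapped to diagonals, and by the images of these vertices. -/
theorem exists_foldedPolygon_of_hits (hA : Continuous P.A)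
    (hall : ∀ e, P.IsEdge e → P.Hits e) : Nonempty (FoldedPolygon P.group) := by
  have hk := H.three_le
  obtain ⟨w, hw⟩ : ∃ w : ℤ, P.FixedAt w := by
    obtain ⟨r, hr, -, -⟩ := H.exists_third hall (P.x 0) (P.x 0)
    obtain ⟨w, rfl⟩ := hr.1
    exact ⟨w, hr.2⟩
  obtain ⟨p, q, ζ, hq, z0, zq, zlt, zA, zfix, hdiag⟩ := H.exists_fan hall hw
  have zanti : StrictAnti ζ := strictAnti_nat_of_succ_lt zlt
  have hqk : (q : ℤ) < P.k := by
    have := zanti (show 0 < q by omega)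
    omega
  let idx : ℕ → ℤ := fun i => if i ≤ q then p + i else ζ (2 * q - i)
  have idx1 : ∀ i ≤ q, idx i = p + i := fun i hi => if_pos hi
  have idx2 : ∀ i, q ≤ i → idx i = ζ (2 * q - i) := by
    intro i hi
    rcases hi.eq_or_lt with rfl | hi
    · rw [idx1 q le_rfl, show 2 * q - q = q by omega, zq]
    · exact if_neg (by omega)
  have mono : ∀ i j, i < j → j ≤ 2 * q → idx i < idx j := by
    intro i j hij hj
    rcases le_total j q with h | h
    · rw [idx1 i (by omega), idx1 j h]
      omega
    · rw [idx2 j h]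
      rcases le_total i q with h' | h'
      · rw [idx1 i h']
        have h1 : ζ q ≤ ζ (2 * q - j) := zanti.antitone (by omega)
        rcases h'.eq_or_lt with rfl | h'
        · rw [← zq]
          exact zanti (by omega)
        · omega
      · rw [idx2 i h']
        exact zanti (by omega)
  have hc : idx (2 * q) = idx 0 + P.k := by
    rw [idx2 _ (by omega), idx1 0 (by omega), Nat.sub_self, z0]
    simp
  obtain ⟨X, hX⟩ : ∃ X, X = subPolygon (P := P) (2 * q) (by omega) idx mono hc := ⟨_, rfl⟩
  have hXN : X.N = 2 * q := by rw [hX]; rfl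
  have v1 : ∀ i ≤ q, X.v i = P.x (p + i) := by
    intro i hi
    rw [hX, subPolygon_v, idx1 i hi]
  have v2 : ∀ i, q ≤ i → X.v i = P.x (ζ (2 * q - i)) := by
    intro i hi
    rw [hX, subPolygon_v, idx2 i hi]
  have hXR : X.inner ⊆ P.R := hX ▸ subPolygon_inner_subset hk
  have gl : ∀ t < q, onCircle (P.g (p + t)) (P.x (p + t)) = P.x (ζ t) := by
    intro t ht
    rw [← A_x, zA t ht.le]
  have gr : ∀ t < q, onCircle (P.g (p + t)) (P.x (p + t + 1)) = P.x (ζ (t + 1)) := by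
    intro t ht
    rw [← A_x_succ, ← zA (t + 1) ht]
    push_cast
    rw [add_assoc]
  have gmap : ∀ t < q, s(P.x (p + t), P.x (p + t + 1)).map (onCircle (P.g (p + t)))
      = s(P.x (ζ t), P.x (ζ (t + 1))) := by
    intro t ht
    rw [Sym2.map_mk, gl t ht, gr t ht]
  have sideE : ∀ i < X.N, s(X.v i, X.v (i + 1)) = s(P.x (p + i), P.x (p + i + 1)) ∧ i < q ∨
      ∃ t < q, i = 2 * q - 1 - t ∧ X.v i = P.x (ζ (t + 1)) ∧ X.v (i + 1) = P.x (ζ t) := by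
    intro i hi
    rw [hXN] at hi
    rcases lt_or_ge i q with h | h
    · left
      rw [v1 i h.le, v1 (i + 1) h]
      push_cast
      rw [add_assoc]
      exact ⟨rfl, h⟩
    · right
      refine ⟨2 * q - 1 - i, by omega, by omega, ?_, ?_⟩
      · rw [v2 i h]
        congr 2
        omega
      · rw [v2 (i + 1) (by omega)]
        congr 2
        omega
  have sideE2 : ∀ i < X.N, ∃ t < q, ∃ g ∈ P.group, s(X.v i, X.v (i + 1)) ∈ P.edgeOrbits ∧
      s(P.x (ζ t), P.x (ζ (t + 1))) = s(X.v i, X.v (i + 1)).map (onCircle g) := by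
    intro i hi
    rcases sideE i hi with ⟨e, h⟩ | ⟨t, ht, -, e1, e2⟩
    · exact ⟨i, h, _, g_mem (p + i), by rw [e]; exact mem_edgeOrbits_of_isEdge (isEdge_x hk _),
        by rw [e, gmap i h]⟩
    · refine ⟨t, ht, 1, P.group.one_mem, ?_, ?_⟩
      · rw [e1, e2, Sym2.eq_swap, ← gmap t ht]
        exact map_mem_edgeOrbits (mem_edgeOrbits_of_isEdge (isEdge_x hk _)) (g_mem _)
      · rw [map_onCircle_one, e1, e2, Sym2.eq_swap]
  -- a translate of a side entering `R` is one of the sides of the polygon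
  have hside : ∀ g ∈ P.group, ∀ i < X.N, ∀ z ∈ P.R,
      z ∈ geodesic s(onCircle g (X.v i), onCircle g (X.v (i + 1))) →
      ∃ l < X.N, z ∈ geodesic s(X.v l, X.v (l + 1)) := by
    intro g hg i hi z hz hzg
    obtain ⟨t, ht, g', hg', hE, e⟩ := sideE2 i hi
    have hb := map_mem_edgeOrbits hE hg
    rw [Sym2.map_mk] at hb
    obtain ⟨d1, -⟩ := H.isDiagonal_of_mem_R hb hz hzg
    have e2 : s(P.x (ζ t), P.x (ζ (t + 1)))
        = s(onCircle g (X.v i), onCircle g (X.v (i + 1))).map (onCircle (g' * g⁻¹)) := by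
      have e1 : s(onCircle g (X.v i), onCircle g (X.v (i + 1)))
          = s(X.v i, X.v (i + 1)).map (onCircle g) := rfl
      rw [e, e1, map_onCircle_mul, map_onCircle_inv]
    have e3 := H.eq_of_isDiagonal d1 (hdiag t ht) hb
      (P.group.mul_mem hg' (P.group.inv_mem hg)) e2
    refine ⟨2 * q - 1 - t, by omega, ?_⟩
    rw [v2 _ (by omega), v2 _ (by omega), show 2 * q - (2 * q - 1 - t) = t + 1 by omega,
      show 2 * q - (2 * q - 1 - t + 1) = t by omega, Sym2.eq_swap, e3]
    exact hzg
  have hnotin : ∀ z ∈ X.inner, ∀ l < X.N, z ∉ geodesic s(X.v l, X.v (l + 1)) := by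
    intro z hz l hl hzl
    have := hz.2 l hl
    have := hzl.2
    linarith
  have hcover : ∀ z ∈ openDisk, ∃ g ∈ P.group, g.1 z ∈ X.outer := by
    intro z hz
    obtain ⟨h, hh, hw⟩ := H.exists_mem_closure_R hA hz
    obtain ⟨w, hwdef⟩ : ∃ w, w = h.1 z := ⟨_, rfl⟩
    have hwD : w ∈ openDisk := by rw [hwdef]; exact (apply_mem_openDisk h).mpr hz
    rw [← hwdef] at hw
    suffices ∃ g ∈ P.group, g.1 w ∈ X.outer by
      obtain ⟨g, hg, hgw⟩ := this
      exact ⟨g * h, P.group.mul_mem hg hh, by rw [hwdef] at hgw; exact hgw⟩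
    by_cases hout : w ∈ X.outer
    · exact ⟨1, P.group.one_mem, hout⟩
    have hout' : ∃ i < X.N, 0 < side (X.v i) (X.v (i + 1)) w := by
      by_contra hc
      push Not at hc
      exact hout hc
    obtain ⟨i, hi, hpos⟩ := hout'
    rcases sideE i hi with ⟨e, h⟩ | ⟨t, ht, hit, e1, e2⟩
    · exfalso
      rw [closure_R hk p] at hw
      have h1 := hw i (by change i < P.k; omega)
      rw [polygon_v, polygon_v_succ] at h1
      rw [v1 i h.le, v1 (i + 1) h] at hpos
      push_cast at hpos
      rw [← add_assoc] at hpos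
      linarith
    -- the part of `R` beyond the side `i` is covered by the translate of the polygon across it
    obtain ⟨g, hgdef⟩ : ∃ g, g = P.g (p + t) := ⟨_, rfl⟩
    have hg : g ∈ P.group := hgdef ▸ g_mem _
    have gv1 : onCircle g (X.v t) = X.v (i + 1) := by rw [hgdef, v1 t ht.le, gl t ht, e2]
    have gv2 : onCircle g (X.v (t + 1)) = X.v i := by
      rw [hgdef, v1 (t + 1) ht, e1, ← gr t ht]
      push_cast
      rw [add_assoc]
    refine ⟨g⁻¹, P.group.inv_mem hg, ?_⟩
    have htN : t < X.N := by omega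
    obtain ⟨z₀, hz₀, hz₀R, hz₀i⟩ : ∃ z₀, (g⁻¹).1 z₀ ∈ X.inner ∧ z₀ ∈ P.R ∧
        0 < side (X.v i) (X.v (i + 1)) z₀ := by
      obtain ⟨y, hy⟩ := exists_mem_geodesic (X.v_ne_succ htN)
      have hgy : g.1 y ∈ geodesic s(X.v (i + 1), X.v i) := by
        rw [← gv1, ← gv2]
        exact (apply_mem_geodesic g).mpr hy
      have hfd := H.fixed_of_isDiagonal (by
        rw [← gmap t ht]
        exact map_mem_edgeOrbits (mem_edgeOrbits_of_isEdge (isEdge_x hk _)) (g_mem _)) (hdiag t ht)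
      have hgyR : g.1 y ∈ P.R := by
        rw [e1, e2] at hgy
        refine H.innerDomainClosure_subset_R (H.geodesic_subset_of_isDiagonal hall (hdiag t ht)
          (fun r hr => ?_) hgy)
        rcases Sym2.mem_iff.mp hr with rfl | rfl
        · exact hfd.1
        · exact hfd.2
      have hRopen : IsOpen P.R := by
        rw [R_eq hk 0]
        exact (P.polygon hk 0).isOpen_inner
      have n1 := X.eventually_mem_inner htN hy
      have n2 := g.1.continuous.continuousAt.eventually (hRopen.mem_nhds hgyR)
      obtain ⟨y', ⟨m1, m2⟩, m3⟩ := exists_side_neg (X.v_ne_succ htN) hy (n1.and n2)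
      refine ⟨g.1 y', by rw [inv_apply_apply]; exact m1 m3, m2, ?_⟩
      rw [side_swap, neg_pos, ← gv1, ← gv2]
      exact (side_onCircle_neg g).mpr m3
    have hopenpart : ∀ y ∈ P.R, 0 < side (X.v i) (X.v (i + 1)) y → (g⁻¹).1 y ∈ X.inner := by
      intro y hy hyi
      refine ⟨(apply_mem_openDisk _).mpr hy.1, fun l hl => ?_⟩
      by_contra hc
      push Not at hc
      have h2 : ∀ u, side (X.v l) (X.v (l + 1)) ((g⁻¹).1 u) =
          side (onCircle g⁻¹ (onCircle g (X.v l))) (onCircle g⁻¹ (onCircle g (X.v (l + 1))))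
            ((g⁻¹).1 u) := by
        intro u
        rw [onCircle_inv_apply, onCircle_inv_apply]
      have h3 := hz₀.2 l hl
      rw [h2, side_onCircle_neg] at h3
      rw [h2, side_onCircle_nonneg] at hc
      have hex : ∃ u ∈ P.R, 0 < side (X.v i) (X.v (i + 1)) u ∧
          side (onCircle g (X.v l)) (onCircle g (X.v (l + 1))) u = 0 := by
        rcases hc.lt_or_eq with hc | hc
        · obtain ⟨a, a0, a1, ha⟩ := exists_between_side_eq_zero hc h3
          refine ⟨between y z₀ a, ?_, ?_, ha⟩
          · rw [R_eq hk 0] at hy hz₀R ⊢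
            exact (P.polygon hk 0).between_mem_inner
              ((P.polygon hk 0).inner_subset_outer hy) hz₀R a0 a1.le
          · rw [side_pos_iff] at hyi hz₀i ⊢
            rw [chord_between _ _ a0.le a1.le]
            nlinarith
        · exact ⟨y, hy, hyi, hc.symm⟩
      obtain ⟨u, hu, hui, hu0⟩ := hex
      obtain ⟨m, hm, hum⟩ := hside g hg l hl u hu ⟨hu.1, hu0⟩
      by_cases him : i = m
      · subst him
        have := hum.2
        linarith
      · have := X.side_neg_of_mem_geodesic hi hm him hum
        linarith
    obtain ⟨y₁, hy₁⟩ := X.inner_nonempty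
    have hlim := tendsto_between w y₁
    have hlim2 := ((g⁻¹).1.continuous.tendsto w).comp hlim
    refine X.isClosed_outer.mem_of_tendsto hlim2 ?_
    have hev : ∀ᶠ y in 𝓝 w, 0 < side (X.v i) (X.v (i + 1)) y :=
      (isOpen_lt continuous_const (continuous_side _ _)).mem_nhds hpos
    filter_upwards [hlim.eventually hev, Ioo_mem_nhdsGT one_pos] with a ha ha'
    refine X.inner_subset_outer (hopenpart _ ?_ ha)
    have h4 := hXR hy₁
    rw [closure_R hk 0] at hw
    rw [R_eq hk 0] at h4 ⊢
    exact (P.polygon hk 0).between_mem_inner hw h4 ha'.1 ha'.2.le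
  refine ⟨{ X := X, n := q, two_le := hq, N_eq := hXN, h := fun t => P.g (p + t),
            h_mem := fun t _ => g_mem _, h_left := ?_, h_right := ?_, tile := ?_,
            cover := hcover }⟩
  · intro t ht
    rw [v1 t ht.le, gl t ht, v2 _ (by omega)]
    congr 2
    omega
  · intro t ht
    rw [v1 (t + 1) ht, v2 _ (by omega), show 2 * q - (2 * q - 1 - t) = t + 1 by omega, ← gr t ht]
    push_cast
    rw [add_assoc]
  · intro g hg z hz hz'
    refine X.eq_one_of_mem_inner H.torsionFree (fun g hg i hi z hz hzg => ?_) hg hz hz'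
    obtain ⟨l, hl, hzl⟩ := hside g hg i hi z (hXR hz) hzg
    exact hnotin z hz l hl hzl

end StandingAssumptions

end PiecewiseMobius

end Mating

namespace Mating

/-! ### The quotient of the disk as a glued polygon -/

namespace FoldedPolygon

variable {Γ : Subgroup diskAut} (F : FoldedPolygon Γ)

/-- The element of `Γ` pairing the side number `i` with the side number `2 n - 1 - i`. -/
def pairing (i : ℕ) : diskAut := if i < F.n then F.h i else (F.h (2 * F.n - 1 - i))⁻¹

theorem pairing_mem {i : ℕ} (hi : i < F.X.N) : F.pairing i ∈ Γ := by
  have := F.N_eq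
  unfold pairing
  split_ifs with h
  · exact F.h_mem i h
  · exact Γ.inv_mem (F.h_mem _ (by omega))

theorem pairing_left {i : ℕ} (hi : i < F.X.N) :
    onCircle (F.pairing i) (F.X.v i) = F.X.v (2 * F.n - 1 - i + 1) := by
  have := F.N_eq
  unfold pairing
  split_ifs with h
  · rw [F.h_left i h]
    congr 1
    omega
  · have h1 := F.h_right (2 * F.n - 1 - i) (by omega)
    rw [show 2 * F.n - 1 - (2 * F.n - 1 - i) = i by omega] at h1
    rw [← h1, onCircle_inv_apply]

theorem pairing_right {i : ℕ} (hi : i < F.X.N) :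
    onCircle (F.pairing i) (F.X.v (i + 1)) = F.X.v (2 * F.n - 1 - i) := by
  have := F.N_eq
  unfold pairing
  split_ifs with h
  · exact F.h_right i h
  · have h1 := F.h_left (2 * F.n - 1 - i) (by omega)
    rw [show 2 * F.n - (2 * F.n - 1 - i) = i + 1 by omega] at h1
    rw [← h1, onCircle_inv_apply]

/-- The pairing of a side maps the part of a neighbourhood of a point of the side outside of the
polygon to the interior of the polygon. -/
theorem eventually_pairing_mem_inner {i : ℕ} (hi : i < F.X.N) {z : ClosedDisk}
    (hz : z ∈ geodesic s(F.X.v i, F.X.v (i + 1))) :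
    ∀ᶠ w in 𝓝 z, 0 < side (F.X.v i) (F.X.v (i + 1)) w → (F.pairing i).1 w ∈ F.X.inner := by
  have hN := F.N_eq
  have h1 := (apply_mem_geodesic (F.pairing i)).mpr hz
  rw [F.pairing_left hi, F.pairing_right hi, Sym2.eq_swap] at h1
  have h2 := (F.pairing i).1.continuous.continuousAt.eventually
    (F.X.eventually_mem_inner (show 2 * F.n - 1 - i < F.X.N by omega) h1)
  filter_upwards [h2] with w hw hpos
  apply hw
  rw [side_swap, neg_lt_zero, ← F.pairing_left hi, ← F.pairing_right hi]
  exact (side_onCircle_pos _).mpr hpos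

theorem exists_mem_geodesic_of_not_mem_inner {X : IdealPolygon} {z : ClosedDisk}
    (hz : z ∈ X.outer) (hzD : z ∈ openDisk) (hn : z ∉ X.inner) :
    ∃ i < X.N, z ∈ geodesic s(X.v i, X.v (i + 1)) := by
  by_contra hc
  push Not at hc
  exact hn ⟨hzD, fun i hi => lt_of_le_of_ne (hz i hi) fun e => hc i hi ⟨hzD, e⟩⟩

/-- Two points of the closed polygon in the same orbit are equal or correspond to each other under
the pairing of a side. -/
theorem eq_one_or_eq_pairing {g : diskAut} (hg : g ∈ Γ) {z : ClosedDisk} (hz : z ∈ F.X.outer)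
    (hzD : z ∈ openDisk) (hgz : g.1 z ∈ F.X.outer) :
    g = 1 ∨ ∃ i < F.X.N, z ∈ geodesic s(F.X.v i, F.X.v (i + 1)) ∧ g = F.pairing i := by
  -- points near `z` which `g` maps to the interior of the polygon
  have hex : ∀ U ∈ 𝓝 z, ∃ y ∈ interior U, g.1 y ∈ F.X.inner := by
    intro U hU
    rw [← F.X.closure_inner] at hgz
    obtain ⟨w, hw, hw'⟩ := mem_closure_iff.mp hgz (g.1 '' interior U)
      (g.1.isOpenMap _ isOpen_interior) ⟨z, mem_interior_iff_mem_nhds.mpr hU, rfl⟩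
    obtain ⟨y, hy, rfl⟩ := hw
    exact ⟨y, hy, hw'⟩
  by_cases hn : z ∈ F.X.inner
  · obtain ⟨y, hy, hgy⟩ := hex _ (F.X.isOpen_inner.mem_nhds hn)
    exact Or.inl (F.tile g hg y (interior_subset hy) hgy)
  · obtain ⟨i, hi, hzi⟩ := exists_mem_geodesic_of_not_mem_inner hz hzD hn
    obtain ⟨y, hy, hgy⟩ := hex _ ((F.X.eventually_mem_inner hi hzi).and
      (F.eventually_pairing_mem_inner hi hzi))
    have hpos : ∀ y, 0 < side (F.X.v i) (F.X.v (i + 1)) y → (F.pairing i).1 y ∈ F.X.inner →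
        g.1 y ∈ F.X.inner → g = F.pairing i := by
      intro y _ h1 h2
      have h3 := F.tile (g * (F.pairing i)⁻¹) (Γ.mul_mem hg (Γ.inv_mem (F.pairing_mem hi))) _ h1
        (by
          change g.1 (((F.pairing i)⁻¹).1 ((F.pairing i).1 y)) ∈ F.X.inner
          rwa [inv_apply_apply])
      exact mul_inv_eq_one.mp h3
    rcases lt_trichotomy (side (F.X.v i) (F.X.v (i + 1)) y) 0 with h | h | h
    · exact Or.inl (F.tile g hg y ((interior_subset hy).1 h) hgy)
    · have hyD : y ∈ openDisk := (apply_mem_openDisk g).mp hgy.1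
      have hO : IsOpen (interior {y | (side (F.X.v i) (F.X.v (i + 1)) y < 0 → y ∈ F.X.inner) ∧
          (0 < side (F.X.v i) (F.X.v (i + 1)) y → (F.pairing i).1 y ∈ F.X.inner)} ∩
          g.1 ⁻¹' F.X.inner) :=
        isOpen_interior.inter (F.X.isOpen_inner.preimage g.1.continuous)
      obtain ⟨u, hu, hu'⟩ := exists_side_neg (F.X.v_ne_succ hi) ⟨hyD, h⟩
        (hO.mem_nhds ⟨hy, hgy⟩)
      exact Or.inl (F.tile g hg u ((interior_subset hu.1).1 hu') hu.2)
    · exact Or.inr ⟨i, hi, hzi, hpos y h ((interior_subset hy).2 h) hgy⟩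

/-- If a compact space is mapped onto the closed polygon and onto the sphere in such a way that the
fibres of the second map are those of the first one, up to the gluing of the sides, then the
quotient surface is a punctured sphere, the punctures being the images of the vertices. -/
theorem isPuncturedSphere_of_maps {Q : Type} [TopologicalSpace Q] [CompactSpace Q]
    {Θ : Q → ClosedDisk} {Ξ : Q → Sphere2} (hΘ : Continuous Θ) (hΞ : Continuous Ξ)
    (hrange : Set.range Θ = F.X.outer) (hsurj : Function.Surjective Ξ)
    (hfib : ∀ u u', Θ u = Θ u' → Ξ u = Ξ u')
    (hfib' : ∀ u u', Ξ u = Ξ u' → ∃ g ∈ Γ, g.1 (Θ u) = Θ u')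
    (hglue : ∀ t < F.n, ∀ u u', Θ u ∈ geodesic s(F.X.v t, F.X.v (t + 1)) →
      Θ u' = (F.h t).1 (Θ u) → Ξ u = Ξ u') : IsPuncturedSphere (QuotientSurface Γ) := by
  have hN := F.N_eq
  have hglue' : ∀ u u', Θ u ∈ openDisk → ∀ g ∈ Γ, g.1 (Θ u) = Θ u' → Ξ u = Ξ u' := by
    intro u u' hu g hg e
    have hu1 : Θ u ∈ F.X.outer := hrange ▸ Set.mem_range_self u
    have hu2 : g.1 (Θ u) ∈ F.X.outer := by rw [e]; exact hrange ▸ Set.mem_range_self u'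
    rcases F.eq_one_or_eq_pairing hg hu1 hu hu2 with rfl | ⟨i, hi, hzi, rfl⟩
    · exact hfib _ _ e
    · unfold pairing at e
      split_ifs at e with h
      · exact hglue i h u u' hzi e.symm
      · refine (hglue (2 * F.n - 1 - i) (by omega) u' u ?_ ?_).symm
        · have h1 := (apply_mem_geodesic (F.pairing i)).mpr hzi
          rw [F.pairing_left hi, F.pairing_right hi, Sym2.eq_swap] at h1
          rw [← e]
          rwa [pairing, if_neg h] at h1
        · rw [← e, apply_inv_apply]
  have hchoose : ∀ z : openDisk, ∃ g ∈ Γ, ∃ u, Θ u = g.1 z.1 := by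
    intro z
    obtain ⟨g, hg, h⟩ := F.cover z.1 z.2
    rw [← hrange] at h
    obtain ⟨u, hu⟩ := h
    exact ⟨g, hg, u, hu⟩
  choose γ hγ υ hυ using hchoose
  let f : openDisk → Sphere2 := fun z => Ξ (υ z)
  have hf : ∀ z : openDisk, ∀ g ∈ Γ, ∀ u, Θ u = g.1 z.1 → f z = Ξ u := by
    intro z g hg u hu
    refine hglue' _ _ ?_ (g * (γ z)⁻¹) (Γ.mul_mem hg (Γ.inv_mem (hγ z))) ?_
    · rw [hυ]
      exact (apply_mem_openDisk _).mpr z.2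
    · rw [hυ, hu]
      change g.1 (((γ z)⁻¹).1 ((γ z).1 z.1)) = _
      rw [inv_apply_apply]
  -- `f` is continuous on each translate of the closed polygon
  have hcl : ∀ g ∈ Γ, ContinuousOn f {z : openDisk | g.1 z.1 ∈ F.X.outer} := by
    intro g hg
    rw [continuousOn_iff_isClosed]
    intro C hC
    refine ⟨{z : openDisk | g.1 z.1 ∈ Θ '' (Ξ ⁻¹' C)}, ?_, ?_⟩
    · have h1 : IsClosed (Θ '' (Ξ ⁻¹' C)) := ((hC.preimage hΞ).isCompact.image hΘ).isClosed
      exact h1.preimage (g.1.continuous.comp continuous_subtype_val)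
    · ext z
      constructor
      · rintro ⟨h1, h2⟩
        refine ⟨?_, h2⟩
        have h3 : g.1 z.1 ∈ F.X.outer := h2
        rw [← hrange] at h3
        obtain ⟨u, hu⟩ := h3
        exact ⟨u, by rw [Set.mem_preimage, ← hf z g hg u hu]; exact h1, hu⟩
      · rintro ⟨⟨u, hu, hu'⟩, h2⟩
        exact ⟨by rw [Set.mem_preimage, hf z g hg u hu']; exact hu, h2⟩
  have hfc : Continuous f := by
    rw [continuous_iff_continuousAt]
    intro z
    obtain ⟨g, hg, h⟩ := F.cover z.1 z.2
    have hgc : Continuous fun w : openDisk => g.1 w.1 :=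
      g.1.continuous.comp continuous_subtype_val
    have hw : g.1 z.1 ∈ openDisk := (apply_mem_openDisk g).mpr z.2
    by_cases hn : g.1 z.1 ∈ F.X.inner
    · refine (hcl g hg).continuousAt ?_
      filter_upwards [(F.X.isOpen_inner.preimage hgc).mem_nhds hn] with w hw
      exact F.X.inner_subset_outer hw
    · obtain ⟨i, hi, hzi⟩ := exists_mem_geodesic_of_not_mem_inner h hw hn
      have hmem : (F.pairing i * g).1 z.1 ∈ F.X.outer := by
        have h1 := (apply_mem_geodesic (F.pairing i)).mpr hzi
        rw [F.pairing_left hi, F.pairing_right hi, Sym2.eq_swap] at h1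
        exact F.X.geodesic_subset_outer (show 2 * F.n - 1 - i < F.X.N by omega) h1
      have h2 := (hcl g hg z h).union
        (hcl (F.pairing i * g) (Γ.mul_mem (F.pairing_mem hi) hg) z hmem)
      refine h2.continuousAt ?_
      filter_upwards [hgc.continuousAt.eventually (F.X.eventually_mem_outer hi hzi),
        hgc.continuousAt.eventually (F.eventually_pairing_mem_inner hi hzi)] with w h3 h4
      rcases le_or_gt (side (F.X.v i) (F.X.v (i + 1)) (g.1 w.1)) 0 with h5 | h5
      · exact Or.inl (h3 h5)
      · exact Or.inr (F.X.inner_subset_outer (h4 h5))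
  let V : Set Sphere2 := Ξ '' {u | Θ u ∉ openDisk}
  have hsat : ∀ u, Ξ u ∈ V ↔ Θ u ∉ openDisk := by
    refine fun u => ⟨?_, fun h => ⟨u, h, rfl⟩⟩
    rintro ⟨u', hu', e⟩
    obtain ⟨g, -, hg⟩ := hfib' u' u e
    rw [← hg]
    exact fun h => hu' ((apply_mem_openDisk g).mp h)
  have hfV : ∀ z, f z ∈ Vᶜ := by
    intro z h
    have := (hsat (υ z)).mp h
    rw [hυ] at this
    exact this ((apply_mem_openDisk _).mpr z.2)
  have hVfin : V.Finite := by
    have hv : ∀ i, ∃ u, i < F.X.N → Θ u = toDisk (F.X.v i) := by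
      intro i
      by_cases hi : i < F.X.N
      · have := F.X.v_mem_outer hi.le
        rw [← hrange] at this
        obtain ⟨u, hu⟩ := this
        exact ⟨u, fun _ => hu⟩
      · obtain ⟨z, hz⟩ := F.X.inner_nonempty
        have := F.X.inner_subset_outer hz
        rw [← hrange] at this
        obtain ⟨u, -⟩ := this
        exact ⟨u, fun h => absurd h hi⟩
    choose u hu using hv
    refine ((Set.finite_Iio F.X.N).image fun i => Ξ (u i)).subset ?_
    rintro _ ⟨w, hw, rfl⟩
    obtain ⟨p, hp⟩ := not_mem_openDisk_iff.mp hw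
    have : toDisk p ∈ F.X.outer := by rw [hp]; exact hrange ▸ Set.mem_range_self w
    obtain ⟨i, hi, rfl⟩ := F.X.toDisk_mem_outer_iff.mp this
    exact ⟨i, hi, hfib _ _ (by rw [hu i hi, hp])⟩
  have hVne : V.Nonempty := by
    have := F.X.v_mem_outer (Nat.zero_le _)
    rw [← hrange] at this
    obtain ⟨u, hu⟩ := this
    exact ⟨_, u, by rw [Set.mem_ofPred_eq, hu]; exact not_mem_openDisk_iff.mpr ⟨_, rfl⟩, rfl⟩
  -- the induced bijection
  let fq : QuotientSurface Γ → (Vᶜ : Set Sphere2) :=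
    Quotient.lift (fun z => ⟨f z, hfV z⟩) (by
      rintro z w ⟨g, hg, e⟩
      refine Subtype.ext (hf z (γ w * g) (Γ.mul_mem (hγ w) hg) (υ w) ?_)
      rw [hυ, ← e]
      rfl)
  have hfq : Continuous fq := Continuous.quotient_lift (hfc.subtype_mk _) _
  let Q₀ : Set Q := Ξ ⁻¹' Vᶜ
  have hQ₀ : ∀ u : Q₀, Θ u.1 ∈ openDisk := by
    intro u
    by_contra hc
    exact u.2 ((hsat u.1).mpr hc)
  let ρ : Q₀ → QuotientSurface Γ := fun u => Quotient.mk _ ⟨Θ u.1, hQ₀ u⟩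
  have hρ : Continuous ρ :=
    continuous_quotient_mk'.comp ((hΘ.comp continuous_subtype_val).subtype_mk _)
  have hfρ : ∀ u : Q₀, (fq (ρ u)).1 = Ξ u.1 := fun u => hf ⟨Θ u.1, hQ₀ u⟩ 1 Γ.one_mem u.1 rfl
  have hinj : Function.Injective fq := by
    intro a b
    induction a using Quotient.inductionOn with
    | _ z =>
    induction b using Quotient.inductionOn with
    | _ w =>
    intro e
    obtain ⟨g, hg, h⟩ := hfib' _ _ (congrArg Subtype.val e : Ξ (υ z) = Ξ (υ w))
    refine Quotient.sound ⟨(γ w)⁻¹ * g * γ z,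
      Γ.mul_mem (Γ.mul_mem (Γ.inv_mem (hγ w)) hg) (hγ z), ?_⟩
    rw [hυ, hυ] at h
    change ((γ w)⁻¹).1 (g.1 ((γ z).1 z.1)) = w.1
    rw [h, inv_apply_apply]
  have hsurjρ : ∀ y : (Vᶜ : Set Sphere2), ∃ u : Q₀, fq (ρ u) = y := by
    intro y
    obtain ⟨u, hu⟩ := hsurj y.1
    exact ⟨⟨u, by rw [Set.mem_preimage, hu]; exact y.2⟩, Subtype.ext ((hfρ _).trans hu)⟩
  have hclosed : IsClosedMap fq := by
    intro C hC
    have h1 : fq '' C = (Vᶜ).restrictPreimage Ξ '' (ρ ⁻¹' C) := by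
      ext y
      constructor
      · rintro ⟨c, hc, rfl⟩
        obtain ⟨u, hu⟩ := hsurjρ (fq c)
        refine ⟨u, ?_, ?_⟩
        · rw [Set.mem_preimage, hinj hu]
          exact hc
        · exact Subtype.ext ((hfρ u).symm.trans (congrArg Subtype.val hu))
      · rintro ⟨u, hu, rfl⟩
        exact ⟨ρ u, hu, Subtype.ext (hfρ u)⟩
    rw [h1]
    exact hΞ.isClosedMap.restrictPreimage _ _ (hC.preimage hρ)
  exact ⟨V, hVfin, hVne, ⟨(Equiv.ofBijective fq ⟨hinj, fun y =>
    let ⟨u, hu⟩ := hsurjρ y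
    ⟨ρ u, hu⟩⟩).toHomeomorphOfContinuousClosed hfq hclosed⟩⟩

end FoldedPolygon

end Mating

namespace Mating

/-! ### Geographic coordinates on the sphere -/

theorem norm_sphereMap (s τ : ℝ) :
    ‖!₂[Real.sin (Real.pi * s) * Real.cos (2 * Real.pi * τ),
      Real.sin (Real.pi * s) * Real.sin (2 * Real.pi * τ), Real.cos (Real.pi * s)]‖ = 1 := by
  rw [EuclideanSpace.norm_eq, Real.sqrt_eq_one]
  simp only [Fin.sum_univ_three, Real.norm_eq_abs, sq_abs]
  change (Real.sin (Real.pi * s) * Real.cos (2 * Real.pi * τ)) ^ 2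
    + (Real.sin (Real.pi * s) * Real.sin (2 * Real.pi * τ)) ^ 2 + Real.cos (Real.pi * s) ^ 2 = 1
  linear_combination Real.sin (Real.pi * s) ^ 2 * Real.sin_sq_add_cos_sq (2 * Real.pi * τ)
    + Real.sin_sq_add_cos_sq (Real.pi * s)

/-- The point of the sphere with colatitude `π s` and longitude `2 π τ`. -/
def sphereMap (s τ : ℝ) : Sphere2 :=
  ⟨!₂[Real.sin (Real.pi * s) * Real.cos (2 * Real.pi * τ),
    Real.sin (Real.pi * s) * Real.sin (2 * Real.pi * τ), Real.cos (Real.pi * s)],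
    mem_sphere_zero_iff_norm.mpr (norm_sphereMap s τ)⟩

theorem continuous_sphereMap : Continuous fun u : ℝ × ℝ => sphereMap u.1 u.2 := by
  refine Continuous.subtype_mk ?_ _
  refine (PiLp.continuous_toLp 2 (fun _ : Fin 3 => ℝ)).comp (continuous_pi fun i => ?_)
  fin_cases i <;> simp <;> fun_prop

theorem sphereMap_eq_iff {s τ s' τ' : ℝ} : sphereMap s τ = sphereMap s' τ' ↔
    Real.sin (Real.pi * s) * Real.cos (2 * Real.pi * τ)
      = Real.sin (Real.pi * s') * Real.cos (2 * Real.pi * τ') ∧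
    Real.sin (Real.pi * s) * Real.sin (2 * Real.pi * τ)
      = Real.sin (Real.pi * s') * Real.sin (2 * Real.pi * τ') ∧
    Real.cos (Real.pi * s) = Real.cos (Real.pi * s') := by
  constructor
  · intro h
    have h' := congrArg Subtype.val h
    exact ⟨congrArg (fun x : EuclideanSpace ℝ (Fin 3) => x 0) h',
      congrArg (fun x : EuclideanSpace ℝ (Fin 3) => x 1) h',
      congrArg (fun x : EuclideanSpace ℝ (Fin 3) => x 2) h'⟩
  · rintro ⟨h1, h2, h3⟩
    apply Subtype.ext
    change !₂[_, _, _] = !₂[_, _, _]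
    rw [h1, h2, h3]

theorem sphereMap_zero (τ τ' : ℝ) : sphereMap 0 τ = sphereMap 0 τ' := by
  rw [sphereMap_eq_iff]
  simp

theorem sphereMap_one (τ τ' : ℝ) : sphereMap 1 τ = sphereMap 1 τ' := by
  rw [sphereMap_eq_iff]
  simp

theorem sphereMap_zero_one (s : ℝ) : sphereMap s 0 = sphereMap s 1 := by
  rw [sphereMap_eq_iff]
  simp

theorem sphereMap_inj {s τ s' τ' : ℝ} (hs : s ∈ Set.Icc (0 : ℝ) 1) (hs' : s' ∈ Set.Icc (0 : ℝ) 1)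
    (hτ : τ ∈ Set.Icc (0 : ℝ) 1) (hτ' : τ' ∈ Set.Icc (0 : ℝ) 1)
    (h : sphereMap s τ = sphereMap s' τ') :
    s = s' ∧ (s = 0 ∨ s = 1 ∨ τ = τ' ∨ (τ = 0 ∧ τ' = 1) ∨ (τ = 1 ∧ τ' = 0)) := by
  obtain ⟨h1, h2, h3⟩ := sphereMap_eq_iff.mp h
  have hpi := Real.pi_pos
  have hss : s = s' := by
    have := Real.injOn_cos (x₁ := Real.pi * s) (x₂ := Real.pi * s')
      ⟨by nlinarith [hs.1], by nlinarith [hs.2]⟩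
      ⟨by nlinarith [hs'.1], by nlinarith [hs'.2]⟩ h3
    exact mul_left_cancel₀ hpi.ne' this
  subst hss
  refine ⟨rfl, ?_⟩
  by_cases h0 : s = 0
  · exact Or.inl h0
  by_cases h4 : s = 1
  · exact Or.inr (Or.inl h4)
  right; right
  have hsin : 0 < Real.sin (Real.pi * s) := by
    have a1 : 0 < s := lt_of_le_of_ne hs.1 (Ne.symm h0)
    have a2 : s < 1 := lt_of_le_of_ne hs.2 h4
    exact Real.sin_pos_of_pos_of_lt_pi (by positivity) (by nlinarith)
  have c1 := mul_left_cancel₀ hsin.ne' h1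
  have c2 := mul_left_cancel₀ hsin.ne' h2
  have e : Circle.exp (2 * Real.pi * τ) = Circle.exp (2 * Real.pi * τ') := by
    apply Circle.ext
    apply Complex.ext
    · rw [circle_exp_re, circle_exp_re, c1]
    · rw [circle_exp_im, circle_exp_im, c2]
  rw [Circle.exp_eq_exp] at e
  obtain ⟨m, hm⟩ := e
  have hm' : τ = τ' + m := by
    have h5 : (2 * Real.pi) * τ = (2 * Real.pi) * (τ' + m) := by rw [hm]; ring
    exact mul_left_cancel₀ (by positivity) h5
  have b1 : (m : ℝ) ≤ 1 := by linarith [hτ.2, hτ'.1]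
  have b2 : (-1 : ℝ) ≤ m := by linarith [hτ.1, hτ'.2]
  have b1' : m ≤ 1 := by exact_mod_cast b1
  have b2' : -1 ≤ m := by exact_mod_cast b2
  have : m = -1 ∨ m = 0 ∨ m = 1 := by omega
  rcases this with rfl | rfl | rfl
  · push_cast at hm'
    exact Or.inr (Or.inl ⟨by linarith [hτ.1, hτ'.2], by linarith [hτ.1, hτ'.2]⟩)
  · left
    simpa using hm'
  · push_cast at hm'
    exact Or.inr (Or.inr ⟨by linarith [hτ.2, hτ'.1], by linarith [hτ.2, hτ'.1]⟩)

theorem exists_sphereMap_eq (y : Sphere2) :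
    ∃ s ∈ Set.Icc (0 : ℝ) 1, ∃ τ ∈ Set.Icc (0 : ℝ) 1, sphereMap s τ = y := by
  have hpi := Real.pi_pos
  obtain ⟨y, hy⟩ := y
  have hn : y 0 ^ 2 + y 1 ^ 2 + y 2 ^ 2 = 1 := by
    rw [mem_sphere_zero_iff_norm, EuclideanSpace.norm_eq, Real.sqrt_eq_one] at hy
    simpa [Fin.sum_univ_three] using hy
  have hz1 : -1 ≤ y 2 := by nlinarith [sq_nonneg (y 0), sq_nonneg (y 1)]
  have hz2 : y 2 ≤ 1 := by nlinarith [sq_nonneg (y 0), sq_nonneg (y 1)]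
  have hs1 : Real.pi * (Real.arccos (y 2) / Real.pi) = Real.arccos (y 2) := by field_simp
  have hsin := Real.sin_arccos (y 2)
  have hr : √(1 - y 2 ^ 2) ^ 2 = y 0 ^ 2 + y 1 ^ 2 := by
    rw [Real.sq_sqrt (by nlinarith)]
    linarith
  have key : ∃ τ ∈ Set.Icc (0 : ℝ) 1, √(1 - y 2 ^ 2) * Real.cos (2 * Real.pi * τ) = y 0 ∧
      √(1 - y 2 ^ 2) * Real.sin (2 * Real.pi * τ) = y 1 := by
    set r := √(1 - y 2 ^ 2)
    by_cases h0 : r = 0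
    · rw [h0] at hr
      refine ⟨0, by simp, ?_, ?_⟩
      · rw [h0]; nlinarith [sq_nonneg (y 0), sq_nonneg (y 1)]
      · rw [h0]; nlinarith [sq_nonneg (y 0), sq_nonneg (y 1)]
    · have hnorm : ‖(⟨y 0 / r, y 1 / r⟩ : ℂ)‖ = 1 := by
        rw [← sq_eq_sq₀ (norm_nonneg _) zero_le_one, ← Complex.normSq_eq_norm_sq,
          Complex.normSq_apply]
        field_simp
        linarith
      obtain ⟨γ, g1, g2, hγ⟩ := exists_angle 0
        (⟨⟨y 0 / r, y 1 / r⟩, mem_sphere_zero_iff_norm.mpr hnorm⟩ : Circle)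
      have e1 := congrArg (fun p : Circle => (p : ℂ).re) hγ
      have e2 := congrArg (fun p : Circle => (p : ℂ).im) hγ
      simp only [circle_exp_re, circle_exp_im] at e1 e2
      have e3 : 2 * Real.pi * (γ / (2 * Real.pi)) = γ := by field_simp
      refine ⟨γ / (2 * Real.pi), ⟨by positivity, ?_⟩, ?_, ?_⟩
      · rw [div_le_one (by positivity)]
        linarith
      · rw [e3, e1]
        field_simp
      · rw [e3, e2]
        field_simp
  obtain ⟨τ, hτ, k1, k2⟩ := key
  refine ⟨Real.arccos (y 2) / Real.pi,
    ⟨div_nonneg (Real.arccos_nonneg _) hpi.le, (div_le_one hpi).mpr (Real.arccos_le_pi _)⟩,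
    τ, hτ, Subtype.ext ?_⟩
  ext i
  fin_cases i
  · change Real.sin (Real.pi * (Real.arccos (y 2) / Real.pi)) * Real.cos (2 * Real.pi * τ) = y 0
    rw [hs1, hsin, k1]
  · change Real.sin (Real.pi * (Real.arccos (y 2) / Real.pi)) * Real.sin (2 * Real.pi * τ) = y 1
    rw [hs1, hsin, k2]
  · change Real.cos (Real.pi * (Real.arccos (y 2) / Real.pi)) = y 2
    rw [hs1, Real.cos_arccos hz1 hz2]

end Mating

namespace Mating

/-! ### Orientation of triangles -/

/-- Twice the signed area of the triangle with vertices `u`, `v`, `w`. -/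
def orient (u v w : ℂ) : ℝ := ((starRingEnd ℂ) (v - u) * (w - u)).im

theorem orient_rotate (u v w : ℂ) : orient u v w = orient v w u := by
  simp only [orient, map_sub, Complex.mul_im, Complex.sub_re, Complex.sub_im, Complex.conj_re,
    Complex.conj_im]
  ring

theorem orient_swap (u v w : ℂ) : orient u w v = -orient u v w := by
  simp only [orient, map_sub, Complex.mul_im, Complex.sub_re, Complex.sub_im, Complex.conj_re,
    Complex.conj_im]
  ring

theorem orient_combo (u v w w' : ℂ) (a : ℝ) :
    orient u v (((1 - a : ℝ) : ℂ) * w + (a : ℂ) * w')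
      = (1 - a) * orient u v w + a * orient u v w' := by
  simp only [orient, map_sub, Complex.mul_im, Complex.sub_re, Complex.sub_im, Complex.conj_re,
    Complex.conj_im, Complex.add_re, Complex.add_im, Complex.mul_re, Complex.ofReal_re,
    Complex.ofReal_im]
  ring

theorem orient_combo_left (u u' v w : ℂ) (a : ℝ) :
    orient (((1 - a : ℝ) : ℂ) * u + (a : ℂ) * u') v w
      = (1 - a) * orient u v w + a * orient u' v w := by
  rw [orient_rotate, orient_combo, ← orient_rotate u, ← orient_rotate u']

theorem orient_combo_middle (u v v' w : ℂ) (a : ℝ) :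
    orient u (((1 - a : ℝ) : ℂ) * v + (a : ℂ) * v') w
      = (1 - a) * orient u v w + a * orient u v' w := by
  rw [orient_swap, orient_combo, orient_swap u w v, orient_swap u w v']
  ring

theorem orient_combo_apex (c u w x : ℂ) (a b : ℝ) :
    orient (((1 - a : ℝ) : ℂ) * c + (a : ℂ) * u) w (((1 - b : ℝ) : ℂ) * c + (b : ℂ) * x)
      = b * orient c w x + a * orient c u w - a * b * orient c u x := by
  simp only [orient, map_sub, Complex.mul_im, Complex.sub_re, Complex.sub_im, Complex.conj_re,
    Complex.conj_im, Complex.add_re, Complex.add_im, Complex.mul_re, Complex.ofReal_re,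
    Complex.ofReal_im]
  ring

@[simp] theorem orient_self_left (u w : ℂ) : orient u u w = 0 := by simp [orient]

@[simp] theorem orient_self_right (u w : ℂ) : orient u w w = 0 := by
  rw [← orient_rotate]; simp [orient]

@[simp] theorem orient_self_outer (u w : ℂ) : orient u w u = 0 := by simp [orient]

theorem chord_eq_neg_orient (p q : Circle) (w : ℂ) : chord p q w = -orient p q w := by
  simp only [chord, orient, map_sub, Complex.mul_im, Complex.sub_re, Complex.sub_im,
    Complex.conj_re, Complex.conj_im]
  ring

theorem orient_pos_iff {p q r : Circle} : 0 < orient p q r ↔ ccw p q r := by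
  rw [ccw, chord_eq_neg_orient, orient_swap]

/-- A point of the line through two points is a combination of them. -/
theorem exists_eq_combo {u v w : ℂ} (h : u ≠ v) (h0 : orient u w v = 0) :
    ∃ τ : ℝ, w = ((1 - τ : ℝ) : ℂ) * u + (τ : ℂ) * v := by
  have hne : v - u ≠ 0 := sub_ne_zero.mpr h.symm
  have h1 : ((w - u) / (v - u)).im = 0 := by
    rw [orient] at h0
    have e : (w - u) / (v - u)
        = (starRingEnd ℂ) ((starRingEnd ℂ) (w - u) * (v - u))
          / ((Complex.normSq (v - u) : ℝ) : ℂ) := by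
      rw [← Complex.mul_conj, map_mul, Complex.conj_conj]
      have hne' : (starRingEnd ℂ) (v - u) ≠ 0 := (map_ne_zero _).mpr hne
      field_simp
    rw [e, Complex.div_ofReal_im, Complex.conj_im, h0]
    simp
  refine ⟨((w - u) / (v - u)).re, ?_⟩
  have h2 : ((((w - u) / (v - u)).re : ℝ) : ℂ) = (w - u) / (v - u) :=
    Complex.ext (by simp) (by simp [h1])
  rw [Complex.ofReal_sub, h2]
  field_simp
  push_cast
  ring

theorem continuousOn_orient {S : Set ℝ} {f g : ℝ → ℂ} (hf : ContinuousOn f S)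
    (hg : ContinuousOn g S) (w : ℂ) : ContinuousOn (fun a => orient (f a) w (g a)) S := by
  unfold orient
  exact Complex.continuous_im.comp_continuousOn
    ((Complex.continuous_conj.comp_continuousOn (continuousOn_const.sub hf)).mul (hg.sub hf))

namespace IdealPolygon

variable (X : IdealPolygon)

theorem orient_v_pos {i j l : ℕ} (hij : i < j) (hjl : j < l) (hl : l ≤ X.N)
    (h : ¬ (i = 0 ∧ l = X.N)) : 0 < orient (X.v i) (X.v j) (X.v l) := by
  rw [orient_pos_iff]
  rcases hl.lt_or_eq with hl | rfl
  · exact X.ccw_v hij hjl hl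
  · rw [X.v_N]
    exact ccw_rotate (X.ccw_v (show 0 < i by omega) hij hjl)

theorem orient_v_nonneg {i j l : ℕ} (hij : i ≤ j) (hjl : j ≤ l) (hl : l ≤ X.N) :
    0 ≤ orient (X.v i) (X.v j) (X.v l) := by
  by_cases h1 : i = j
  · simp [h1]
  by_cases h2 : j = l
  · simp [h2]
  by_cases h : i = 0 ∧ l = X.N
  · rw [h.1, h.2, X.v_N]
    simp
  · exact (X.orient_v_pos (by omega) (by omega) hl h).le

theorem orient_v_klein_pos {z : ClosedDisk} (hz : z ∈ X.inner) {i : ℕ} (hi : i < X.N) :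
    0 < orient (X.v i) (X.v (i + 1)) (klein z : ClosedDisk) := by
  have := hz.2 i hi
  rw [side_neg_iff, chord_eq_neg_orient] at this
  linarith

theorem mem_outer_of_orient {z : ClosedDisk}
    (h : ∀ i < X.N, 0 ≤ orient (X.v i) (X.v (i + 1)) (klein z : ClosedDisk)) : z ∈ X.outer := by
  intro i hi
  rw [side_nonpos_iff, chord_eq_neg_orient]
  linarith [h i hi]

theorem orient_nonneg_of_mem_outer {z : ClosedDisk} (hz : z ∈ X.outer) {i : ℕ} (hi : i < X.N) :
    0 ≤ orient (X.v i) (X.v (i + 1)) (klein z : ClosedDisk) := by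
  have := hz i hi
  rw [side_nonpos_iff, chord_eq_neg_orient] at this
  linarith

/-- The closed polygon is convex. -/
theorem between_mem_outer {z w : ClosedDisk} (hz : z ∈ X.outer) (hw : w ∈ X.outer) {a : ℝ}
    (h0 : 0 ≤ a) (h1 : a ≤ 1) : between z w a ∈ X.outer := by
  refine X.mem_outer_of_orient fun i hi => ?_
  rw [klein_between h0 h1, orient_combo]
  have c1 := X.orient_nonneg_of_mem_outer hz hi
  have c2 := X.orient_nonneg_of_mem_outer hw hi
  have : 0 ≤ 1 - a := by linarith
  positivity

/-- A line through two points of opposite sides is the zero set of an affine function which is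
positive at the vertices beyond these sides. If both points are the vertex number `0`, a
supporting line is used instead. -/
theorem exists_separating {n t : ℕ} (hN : X.N = 2 * n) (ht : t < n) {a b : ℝ} (ha : 0 ≤ a)
    (ha1 : a < 1) (hb : 0 ≤ b) (hb1 : b < 1) (h0 : t = 0 → (0 < a ∧ 0 < b) ∨ (a = 0 ∧ b = 0)) :
    ∃ ℓ : ℂ → ℝ, (∀ (u w : ℂ) (c : ℝ),
        ℓ (((1 - c : ℝ) : ℂ) * u + (c : ℂ) * w) = (1 - c) * ℓ u + c * ℓ w) ∧
      ℓ (((1 - a : ℝ) : ℂ) * X.v t + (a : ℂ) * X.v (t + 1)) = 0 ∧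
      ℓ (((1 - b : ℝ) : ℂ) * X.v (2 * n - t) + (b : ℂ) * X.v (2 * n - 1 - t)) = 0 ∧
      ∀ j, t < j → j < 2 * n - t → 0 < ℓ (X.v j) := by
  have h3 := X.three_le
  by_cases hc : t = 0 ∧ a = 0 ∧ b = 0
  · obtain ⟨rfl, rfl, rfl⟩ := hc
    have h00 : ∀ z : Circle, ((starRingEnd ℂ) (z : ℂ) * z).re = 1 := by
      intro z
      rw [← Complex.normSq_eq_conj_mul_self]
      simp
    refine ⟨fun w => 1 - ((starRingEnd ℂ) (X.v 0 : ℂ) * w).re, ?_, ?_, ?_, ?_⟩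
    · intro u w c
      simp only [Complex.mul_im, Complex.conj_re, Complex.conj_im, Complex.add_re, Complex.add_im,
        Complex.mul_re, Complex.ofReal_re, Complex.ofReal_im]
      ring
    · simp [h00]
    · have : X.v (2 * n - 0) = X.v 0 := by rw [Nat.sub_zero, ← hN, X.v_N]
      rw [this]
      simp [h00]
    · intro j hj hj'
      have hne : (X.v 0 : ℂ) ≠ X.v j := fun e => X.v_ne hj (by omega) (Circle.ext e)
      have h1 := Complex.normSq_pos.mpr (sub_ne_zero.mpr hne)
      have h2 := Circle.normSq_coe (X.v 0)
      have h3 := Circle.normSq_coe (X.v j)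
      simp only [Complex.normSq_apply, Complex.sub_re, Complex.sub_im, Complex.mul_re,
        Complex.conj_re, Complex.conj_im] at *
      nlinarith
  · refine ⟨fun w => orient (((1 - a : ℝ) : ℂ) * X.v t + (a : ℂ) * X.v (t + 1)) w
      (((1 - b : ℝ) : ℂ) * X.v (2 * n - t) + (b : ℂ) * X.v (2 * n - 1 - t)), ?_, ?_, ?_, ?_⟩
    · intro u w c
      exact orient_combo_middle _ _ _ _ _
    · simp
    · simp
    · intro j hj hj'
      have e1 : 0 < 1 - a := by linarith
      have e2 : 0 < 1 - b := by linarith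
      have d1 := X.orient_v_nonneg hj.le hj'.le (by omega)
      have d2 := X.orient_v_nonneg (show t + 1 ≤ j by omega) hj'.le (by omega)
      have d3 := X.orient_v_nonneg hj.le (show j ≤ 2 * n - 1 - t by omega) (by omega)
      have d4 := X.orient_v_nonneg (show t + 1 ≤ j by omega) (show j ≤ 2 * n - 1 - t by omega)
        (by omega)
      change 0 < orient _ _ _
      rw [orient_combo_left, orient_combo, orient_combo]
      by_cases h : t = 0
      · have hab : 0 < a ∧ 0 < b := (h0 h).resolve_right fun h' => hc ⟨h, h'⟩
        obtain ⟨a0, b0⟩ := hab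
        by_cases hj1 : j = 2 * n - 1 - t
        · have d5 := X.orient_v_pos (show t + 1 < j by omega) hj' (by omega) (by omega)
          positivity
        · have d5 := X.orient_v_pos hj (show j < 2 * n - 1 - t by omega) (by omega) (by omega)
          positivity
      · have d5 := X.orient_v_pos hj hj' (by omega) (by omega)
        positivity

end IdealPolygon

end Mating

namespace Mating

/-! ### Sweeping out a folded polygon by chords joining paired points -/

theorem continuous_between {Y : Type*} [TopologicalSpace Y] {f g : Y → ClosedDisk} {c : Y → ℝ}
    (hf : Continuous f) (hg : Continuous g) (hc : Continuous c)
    (h : ∀ y, c y ∈ Set.Icc (0 : ℝ) 1) : Continuous fun y => between (f y) (g y) (c y) := by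
  rw [← klein.comp_continuous_iff, ← Topology.IsInducing.subtypeVal.continuous_iff.symm]
  have e : (Subtype.val ∘ (klein ∘ fun y => between (f y) (g y) (c y)) : Y → ℂ)
      = fun y => ((1 - c y : ℝ) : ℂ) * (klein (f y) : ClosedDisk)
        + (c y : ℂ) * (klein (g y) : ClosedDisk) :=
    funext fun y => klein_between (h y).1 (h y).2
  rw [e]
  have h1 : Continuous fun y => ((klein (f y) : ClosedDisk) : ℂ) :=
    continuous_subtype_val.comp (klein.continuous.comp hf)
  have h2 : Continuous fun y => ((klein (g y) : ClosedDisk) : ℂ) :=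
    continuous_subtype_val.comp (klein.continuous.comp hg)
  fun_prop

theorem eq_of_coe_klein_eq {z w : ClosedDisk}
    (h : ((klein z : ClosedDisk) : ℂ) = (klein w : ClosedDisk)) : z = w :=
  klein.injective (Subtype.ext h)

theorem coe_klein_toDisk (p : Circle) : ((klein (toDisk p) : ClosedDisk) : ℂ) = p := by
  rw [klein_toDisk]; rfl

theorem between_zero (z w : ClosedDisk) : between z w 0 = z :=
  eq_of_coe_klein_eq (by rw [klein_between le_rfl zero_le_one]; simp)

theorem between_one (z w : ClosedDisk) : between z w 1 = w :=
  eq_of_coe_klein_eq (by rw [klein_between zero_le_one le_rfl]; simp)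

theorem between_self (z : ClosedDisk) {a : ℝ} (h0 : 0 ≤ a) (h1 : a ≤ 1) : between z z a = z :=
  eq_of_coe_klein_eq (by rw [klein_between h0 h1]; push_cast; ring)

theorem between_injective {z w : ClosedDisk} {a b : ℝ} (ha : a ∈ Set.Icc (0 : ℝ) 1)
    (hb : b ∈ Set.Icc (0 : ℝ) 1) (h : between z w a = between z w b) : a = b ∨ z = w := by
  by_cases hzw : z = w
  · exact Or.inr hzw
  left
  have e := congrArg (fun u => ((klein u : ClosedDisk) : ℂ)) h
  simp only [klein_between ha.1 ha.2, klein_between hb.1 hb.2] at e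
  have hne : ((klein w : ClosedDisk) : ℂ) - (klein z : ClosedDisk) ≠ 0 :=
    sub_ne_zero.mpr fun e' => hzw (eq_of_coe_klein_eq e'.symm)
  have e2 : ((a : ℂ) - b) * (((klein w : ClosedDisk) : ℂ) - (klein z : ClosedDisk)) = 0 := by
    push_cast at e
    linear_combination e
  have := (mul_eq_zero.mp e2).resolve_right hne
  exact_mod_cast sub_eq_zero.mp this

theorem combo_pos {x y a : ℝ} (hx : 0 < x) (hy : 0 < y) (h0 : 0 ≤ a) (h1 : a ≤ 1) :
    0 < (1 - a) * x + a * y := by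
  rcases h0.eq_or_lt with rfl | h0
  · simpa using hx
  · have : 0 ≤ 1 - a := by linarith
    positivity

theorem combo_pos_of_lt {x y a b : ℝ} (h : (1 - a) * x + a * y = 0) (hy : 0 < y) (ha : a < b)
    (h1 : b ≤ 1) : 0 < (1 - b) * x + b * y := by
  have h2 : 0 < 1 - a := by linarith
  have h3 : (1 - a) * ((1 - b) * x + b * y) = (b - a) * y := by linear_combination (1 - b) * h
  have h4 : 0 < (b - a) * y := mul_pos (by linarith) hy
  rw [← h3] at h4
  exact pos_of_mul_pos_right h4 h2.le

namespace FoldedPolygon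

variable {Γ : Subgroup diskAut} (F : FoldedPolygon Γ)

/-- The point with parameter `a ∈ [0, 1]` on the side number `t < n`. -/
def front (t : ℕ) (a : ℝ) : ClosedDisk := between (toDisk (F.X.v t)) (toDisk (F.X.v (t + 1))) a

/-- The point glued to `front t a`, on the side number `2 n - 1 - t`. -/
def back (t : ℕ) (a : ℝ) : ClosedDisk := (F.h t).1 (F.front t a)

theorem klein_front (t : ℕ) {a : ℝ} (ha : a ∈ Set.Icc (0 : ℝ) 1) :
    ((klein (F.front t a) : ClosedDisk) : ℂ)
      = ((1 - a : ℝ) : ℂ) * F.X.v t + (a : ℂ) * F.X.v (t + 1) := by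
  rw [front, klein_between ha.1 ha.2, coe_klein_toDisk, coe_klein_toDisk]

theorem front_zero (t : ℕ) : F.front t 0 = toDisk (F.X.v t) := between_zero _ _

theorem front_one (t : ℕ) : F.front t 1 = toDisk (F.X.v (t + 1)) := between_one _ _

theorem back_zero {t : ℕ} (ht : t < F.n) : F.back t 0 = toDisk (F.X.v (2 * F.n - t)) := by
  rw [back, front_zero, ← toDisk_onCircle, F.h_left t ht]

theorem back_one {t : ℕ} (ht : t < F.n) : F.back t 1 = toDisk (F.X.v (2 * F.n - 1 - t)) := by
  rw [back, front_one, ← toDisk_onCircle, F.h_right t ht]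

/-- The gluing of a side, in Klein coordinates, is an increasing change of the parameter. -/
theorem exists_back (t : ℕ) : ∃ b : ℝ → ℝ, t < F.n → ContinuousOn b (Set.Icc 0 1) ∧ b 0 = 0 ∧
    b 1 = 1 ∧ StrictMonoOn b (Set.Icc 0 1) ∧ ∀ a ∈ Set.Icc (0 : ℝ) 1,
      ((klein (F.back t a) : ClosedDisk) : ℂ)
        = ((1 - b a : ℝ) : ℂ) * F.X.v (2 * F.n - t) + (b a : ℂ) * F.X.v (2 * F.n - 1 - t) := by
  by_cases ht : t < F.n
  swap
  · exact ⟨id, fun h => absurd h ht⟩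
  have hN := F.N_eq
  have hne : F.X.v (2 * F.n - t) ≠ F.X.v (2 * F.n - 1 - t) := by
    have := F.X.v_ne_succ (i := 2 * F.n - 1 - t) (by omega)
    rw [show 2 * F.n - 1 - t + 1 = 2 * F.n - t by omega] at this
    exact this.symm
  obtain ⟨b, hb⟩ : ∃ b : ℝ → ℝ, b = fun a => chordCoord (F.X.v (2 * F.n - t))
      (F.X.v (2 * F.n - 1 - t)) (klein (F.back t a) : ClosedDisk) := ⟨_, rfl⟩
  have hcont : ContinuousOn b (Set.Icc 0 1) := by
    rw [continuousOn_iff_continuous_domRestrict, hb]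
    have h1 : Continuous fun a : Set.Icc (0 : ℝ) 1 => F.front t a :=
      continuous_between continuous_const continuous_const continuous_subtype_val fun a => a.2
    have h2 : Continuous fun a : Set.Icc (0 : ℝ) 1 => F.back t a := (F.h t).1.continuous.comp h1
    exact (continuous_chordCoord _ _).comp
      (continuous_subtype_val.comp (klein.continuous.comp h2))
  have hkl : ∀ a ∈ Set.Icc (0 : ℝ) 1, ((klein (F.back t a) : ClosedDisk) : ℂ)
      = ((1 - b a : ℝ) : ℂ) * F.X.v (2 * F.n - t) + (b a : ℂ) * F.X.v (2 * F.n - 1 - t) := by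
    intro a ha
    rw [hb]
    apply eq_combo_of_chord_eq_zero hne
    rw [← side_eq_zero_iff, ← F.h_left t ht, ← F.h_right t ht, back, side_onCircle_eq_zero,
      side_eq_zero_iff, F.klein_front t ha, chord_combo _ _ _ _ _ _ (by ring)]
    simp
  have hb0 : b 0 = 0 := by
    have := chordCoord_combo hne 0
    simp only [hb, F.back_zero ht, coe_klein_toDisk]
    simpa using this
  have hb1 : b 1 = 1 := by
    have := chordCoord_combo hne 1
    simp only [hb, F.back_one ht, coe_klein_toDisk]
    simpa using this
  have hinj : Set.InjOn b (Set.Icc 0 1) := by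
    intro a ha a' ha' e
    have h1 : F.back t a = F.back t a' := eq_of_coe_klein_eq (by rw [hkl a ha, hkl a' ha', e])
    rcases between_injective ha ha' ((F.h t).1.injective h1) with h | h
    · exact h
    · exact absurd (toDisk_injective h) (F.X.v_ne_succ (by omega))
  exact ⟨b, fun _ => ⟨hcont, hb0, hb1,
    hcont.strictMonoOn_of_injOn_Icc zero_le_one (by rw [hb0, hb1]; exact zero_le_one) hinj, hkl⟩⟩

theorem front_mem_outer {t : ℕ} (ht : t < F.n) {a : ℝ} (ha : a ∈ Set.Icc (0 : ℝ) 1) :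
    F.front t a ∈ F.X.outer := by
  have hN := F.N_eq
  exact F.X.between_mem_outer (F.X.v_mem_outer (by omega)) (F.X.v_mem_outer (by omega)) ha.1 ha.2

theorem back_mem_outer {t : ℕ} (ht : t < F.n) {a : ℝ} (ha : a ∈ Set.Icc (0 : ℝ) 1) :
    F.back t a ∈ F.X.outer := by
  have hN := F.N_eq
  obtain ⟨b, hb⟩ := F.exists_back t
  obtain ⟨-, b0, b1, bm, hkl⟩ := hb ht
  have c0 : 0 ≤ b a := b0 ▸ bm.monotoneOn (by simp) ha ha.1
  have c1 : b a ≤ 1 := b1 ▸ bm.monotoneOn ha (by simp) ha.2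
  have e : F.back t a
      = between (toDisk (F.X.v (2 * F.n - t))) (toDisk (F.X.v (2 * F.n - 1 - t))) (b a) :=
    eq_of_coe_klein_eq (by
      rw [hkl a ha, klein_between c0 c1, coe_klein_toDisk, coe_klein_toDisk])
  rw [e]
  exact F.X.between_mem_outer (F.X.v_mem_outer (by omega)) (F.X.v_mem_outer (by omega)) c0 c1

/-- The point with parameter `τ ∈ [0, 1]` on the chord from `front t a` to `back t a`. -/
def strip (t : ℕ) (a τ : ℝ) : ClosedDisk := between (F.front t a) (F.back t a) τ

theorem front_back_eq_of_lt {t t' : ℕ} (ht' : t' < F.n) {a a' : ℝ} (ha : a ≤ 1) (ha' : 0 ≤ a')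
    (h : (t : ℝ) + a = t' + a') (hlt : t < t') :
    F.front t a = F.front t' a' ∧ F.back t a = F.back t' a' := by
  have h1 : ((t + 1 : ℕ) : ℝ) ≤ t' := by exact_mod_cast hlt
  push_cast at h1
  have h2 : a = 1 := by linarith
  have h3 : a' = 0 := by linarith
  subst h2 h3
  have h4 : t' = t + 1 := by
    have : (t' : ℝ) = ((t + 1 : ℕ) : ℝ) := by push_cast; linarith
    exact_mod_cast this
  subst h4
  refine ⟨by rw [front_one, front_zero], ?_⟩
  rw [F.back_one (by omega), F.back_zero ht']
  congr 2
  omega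

/-- The chord through `front t a` and `back t a` depends on `t + a` only. -/
theorem front_back_eq {t t' : ℕ} (ht : t < F.n) (ht' : t' < F.n) {a a' : ℝ}
    (ha : a ∈ Set.Icc (0 : ℝ) 1) (ha' : a' ∈ Set.Icc (0 : ℝ) 1) (h : (t : ℝ) + a = t' + a') :
    F.front t a = F.front t' a' ∧ F.back t a = F.back t' a' := by
  rcases lt_trichotomy t t' with hlt | rfl | hlt
  · exact F.front_back_eq_of_lt ht' ha.2 ha'.1 h hlt
  · have : a = a' := by linarith
    rw [this]
    exact ⟨rfl, rfl⟩
  · obtain ⟨h1, h2⟩ := F.front_back_eq_of_lt ht ha'.2 ha.1 h.symm hlt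
    exact ⟨h1.symm, h2.symm⟩

/-- Different chords are disjoint. -/
theorem strip_ne {t t' : ℕ} (ht : t < F.n) (ht' : t' < F.n) {a a' τ τ' : ℝ}
    (ha : a ∈ Set.Icc (0 : ℝ) 1) (ha' : a' ∈ Set.Icc (0 : ℝ) 1) (hτ : τ ∈ Set.Icc (0 : ℝ) 1)
    (hτ' : τ' ∈ Set.Icc (0 : ℝ) 1) (h : (t : ℝ) + a < t' + a') :
    F.strip t a τ ≠ F.strip t' a' τ' := by
  -- it may be assumed that `a < 1`
  wlog ha1 : a < 1 generalizing t a
  · have e : a = 1 := le_antisymm ha.2 (not_lt.mp ha1)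
    subst e
    have h1 : t + 1 < F.n := by
      have h2 : ((t + 1 : ℕ) : ℝ) < (F.n : ℝ) := by
        have h3 : ((t' + 1 : ℕ) : ℝ) ≤ F.n := by exact_mod_cast ht'
        push_cast at h3 ⊢
        linarith [ha'.2]
      exact_mod_cast h2
    have h2 := F.front_back_eq ht h1 (a := 1) (a' := 0) (by simp) (by simp) (by push_cast; ring)
    rw [strip, h2.1, h2.2]
    exact this h1 (by simp) (by push_cast; linarith) one_pos
  have hN := F.N_eq
  obtain ⟨b, hb⟩ := F.exists_back t
  obtain ⟨b', hb'⟩ := F.exists_back t'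
  have hbb : t = t' → ((klein (F.back t' a') : ClosedDisk) : ℂ)
      = ((1 - b a' : ℝ) : ℂ) * F.X.v (2 * F.n - t) + (b a' : ℂ) * F.X.v (2 * F.n - 1 - t) := by
    rintro rfl
    exact (hb ht).2.2.2.2 a' ha'
  obtain ⟨-, b0, b1, bm, hkl⟩ := hb ht
  obtain ⟨-, b0', b1', bm', hkl'⟩ := hb' ht'
  have c0 : 0 ≤ b a := b0 ▸ bm.monotoneOn (by simp) ha ha.1
  have c1 : b a < 1 := b1 ▸ bm ha (by simp) ha1
  obtain ⟨ℓ, hℓ, l1, l2, l3⟩ := F.X.exists_separating hN ht ha.1 ha1 c0 c1 (fun _ => by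
    rcases ha.1.eq_or_lt with h | h
    · right
      rw [← h, b0]
      exact ⟨rfl, rfl⟩
    · exact Or.inl ⟨h, b0 ▸ bm (by simp) ha h⟩)
  have f1 : 0 < ℓ (klein (F.front t' a') : ClosedDisk) := by
    rw [F.klein_front t' ha', hℓ]
    rcases lt_or_ge t t' with hlt | hge
    · exact combo_pos (l3 _ hlt (by omega)) (l3 _ (by omega) (by omega)) ha'.1 ha'.2
    · have ht0 : t = t' := by
        refine le_antisymm ?_ hge
        have : (t : ℝ) < ((t' + 1 : ℕ) : ℝ) := by push_cast; linarith [ha.1, ha'.2]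
        exact Nat.lt_succ_iff.mp (by exact_mod_cast this)
      subst ht0
      rw [hℓ] at l1
      exact combo_pos_of_lt l1 (l3 _ (by omega) (by omega)) (by linarith) ha'.2
  have f2 : 0 < ℓ (klein (F.back t' a') : ClosedDisk) := by
    rcases lt_or_ge t t' with hlt | hge
    · have d0 : 0 ≤ b' a' := b0' ▸ bm'.monotoneOn (by simp) ha' ha'.1
      have d1 : b' a' ≤ 1 := b1' ▸ bm'.monotoneOn ha' (by simp) ha'.2
      rw [hkl' a' ha', hℓ]
      exact combo_pos (l3 _ (by omega) (by omega)) (l3 _ (by omega) (by omega)) d0 d1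
    · have ht0 : t = t' := by
        refine le_antisymm ?_ hge
        have : (t : ℝ) < ((t' + 1 : ℕ) : ℝ) := by push_cast; linarith [ha.1, ha'.2]
        exact Nat.lt_succ_iff.mp (by exact_mod_cast this)
      rw [hbb ht0, hℓ]
      rw [hℓ] at l2
      have haa : a < a' := by
        rw [ht0] at h
        linarith
      exact combo_pos_of_lt l2 (l3 _ (by omega) (by omega)) (bm ha ha' haa)
        (b1 ▸ bm.monotoneOn ha' (by simp) ha'.2)
  intro e
  have e1 : ℓ (klein (F.strip t a τ) : ClosedDisk) = 0 := by
    rw [strip, klein_between hτ.1 hτ.2, hℓ, F.klein_front t ha, hkl a ha, l1, l2]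
    ring
  have e2 : 0 < ℓ (klein (F.strip t' a' τ') : ClosedDisk) := by
    rw [strip, klein_between hτ'.1 hτ'.2, hℓ]
    exact combo_pos f1 f2 hτ'.1 hτ'.2
  rw [e] at e1
  linarith

/-- Only the first and the last chord are degenerate. -/
theorem front_eq_back_iff {t : ℕ} (ht : t < F.n) {a : ℝ} (ha : a ∈ Set.Icc (0 : ℝ) 1) :
    F.front t a = F.back t a ↔ (t : ℝ) + a = 0 ∨ (t : ℝ) + a = F.n := by
  have hN := F.N_eq
  have hn := F.two_le
  constructor
  · intro h
    rcases ha.1.eq_or_lt with rfl | h0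
    · rw [front_zero, F.back_zero ht] at h
      left
      by_contra hc
      have : t ≠ 0 := by
        rintro rfl
        simp at hc
      exact F.X.v_ne (show t < 2 * F.n - t by omega) (by omega) (toDisk_injective h)
    rcases ha.2.eq_or_lt with rfl | h1
    · rw [front_one, F.back_one ht] at h
      right
      by_contra hc
      have : t + 1 ≠ F.n := by
        intro e
        rw [← e] at hc
        push_cast at hc
        exact hc rfl
      exact F.X.v_ne (show t + 1 < 2 * F.n - 1 - t by omega) (by omega) (toDisk_injective h)
    · exfalso
      have h2 : F.front t a ∈ geodesic s(F.X.v t, F.X.v (t + 1)) :=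
        (mem_geodesic_iff (F.X.v_ne_succ (by omega))).mpr ⟨a, h0, h1, F.klein_front t ha⟩
      have h3 := (apply_mem_geodesic (F.h t)).mpr h2
      rw [F.h_left t ht, F.h_right t ht, Sym2.eq_swap,
        show 2 * F.n - t = 2 * F.n - 1 - t + 1 by omega] at h3
      have h4 := F.X.side_neg_of_mem_geodesic (show t < F.X.N by omega) (by omega) (by omega) h3
      change side _ _ (F.back t a) < 0 at h4
      rw [← h] at h4
      exact absurd h2.2 h4.ne
  · rintro (h | h)
    · have h1 := F.front_back_eq ht (show 0 < F.n by omega) ha (a' := 0) (by simp)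
        (by push_cast; linarith)
      rw [h1.1, h1.2, front_zero, F.back_zero (by omega), Nat.sub_zero, ← hN, F.X.v_N]
    · have h2 : ((F.n - 1 : ℕ) : ℝ) = F.n - 1 := by
        rw [Nat.cast_sub (by omega)]
        simp
      have h1 := F.front_back_eq ht (show F.n - 1 < F.n by omega) ha (a' := 1) (by simp)
        (by rw [h2]; linarith)
      rw [h1.1, h1.2, front_one, F.back_one (by omega)]
      congr 2
      omega

end FoldedPolygon

end Mating

namespace Mating

theorem exists_nonneg_near_apex {D₁ D₂ D₃ : ℝ} (h1 : 0 < D₁) (h2 : 0 < D₂) (h3 : 0 < D₃) :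
    ∃ a : ℝ, 0 < a ∧ a < 1 ∧ ∀ b, 0 ≤ b → 0 ≤ b * D₁ + a * D₂ - a * b * D₃ := by
  have h4 : D₁ / (D₁ + D₃) * D₃ ≤ D₁ := by
    rw [div_mul_eq_mul_div, div_le_iff₀ (by positivity)]
    nlinarith
  refine ⟨D₁ / (D₁ + D₃), by positivity, (div_lt_one (by positivity)).mpr (by linarith),
    fun b hb => ?_⟩
  have h5 : 0 ≤ D₁ / (D₁ + D₃) * D₂ := by positivity
  have h6 := mul_le_mul_of_nonneg_left h4 hb
  linarith

namespace FoldedPolygon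

variable {Γ : Subgroup diskAut} (F : FoldedPolygon Γ)

/-- A point of the polygon lies between two consecutive diagonals. -/
theorem exists_diagonals (W : ℂ) : ∃ t < F.n,
    (t = 0 ∨ 0 ≤ orient (F.X.v t) W (F.X.v (2 * F.n - t))) ∧
    (t + 1 = F.n ∨ orient (F.X.v (t + 1)) W (F.X.v (2 * F.n - 1 - t)) < 0) := by
  classical
  have hn := F.two_le
  let p : ℕ → Prop := fun t => t = 0 ∨ 0 ≤ orient (F.X.v t) W (F.X.v (2 * F.n - t))
  obtain ⟨t, ht⟩ : ∃ t, t = Nat.findGreatest p (F.n - 1) := ⟨_, rfl⟩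
  have h1 : t ≤ F.n - 1 := ht ▸ Nat.findGreatest_le _
  have h2 : p t := ht ▸ Nat.findGreatest_spec (P := p) (Nat.zero_le _) (Or.inl rfl)
  refine ⟨t, by omega, h2, ?_⟩
  by_contra hc
  push Not at hc
  have h3 : p (t + 1) := by
    right
    rw [show 2 * F.n - (t + 1) = 2 * F.n - 1 - t by omega]
    exact hc.2
  have := Nat.le_findGreatest (P := p) (show t + 1 ≤ F.n - 1 by omega) h3
  omega

/-- A point of the polygon lies on the line through two paired points: its position relative to
this line changes from one side to the other between two consecutive diagonals. -/
theorem exists_orient_eq_zero {W : ℂ}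
    (hpos : ∀ i < F.X.N, 0 < orient (F.X.v i) (F.X.v (i + 1)) W) :
    ∃ t < F.n, ∃ a ∈ Set.Icc (0 : ℝ) 1, (t = 0 → 0 < a) ∧ (t + 1 = F.n → a < 1) ∧
      orient (klein (F.front t a) : ClosedDisk) W (klein (F.back t a) : ClosedDisk) = 0 := by
  have hN := F.N_eq
  have hn := F.two_le
  obtain ⟨t, ht, hp, hq⟩ := F.exists_diagonals W
  obtain ⟨b, hb⟩ := F.exists_back t
  obtain ⟨bc, b0, b1, bm, hkl⟩ := hb ht
  have bI : ∀ a ∈ Set.Icc (0 : ℝ) 1, b a ∈ Set.Icc (0 : ℝ) 1 := fun a ha =>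
    ⟨b0 ▸ bm.monotoneOn (by simp) ha ha.1, b1 ▸ bm.monotoneOn ha (by simp) ha.2⟩
  obtain ⟨δ, hδ⟩ : ∃ δ : ℝ → ℝ, ∀ a, δ a =
      orient (((1 - a : ℝ) : ℂ) * F.X.v t + (a : ℂ) * F.X.v (t + 1)) W
        (((1 - b a : ℝ) : ℂ) * F.X.v (2 * F.n - t) + (b a : ℂ) * F.X.v (2 * F.n - 1 - t)) :=
    ⟨_, fun _ => rfl⟩
  have hδc : ContinuousOn δ (Set.Icc 0 1) := by
    rw [show δ = fun a => _ from funext hδ]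
    have h1 : ContinuousOn (fun a => ((b a : ℝ) : ℂ)) (Set.Icc 0 1) :=
      Complex.continuous_ofReal.comp_continuousOn bc
    have h2 : ContinuousOn (fun a => ((1 - b a : ℝ) : ℂ)) (Set.Icc 0 1) :=
      Complex.continuous_ofReal.comp_continuousOn (continuousOn_const.sub bc)
    exact continuousOn_orient (by fun_prop)
      ((h2.mul continuousOn_const).add (h1.mul continuousOn_const)) W
  -- the first chord is degenerate, and the point lies beyond the next ones
  obtain ⟨a₁, h₁, d₁, p₁, q₁⟩ : ∃ a₁ ∈ Set.Icc (0 : ℝ) 1, 0 ≤ δ a₁ ∧ (t = 0 → 0 < a₁) ∧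
      (t + 1 = F.n → a₁ < 1) := by
    by_cases h0 : t = 0
    · subst h0
      have c1 := hpos (2 * F.n - 1) (by omega)
      rw [show 2 * F.n - 1 + 1 = F.X.N by omega, F.X.v_N, orient_rotate] at c1
      have c2 := hpos 0 (by omega)
      have c3 := F.X.orient_v_pos (show 0 < 1 by omega) (show 1 < 2 * F.n - 1 by omega) (by omega)
        (by omega)
      obtain ⟨a, a0, a1, ha⟩ := exists_nonneg_near_apex c1 c2 c3
      refine ⟨a, ⟨a0.le, a1.le⟩, ?_, fun _ => a0, fun _ => a1⟩
      have e : F.X.v (2 * F.n - 0) = F.X.v 0 := by rw [Nat.sub_zero, ← hN, F.X.v_N]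
      rw [hδ, e, Nat.sub_zero, orient_combo_apex]
      exact ha _ (bI a ⟨a0.le, a1.le⟩).1
    · refine ⟨0, by simp, ?_, fun h => absurd h h0, fun _ => one_pos⟩
      have := hp.resolve_left h0
      simpa [hδ, b0] using this
  -- the last chord is degenerate, too, and the previous ones lie beyond the point
  obtain ⟨a₂, h₂, d₂, p₂, q₂⟩ : ∃ a₂ ∈ Set.Icc (0 : ℝ) 1, δ a₂ ≤ 0 ∧ (t = 0 → 0 < a₂) ∧
      (t + 1 = F.n → a₂ < 1) := by
    by_cases h0 : t + 1 = F.n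
    · have c1 := hpos (t + 1) (by omega)
      have c2 := hpos t (by omega)
      have c3 := F.X.orient_v_pos (show t < t + 1 by omega) (show t + 1 < t + 2 by omega)
        (by omega) (by omega)
      obtain ⟨a, a0, a1, ha⟩ := exists_nonneg_near_apex c1 c2 c3
      have haI : 1 - a ∈ Set.Icc (0 : ℝ) 1 := ⟨by linarith, by linarith⟩
      refine ⟨1 - a, haI, ?_, fun _ => by linarith, fun _ => by linarith⟩
      have key := orient_combo_apex (F.X.v (t + 1)) (F.X.v t) W (F.X.v (t + 2)) a (1 - b (1 - a))
      have i1 := orient_swap (F.X.v (t + 1)) (F.X.v (t + 2)) W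
      have i2 := (orient_rotate _ _ _).trans (orient_swap (F.X.v t) (F.X.v (t + 1)) W)
      have i3 := (orient_rotate _ _ _).trans
        (orient_swap (F.X.v t) (F.X.v (t + 1)) (F.X.v (t + 2)))
      rw [i1, i2, i3, sub_sub_cancel] at key
      rw [hδ, show 2 * F.n - t = t + 2 by omega, show 2 * F.n - 1 - t = t + 1 by omega, add_comm,
        add_comm (_ * ((F.X.v (t + 2) : Circle) : ℂ)), sub_sub_cancel, key]
      have := ha (1 - b (1 - a)) (by linarith [(bI _ haI).2])
      linarith
    · refine ⟨1, by simp, ?_, fun _ => one_pos, fun h => absurd h h0⟩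
      have := (hq.resolve_left h0).le
      simpa [hδ, b1] using this
  have hsub : Set.uIcc a₁ a₂ ⊆ Set.Icc 0 1 := Set.uIcc_subset_Icc h₁ h₂
  obtain ⟨a, ha, hδa⟩ := intermediate_value_uIcc (hδc.mono hsub)
    (show (0 : ℝ) ∈ Set.uIcc (δ a₁) (δ a₂) from Set.mem_uIcc.mpr (Or.inr ⟨d₂, d₁⟩))
  have haI := hsub ha
  refine ⟨t, ht, a, haI, fun h => lt_of_lt_of_le (lt_min (p₁ h) (p₂ h)) ha.1,
    fun h => lt_of_le_of_lt ha.2 (max_lt (q₁ h) (q₂ h)), ?_⟩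
  rw [F.klein_front t haI, hkl a haI, ← hδ, hδa]

/-- The chords sweep out the polygon. -/
theorem exists_strip_eq {z : ClosedDisk} (hz : z ∈ F.X.inner) :
    ∃ t < F.n, ∃ a ∈ Set.Icc (0 : ℝ) 1, ∃ τ ∈ Set.Icc (0 : ℝ) 1, F.strip t a τ = z := by
  have hN := F.N_eq
  have hn := F.two_le
  have hpos : ∀ i < F.X.N, 0 < orient (F.X.v i) (F.X.v (i + 1)) (klein z : ClosedDisk) :=
    fun i hi => F.X.orient_v_klein_pos hz hi
  obtain ⟨t, ht, a, ha, ha0, ha1, h0⟩ := F.exists_orient_eq_zero hpos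
  have hne : F.front t a ≠ F.back t a := by
    rw [Ne, F.front_eq_back_iff ht ha]
    rintro (h | h)
    · have h1 : t = 0 := by
        have : (t : ℝ) ≤ 0 := by linarith [ha.1]
        exact Nat.le_zero.mp (by exact_mod_cast this)
      have h2 := ha0 h1
      have : (0 : ℝ) ≤ t := Nat.cast_nonneg _
      linarith
    · have h3 : ((t + 1 : ℕ) : ℝ) ≤ F.n := by exact_mod_cast ht
      have h1 : t + 1 = F.n := by
        refine le_antisymm ht ?_
        have : (F.n : ℝ) ≤ ((t + 1 : ℕ) : ℝ) := by push_cast; linarith [ha.2]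
        exact_mod_cast this
      have h2 := ha1 h1
      push_cast at h3
      rw [← h1] at h
      push_cast at h
      linarith
  obtain ⟨τ, hτ⟩ := exists_eq_combo (fun e => hne (eq_of_coe_klein_eq e)) h0
  obtain ⟨f, hf⟩ : ∃ f : ℂ → ℝ, f = orient (F.X.v t) (F.X.v (t + 1)) := ⟨_, rfl⟩
  obtain ⟨g, hg⟩ : ∃ g : ℂ → ℝ, g = orient (F.X.v (2 * F.n - 1 - t))
    (F.X.v (2 * F.n - 1 - t + 1)) := ⟨_, rfl⟩
  have f0 : f (klein (F.front t a) : ClosedDisk) = 0 := by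
    rw [hf, F.klein_front t ha, orient_combo]
    simp
  have f1 : 0 ≤ f (klein (F.back t a) : ClosedDisk) := by
    rw [hf]
    exact F.X.orient_nonneg_of_mem_outer (F.back_mem_outer ht ha) (by omega)
  have g0 : g (klein (F.back t a) : ClosedDisk) = 0 := by
    obtain ⟨b, hb⟩ := F.exists_back t
    rw [hg, (hb ht).2.2.2.2 a ha, orient_combo,
      show 2 * F.n - 1 - t + 1 = 2 * F.n - t by omega]
    simp
  have g1 : 0 ≤ g (klein (F.front t a) : ClosedDisk) := by
    rw [hg]
    exact F.X.orient_nonneg_of_mem_outer (F.front_mem_outer ht ha) (by omega)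
  have f2 := hpos t (by omega)
  have g2 := hpos (2 * F.n - 1 - t) (by omega)
  rw [← hf, hτ, hf, orient_combo, ← hf, f0, mul_zero, zero_add] at f2
  rw [← hg, hτ, hg, orient_combo, ← hg, g0, mul_zero, add_zero] at g2
  have t0 : 0 < τ := pos_of_mul_pos_left f2 f1
  have t1 : 0 < 1 - τ := pos_of_mul_pos_left g2 g1
  refine ⟨t, ht, a, ha, τ, ⟨t0.le, by linarith⟩, eq_of_coe_klein_eq ?_⟩
  rw [strip, klein_between t0.le (by linarith), hτ]

/-- The quotient of the disk by a group with a folded fundamental polygon is a punctured sphere: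
the chords joining paired points become circles of latitude. -/
theorem isPuncturedSphere {Γ : Subgroup diskAut} (F : FoldedPolygon Γ) :
    IsPuncturedSphere (QuotientSurface Γ) := by
  have hN := F.N_eq
  have hn := F.two_le
  have hn0 : (0 : ℝ) < F.n := by exact_mod_cast (show 0 < F.n by omega)
  let Q : Type := Fin F.n × Set.Icc (0 : ℝ) 1 × Set.Icc (0 : ℝ) 1
  let Θ : Q → ClosedDisk := fun u => F.strip u.1 u.2.1 u.2.2
  let lat : Q → ℝ := fun u => ((u.1 : ℕ) + (u.2.1 : ℝ)) / F.n
  let Ξ : Q → Sphere2 := fun u => sphereMap (lat u) u.2.2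
  have hlat : ∀ u, lat u ∈ Set.Icc (0 : ℝ) 1 := by
    intro u
    have h1 := u.2.1.2
    have h2 : (((u.1 : ℕ) + 1 : ℕ) : ℝ) ≤ F.n := by exact_mod_cast u.1.2
    push_cast at h2
    refine ⟨div_nonneg (add_nonneg (Nat.cast_nonneg _) h1.1) hn0.le, ?_⟩
    rw [div_le_one hn0]
    linarith [h1.2]
  have hΘ : Continuous Θ := by
    rw [continuous_prod_of_discrete_left]
    intro t
    have h1 : Continuous fun u : Set.Icc (0 : ℝ) 1 × Set.Icc (0 : ℝ) 1 => F.front t u.1 :=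
      continuous_between continuous_const continuous_const
        (continuous_subtype_val.comp continuous_fst) fun u => u.1.2
    exact continuous_between h1 ((F.h t).1.continuous.comp h1)
      (continuous_subtype_val.comp continuous_snd) fun u => u.2.2
  have hΞ : Continuous Ξ := by
    rw [continuous_prod_of_discrete_left]
    intro t
    exact continuous_sphereMap.comp (f := fun u : Set.Icc (0 : ℝ) 1 × Set.Icc (0 : ℝ) 1 =>
      (((t : ℕ) + (u.1 : ℝ)) / F.n, (u.2 : ℝ))) (by fun_prop)
  -- points on chords of the same latitude
  have hchord : ∀ u u', lat u = lat u' → F.front u.1 u.2.1 = F.front u'.1 u'.2.1 ∧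
      F.back u.1 u.2.1 = F.back u'.1 u'.2.1 := by
    intro u u' h
    refine F.front_back_eq u.1.2 u'.1.2 u.2.1.2 u'.2.1.2 ?_
    exact (div_left_inj' hn0.ne').mp h
  have hdeg : ∀ u, F.front u.1 u.2.1 = F.back u.1 u.2.1 ↔ lat u = 0 ∨ lat u = 1 := by
    intro u
    rw [F.front_eq_back_iff u.1.2 u.2.1.2, div_eq_one_iff_eq hn0.ne', div_eq_zero_iff]
    simp [hn0.ne']
  have hfib : ∀ u u', Θ u = Θ u' → Ξ u = Ξ u' := by
    intro u u' h
    have hl : lat u = lat u' := by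
      rcases lt_trichotomy (((u.1 : ℕ) : ℝ) + (u.2.1 : ℝ)) ((u'.1 : ℕ) + (u'.2.1 : ℝ))
        with hlt | heq | hlt
      · exact absurd h (F.strip_ne u.1.2 u'.1.2 u.2.1.2 u'.2.1.2 u.2.2.2 u'.2.2.2 hlt)
      · exact congrArg (· / (F.n : ℝ)) heq
      · exact absurd h.symm (F.strip_ne u'.1.2 u.1.2 u'.2.1.2 u.2.1.2 u'.2.2.2 u.2.2.2 hlt)
    change between _ _ _ = between _ _ _ at h
    rw [← (hchord u u' hl).1, ← (hchord u u' hl).2] at h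
    change sphereMap _ _ = sphereMap _ _
    rw [← hl]
    rcases between_injective u.2.2.2 u'.2.2.2 h with h1 | h1
    · rw [h1]
    · rcases (hdeg u).mp h1 with h2 | h2
      · rw [h2]
        exact sphereMap_zero _ _
      · rw [h2]
        exact sphereMap_one _ _
  refine F.isPuncturedSphere_of_maps hΘ hΞ ?_ ?_ hfib ?_ ?_
  · apply subset_antisymm
    · rintro _ ⟨u, rfl⟩
      exact F.X.between_mem_outer (F.front_mem_outer u.1.2 u.2.1.2)
        (F.back_mem_outer u.1.2 u.2.1.2) u.2.2.2.1 u.2.2.2.2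
    · rw [← F.X.closure_inner]
      refine (isCompact_range hΘ).isClosed.closure_subset_iff.mpr fun z hz => ?_
      obtain ⟨t, ht, a, ha, τ, hτ, e⟩ := F.exists_strip_eq hz
      exact ⟨(⟨t, ht⟩, ⟨a, ha⟩, ⟨τ, hτ⟩), e⟩
  · intro y
    obtain ⟨s, hs, τ, hτ, rfl⟩ := exists_sphereMap_eq y
    obtain ⟨t, a, ha, e⟩ : ∃ t : Fin F.n, ∃ a ∈ Set.Icc (0 : ℝ) 1, ((t : ℕ) : ℝ) + a = s * F.n := by
      have h0 : 0 ≤ s * F.n := mul_nonneg hs.1 hn0.le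
      rcases hs.2.eq_or_lt with rfl | h1
      · refine ⟨⟨F.n - 1, by omega⟩, 1, by simp, ?_⟩
        simp only
        rw [Nat.cast_sub (by omega)]
        simp
      · refine ⟨⟨⌊s * F.n⌋₊, ?_⟩, s * F.n - ⌊s * F.n⌋₊, ⟨?_, ?_⟩, by ring⟩
        · rw [Nat.floor_lt h0]
          nlinarith
        · linarith [Nat.floor_le h0]
        · linarith [Nat.lt_floor_add_one (s * F.n)]
    refine ⟨(t, ⟨a, ha⟩, ⟨τ, hτ⟩), ?_⟩
    change sphereMap (((t : ℕ) + a) / F.n) τ = _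
    rw [e, mul_div_cancel_right₀ _ hn0.ne']
  · intro u u' h
    obtain ⟨hl, h1⟩ := sphereMap_inj (hlat u) (hlat u') u.2.2.2 u'.2.2.2 h
    obtain ⟨e1, e2⟩ := hchord u u' hl
    have e3 : Θ u' = between (F.front u.1 u.2.1) (F.back u.1 u.2.1) u'.2.2 := by
      rw [e1, e2]; rfl
    have e4 : Θ u = between (F.front u.1 u.2.1) (F.back u.1 u.2.1) u.2.2 := rfl
    have hdeg' : lat u = 0 ∨ lat u = 1 → ∃ g ∈ Γ, g.1 (Θ u) = Θ u' := by
      intro h2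
      refine ⟨1, Γ.one_mem, ?_⟩
      rw [e3, e4, ← (hdeg u).mpr h2, between_self _ u.2.2.2.1 u.2.2.2.2,
        between_self _ u'.2.2.2.1 u'.2.2.2.2]
      rfl
    rcases h1 with h1 | h1 | h1 | ⟨h1, h2⟩ | ⟨h1, h2⟩
    · exact hdeg' (Or.inl h1)
    · exact hdeg' (Or.inr h1)
    · refine ⟨1, Γ.one_mem, ?_⟩
      rw [e3, e4, h1]
      rfl
    · refine ⟨F.h u.1, F.h_mem _ u.1.2, ?_⟩
      rw [e3, e4, h1, h2, between_zero, between_one]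
      rfl
    · refine ⟨(F.h u.1)⁻¹, Γ.inv_mem (F.h_mem _ u.1.2), ?_⟩
      rw [e3, e4, h1, h2, between_zero, between_one]
      exact inv_apply_apply _ _
  · intro t ht u u' h e
    obtain ⟨a, a0, a1, ha⟩ := (mem_geodesic_iff (F.X.v_ne_succ (by omega))).mp h
    have haI : a ∈ Set.Icc (0 : ℝ) 1 := ⟨a0.le, a1.le⟩
    have hu : Θ u = F.front t a := eq_of_coe_klein_eq (by rw [ha, F.klein_front t haI])
    have h1 : Ξ u = sphereMap ((t + a) / F.n) 0 :=
      hfib u (⟨t, ht⟩, ⟨a, haI⟩, ⟨0, by simp⟩) (hu.trans (between_zero _ _).symm)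
    have h2 : Ξ u' = sphereMap ((t + a) / F.n) 1 :=
      hfib u' (⟨t, ht⟩, ⟨a, haI⟩, ⟨1, by simp⟩) ((by rw [e, hu]; rfl : Θ u' = F.back t a).trans
        (between_one _ _).symm)
    rw [h1, h2, sphereMap_zero_one]

end FoldedPolygon

end Mating

end

theorem mainTheorem9 (P : Mating.PiecewiseMobius)
    (hmateable : P.IsMateable)
    (hminimal : P.IsMinimal)
    (htorsion : Mating.IsTorsionFree P.group)
    (hfolding : ¬ P.HasFolding)
    (hequiv : P.IsEdgeOrbitEquivalent P.group) :
    (P.extImage (frontier P.R) = frontier P.R ∨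
      ∀ e, P.IsEdge e → ∃ f, P.ExtReaches e f ∧ P.IsDiagonal f ∧
        Mating.geodesic f ⊆ P.innerDomainClosure) ∧
    P.innerDomainClosure ⊆ P.R ∧
    (∀ e, P.IsEdge e → ∃ f, P.ExtStep e f ∧
      (P.IsEdge f ∨ (P.IsDiagonal f ∧ Mating.geodesic f ⊆ P.innerDomainClosure))) ∧
    Mating.IsPuncturedSphere (Mating.QuotientSurface P.group) := by
  obtain ⟨⟨-, hexp, hcov, hmarkov⟩, -, -⟩ := hmateable
  have H : P.StandingAssumptions :=
    ⟨P.three_le_k hcov, hmarkov, hexp, hminimal, htorsion, hfolding, hequiv⟩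
  have hA : Continuous P.A := hcov.1.continuous
  rcases H.hits_or_isEdge with hall | hE
  · refine ⟨Or.inr fun e he => ?_, H.innerDomainClosure_subset_R, fun e he => ?_, ?_⟩
    · obtain ⟨f, h1, h2, h3⟩ := H.exists_fixed_of_hits he (hall e he)
      exact ⟨f, h1, h2, H.geodesic_subset_of_isDiagonal hall h2 h3⟩
    · refine ⟨e.map P.A, H.extStep_map he, ?_⟩
      rcases H.map_isEdge_or he with h | ⟨h1, h2⟩
      · exact Or.inl h
      · refine Or.inr ⟨h1, H.geodesic_subset_of_isDiagonal hall h1 fun p hp => ?_⟩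
        obtain ⟨q, hq, rfl⟩ := Sym2.mem_map.mp hp
        exact h2 q hq
    · obtain ⟨F⟩ := H.exists_foldedPolygon_of_hits hA hall
      exact F.isPuncturedSphere
  · refine ⟨Or.inl (H.extImage_frontier hE), H.innerDomainClosure_subset_R,
      fun e he => ⟨e.map P.A, H.extStep_map he, Or.inl (hE e he)⟩, ?_⟩
    obtain ⟨F⟩ := H.exists_foldedPolygon_of_isEdge_map hA hE
    exact F.isPuncturedSphere
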